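/- Let $\mathbb{T}=\mathbb{R}/2\pi\mathbb{Z}$ and $\langle x\rangle=(1+x^2)^{1/2}$. For $s\in\mathbb{R}$, $H^{s}(\mathbb{T})$ is the space of periodic distributions $f$ with $\|f\|_{H^s}^2=\sum_{n\in\mathbb{Z}}\langle n\rangle^{2s}|\hat f(n)|^2<\infty$, where $\hat f(n)=\frac1{2\pi}\langle f,e^{-inx}\rangle$, and $e^{it\Delta}f=\sum_{n}\hat f(n)e^{-in^2t}e^{inx}$. For $b>\frac12$, $X^{0,b}(\mathbb{R}\times\mathbb{T})$ is the space of functions $F$ on $\mathbb{R}\times\mathbb{T}$ with $\|F\|_{X^{0,b}}^2=\sum_{n}\int_{\mathbb{R}}\langle\tau+n^2\rangle^{2b}|\widetilde F(\tau,n)|^2\,d\tau<\infty$, where $\widetilde F(\tau,n)=\frac1{2\pi}\int_{\mathbb{R}}\int_{-\pi}^{\pi}e^{-i(\tau t+nx)}F(t,x)\,dx\,dt$ (extended by density), and $X^{0,b}([-T,T]\times\mathbb{T})$ is the space of their restrictions to $[-T,T]\times\mathbb{T}$, with the infimum of the norms of the extensions as norm. Put $$Y^{0,b}_T(f)=e^{it\Delta}f+X^{0,b}([-T,T]\times\mathbb{T}).$$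 A solution on $[-T,T]$ with data $f$ is a $u$ with $u(0)=f$ and $i\partial_tu+\Delta u=\kappa\overline{u}^2$ in the sense of distributions on $(-T,T)\times\mathbb{T}$, where $\overline{u}^2$ is the limit in the sense of distributions, as $N\to\infty$, of $\big(\overline{P_Nu}\big)^2$ with $P_Nu=\sum_{|n|\le N}\hat u(t,n)e^{inx}$. **Theorem.** Let $\kappa=\pm1$, $-\frac12<s_0\le 0$ and $f\in H^{s_0}(\mathbb{T})$. Then there exist $b>\frac12$ and $T>0$ such that there is a unique solution $u$ on $[-T,T]$ with data $f$ in the space $Y^{0,b}_T(f)$. Moreover, for every $0<T'<T$ there is $R=R(T')>0$ such that every $g\in H^{s_0}(\mathbb{T})$ with $\|g-f\|_{H^{s_0}}<R$ has a unique solution $u_g$ on $[-T',T']$ with data $g$ in $Y^{0,b}_{T'}(g)$, and the map $g\mapsto u_g$ is Lipschitz on this ball: there is $L$ such that for all $g_1,g_2$ in it $$\big\|(u_{g_1}-e^{it\Delta}g_1)-(u_{g_2}-e^{it\Delta}g_2)\big\|_{X^{0,b}([-T',T']\times\mathbb{T})}\le L\|g_1-g_2\|_{H^{s_0}}$$ and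 $$\|u_{g_1}(t)-u_{g_2}(t)\|_{H^{s_0}}\le L\|g_1-g_2\|_{H^{s_0}}\qquad\text{for all }|t|\le T'.$$ -/

import Mathlib

open scoped ContDiff ENNReal NNReal Topology
open MeasureTheory Filter Set

noncomputable section

namespace NLSTorus

/-- The bracket `⟨x⟩ = (1 + x²)^{1/2}`. -/
def bracket (x : ℝ) : ℝ := Real.sqrt (1 + x ^ 2)

/-- `C^∞(𝕋)` for `𝕋 = ℝ / 2πℤ`: the smooth `2π`-periodic functions `ℝ → ℂ`. -/
def TestFn : Submodule ℂ (ℝ → ℂ) where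
  carrier := {φ | ContDiff ℝ ∞ φ ∧ Function.Periodic φ (2 * Real.pi)}
  add_mem' := fun ha hb => ⟨ha.1.add hb.1, ha.2.add hb.2⟩
  zero_mem' := ⟨contDiff_const, fun _ => rfl⟩
  smul_mem' := fun c _ ha => ⟨contDiff_const.smul ha.1, ha.2.smul c⟩

/-- `x ↦ e^{inx}`. -/
def expFn (n : ℤ) (x : ℝ) : ℂ := Complex.exp (Complex.I * n * x)

theorem expFn_mem (n : ℤ) : expFn n ∈ TestFn := by
  refine ⟨?_, fun x => ?_⟩
  · have h : ContDiff ℝ ∞ (fun x : ℝ => (x : ℂ)) := Complex.ofRealCLM.contDiff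
    exact (contDiff_const.mul h).cexp
  · unfold expFn
    rw [Complex.exp_eq_exp_iff_exists_int]
    exact ⟨n, by push_cast; ring⟩

/-- `Δ = ∂ₓ²` on `C^∞(𝕋)`. -/
def laplacian (θ : TestFn) : TestFn :=
  ⟨deriv (deriv θ.1), by
    have key : ∀ φ : ℝ → ℂ, φ ∈ TestFn → deriv φ ∈ TestFn := by
      rintro φ ⟨h1, h2⟩
      refine ⟨(contDiff_infty_iff_deriv.1 h1).2, fun x => ?_⟩
      rw [← deriv_comp_add_const]
      congr 1
      funext y
      exact h2 y
    exact key _ (key _ θ.2)⟩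

/-- `𝒟'(𝕋)`: the linear functionals on `C^∞(𝕋)` that are continuous, i.e. bounded by some
`C^k` norm. -/
def Distr : Submodule ℂ (TestFn →ₗ[ℂ] ℂ) where
  carrier := {Λ | ∃ (k : ℕ) (C : ℝ), ∀ (φ : TestFn) (M : ℝ),
    (∀ j ≤ k, ∀ x, ‖iteratedDeriv j φ.1 x‖ ≤ M) → ‖Λ φ‖ ≤ C * M}
  add_mem' := by
    rintro Λ Λ' ⟨k, C, h⟩ ⟨k', C', h'⟩
    refine ⟨max k k', C + C', fun φ M hM => ?_⟩
    have e := h φ M fun j hj => hM j (hj.trans (le_max_left _ _))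
    have e' := h' φ M fun j hj => hM j (hj.trans (le_max_right _ _))
    calc ‖(Λ + Λ') φ‖ ≤ ‖Λ φ‖ + ‖Λ' φ‖ := norm_add_le _ _
      _ ≤ (C + C') * M := by linarith
  zero_mem' := ⟨0, 0, fun φ M _ => by simp⟩
  smul_mem' := by
    rintro c Λ ⟨k, C, h⟩
    refine ⟨k, ‖c‖ * C, fun φ M hM => ?_⟩
    rw [LinearMap.smul_apply, norm_smul, mul_assoc]
    exact mul_le_mul_of_nonneg_left (h φ M hM) (norm_nonneg c)

/-- The pairing `⟨Λ, θ⟩` of a distribution and a test function; a function `g` corresponds to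
`θ ↦ ∫_{-π}^{π} g θ dx`. -/
def pair (Λ : Distr) (θ : TestFn) : ℂ := Λ.1 θ

/-- The Fourier coefficient `(1/2π) ⟨Λ, e^{-inx}⟩`. -/
def coeff (Λ : Distr) (n : ℤ) : ℂ :=
  (2 * Real.pi : ℂ)⁻¹ * pair Λ ⟨expFn (-n), expFn_mem (-n)⟩

/-- The norm `(∑ₙ ⟨n⟩^{2s} |f̂(n)|²)^{1/2}` of `H^s(𝕋)`, `∞` off `H^s(𝕋)`. -/
def hsNorm (s : ℝ) (f : Distr) : ℝ≥0∞ :=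
  (∑' n : ℤ, ENNReal.ofReal (bracket n ^ (2 * s)) * ‖coeff f n‖ₑ ^ 2) ^ (1 / 2 : ℝ)

/-- `f ∈ H^s(𝕋)`. -/
def MemHs (s : ℝ) (f : Distr) : Prop := hsNorm s f < ⊤

/-- The norm `(∑ₙ ∫ ⟨τ + n²⟩^{2b} ⟨n⟩^{2s} |G(n, τ)|² dτ)^{1/2}` of a function `G` of the
space-time frequencies. -/
def weightedNorm (s b : ℝ) (G : ℤ → ℝ → ℂ) : ℝ≥0∞ :=
  (∑' n : ℤ, ∫⁻ τ : ℝ, ENNReal.ofReal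
    (bracket (τ + (n : ℝ) ^ 2) ^ (2 * b) * bracket n ^ (2 * s)) * ‖G n τ‖ₑ ^ 2) ^ (1 / 2 : ℝ)

/-- `V t n` is, for `|t| ≤ T`, the `n`-th spatial Fourier coefficient at time `t` of the function on
`ℝ × 𝕋` with space-time Fourier transform `G` (inversion formula in time). -/
def IsExtension (T : ℝ) (V : ℝ → ℤ → ℂ) (G : ℤ → ℝ → ℂ) : Prop :=
  (∀ n, Integrable (G n)) ∧
    ∀ t ∈ Icc (-T) T, ∀ n,
      V t n = (2 * Real.pi : ℂ)⁻¹ * ∫ τ : ℝ, Complex.exp (Complex.I * τ * t) * G n τ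

/-- The norm of the restriction space `X^{s,b}([-T,T] × 𝕋)`, for `b > 1/2`: the infimum of the
`X^{s,b}(ℝ × 𝕋)` norms of the extensions, `∞` if there is none. A function on `[-T,T] × 𝕋` is given
by its spatial Fourier coefficients `V t n`. For `b > 1/2` a measurable `G` of finite
weighted norm has all its `G n` integrable, so that no element of `X^{s,b}(ℝ × 𝕋)` is left out. -/
def xNorm (s b T : ℝ) (V : ℝ → ℤ → ℂ) : ℝ≥0∞ :=
  ⨅ (G : ℤ → ℝ → ℂ) (_ : IsExtension T V G), weightedNorm s b G

/-- The `n`-th Fourier coefficient of `e^{itΔ} f`. -/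
def freeCoeff (f : Distr) (t : ℝ) (n : ℤ) : ℂ :=
  Complex.exp (-Complex.I * (n : ℂ) ^ 2 * t) * coeff f n

/-- The Fourier coefficients of `u(t) - e^{itΔ} f`. -/
def remainder (f : Distr) (u : ℝ → Distr) (t : ℝ) (n : ℤ) : ℂ :=
  coeff (u t) n - freeCoeff f t n

/-- The space `e^{itΔ} f + X^{0,b}([-T,T] × 𝕋)`. -/
def InY (b T : ℝ) (f : Distr) (u : ℝ → Distr) : Prop :=
  xNorm 0 b T (remainder f u) < ⊤

/-- The frequency truncation `∑_{|n| ≤ N} ĝ(n) e^{inx}`. -/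
def trunc (N : ℕ) (g : Distr) (x : ℝ) : ℂ :=
  ∑ n ∈ Finset.Icc (-(N : ℤ)) N, coeff g n * expFn n x

/-- `i ∂ₜ u + Δu = κ ū²` in the sense of distributions on `(-T,T) × 𝕋`, tested against the products
`η(t) θ(x)`, and `u(0) = f`. The product `ū²` is the limit, in the sense of distributions, of
the squares of the conjugates of the frequency truncations of `u`. -/
def IsSolution (κ T : ℝ) (f : Distr) (u : ℝ → Distr) : Prop :=
  u 0 = f ∧
    ∀ (η : ℝ → ℂ) (θ : TestFn), ContDiff ℝ ∞ η → HasCompactSupport η →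
      tsupport η ⊆ Ioo (-T) T →
      Tendsto
        (fun N : ℕ => (κ : ℂ) * ∫ t in (-T)..T, η t *
          ∫ x in (-Real.pi)..Real.pi, (starRingEnd ℂ (trunc N (u t) x)) ^ 2 * θ.1 x)
        atTop
        (𝓝 (∫ t in (-T)..T,
          (-Complex.I * deriv η t * pair (u t) θ + η t * pair (u t) (laplacian θ))))

/-- `u` is, up to its values outside `[-T,T]`, the unique solution with `u(0) = f` in
`e^{itΔ} f + X^{0,b}([-T,T] × 𝕋)`. -/
def IsUniqueSolution (κ b T : ℝ) (f : Distr) (u : ℝ → Distr) : Prop :=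
  (InY b T f u ∧ IsSolution κ T f u) ∧
    ∀ w : ℝ → Distr, InY b T f w → IsSolution κ T f w → ∀ t ∈ Icc (-T) T, w t = u t

end NLSTorus

end

open NLSTorus

noncomputable section

namespace NLSTorus


/-! Both factors of ū² are conjugated, so a frequency (τ, n) of the product and the frequencies of
its two factors add up to zero after a change of sign. Hence the three modulations τ + n² add up to
the sum of the three squares n², with no cancellation, and the largest modulation controls ⟨n₁⟩⟨n₂⟩
(`wt_mul_wt_le`). The loss ⟨n₁⟩^{-s}⟨n₂⟩^{-s} caused by data in H^s is therefore paid by one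
modulation when -s ≤ β < 1/2. The other two modulations close the estimate by Cauchy–Schwarz,
because boundedly many lattice points lie near a level set of n² + (n+m)² (`tsum_wt_resonance_le`);
this needs 2β > 1/2. The outcome is X^{s,b} × X^{s,b} → X^{0,-β} (`sqNorm_conv_le`): the product has
regularity 0 even for rough data, which is why u - e^{itΔ}f lies in X^{0,b}.

The Duhamel integral, localised to an interval of length comparable to δ, maps X^{0,-β} to X^{0,b}
and gains the factor δ^{2(1-b-β)} in the squared norm (`lintegral_duhKernel_sq_le`). With b slightly
above 1/2 and β sufficiently below 1/2 the exponent is positive, so for short times the map from w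
to the Duhamel integral of the nonlinearity at e^{itΔ}g + w is a contraction of the unit ball of
X^{0,b}. The time depends only on a bound for the H^s norm of g, and the fixed point is Lipschitz in
g (`Exponents.exists_fixedPoint`).

The equation is posed through limits of truncated squares. Mode by mode, the time primitives of
these squares converge, with uniform bounds, to the Duhamel integral (`tendsto_integral_quad`). The
lemma of du Bois-Reymond then turns the equation into Duhamel's formula, and integration by parts
turns it back.

For uniqueness the free parts cancel, so the difference of two solutions has a representative in
X^{0,b}. On a short interval at whose base point the solutions agree, each representative can be
replaced by another with half the squared norm (`Exponents.exists_smaller_representative`); hence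
the difference vanishes there. The length of the interval depends only on the global norms of the
two solutions, so finitely many steps reach every time in [-T,T]. -/

/-! ### Japanese brackets, weights and lattice sums -/

theorem one_le_bracket (x : ℝ) : 1 ≤ bracket x := by
  unfold bracket
  rw [Real.one_le_sqrt]
  nlinarith [sq_nonneg x]

theorem bracket_pos (x : ℝ) : 0 < bracket x := zero_lt_one.trans_le (one_le_bracket x)

theorem bracket_sq (x : ℝ) : bracket x ^ 2 = 1 + x ^ 2 :=
  Real.sq_sqrt (by positivity)

theorem abs_le_bracket (x : ℝ) : |x| ≤ bracket x :=
  abs_le_of_sq_le_sq' (by rw [bracket_sq]; linarith) (bracket_pos x).le |> abs_le.2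

theorem bracket_le_of_abs_le {x y : ℝ} (h : |x| ≤ |y|) : bracket x ≤ bracket y := by
  unfold bracket
  exact Real.sqrt_le_sqrt (by have := sq_le_sq.2 h; linarith)

theorem continuous_bracket : Continuous bracket := by
  unfold bracket; fun_prop

theorem measurable_bracket : Measurable bracket := continuous_bracket.measurable

theorem bracket_le_one_add_abs (x : ℝ) : bracket x ≤ 1 + |x| := by
  unfold bracket
  rw [Real.sqrt_le_left (by positivity)]
  nlinarith [sq_abs x, abs_nonneg x]

theorem bracket_add_le (x y : ℝ) : bracket (x + y) ≤ bracket x + |y| := by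
  have h : 0 ≤ bracket x + |y| := add_nonneg (bracket_pos x).le (abs_nonneg y)
  conv_lhs => unfold bracket
  rw [Real.sqrt_le_left h]
  have h1 : x * y ≤ bracket x * |y| := (le_abs_self _).trans (by
    rw [abs_mul]; exact mul_le_mul_of_nonneg_right (abs_le_bracket x) (abs_nonneg y))
  nlinarith [bracket_sq x, sq_abs y]

theorem bracket_add_le_mul (x y : ℝ) : bracket (x + y) ≤ 2 * (bracket x * bracket y) := by
  have h := bracket_add_le x y
  nlinarith [abs_le_bracket y, one_le_bracket x, one_le_bracket y]

/-- The `ℝ≥0∞`-valued weight `⟨x⟩^p`. -/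
def wt (p x : ℝ) : ℝ≥0∞ := ENNReal.ofReal (bracket x ^ p)

theorem measurable_wt (p : ℝ) : Measurable (wt p) :=
  (measurable_bracket.pow_const p).ennreal_ofReal

theorem wt_mul (p q x : ℝ) : wt p x * wt q x = wt (p + q) x := by
  unfold wt
  rw [← ENNReal.ofReal_mul (Real.rpow_nonneg (bracket_pos x).le _), Real.rpow_add (bracket_pos x)]

theorem wt_sq (p x : ℝ) : wt p x ^ 2 = wt (2 * p) x := by
  rw [sq, wt_mul, two_mul]

theorem wt_zero (x : ℝ) : wt 0 x = 1 := by simp [wt]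

theorem wt_ne_top (p x : ℝ) : wt p x ≠ ⊤ := ENNReal.ofReal_ne_top

theorem wt_ne_zero (p x : ℝ) : wt p x ≠ 0 := by
  simpa [wt] using Real.rpow_pos_of_pos (bracket_pos x) p

theorem wt_mono {p q : ℝ} (h : p ≤ q) (x : ℝ) : wt p x ≤ wt q x :=
  ENNReal.ofReal_le_ofReal (Real.rpow_le_rpow_of_exponent_le (one_le_bracket x) h)

theorem wt_le_one {p : ℝ} (h : p ≤ 0) (x : ℝ) : wt p x ≤ 1 :=
  (wt_mono h x).trans (wt_zero x).le

/-- Negative powers: a lower bound on the bracket is an upper bound on the weight. -/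
theorem wt_neg_le {p x y c : ℝ} (hp : 0 ≤ p) (hc : 0 < c) (h : bracket y ≤ c * bracket x) :
    wt (-p) x ≤ ENNReal.ofReal (c ^ p) * wt (-p) y := by
  unfold wt
  rw [← ENNReal.ofReal_mul (by positivity)]
  refine ENNReal.ofReal_le_ofReal ?_
  have hx := bracket_pos x
  have hy := bracket_pos y
  rw [Real.rpow_neg hx.le, Real.rpow_neg hy.le, ← div_eq_mul_inv, inv_eq_one_div,
    div_le_div_iff₀ (by positivity) (by positivity), one_mul, ← Real.mul_rpow hc.le hx.le]
  exact Real.rpow_le_rpow hy.le h hp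

theorem wt_neg_anti {p x y : ℝ} (hp : 0 ≤ p) (h : bracket y ≤ bracket x) :
    wt (-p) x ≤ wt (-p) y := by
  have := wt_neg_le (c := 1) hp one_pos (by simpa using h)
  simpa using this

theorem wt_pos_le {p x y c : ℝ} (hp : 0 ≤ p) (hc : 0 ≤ c) (h : bracket y ≤ c * bracket x) :
    wt p y ≤ ENNReal.ofReal (c ^ p) * wt p x := by
  unfold wt
  rw [← ENNReal.ofReal_mul (by positivity), ← Real.mul_rpow hc (bracket_pos x).le]
  exact ENNReal.ofReal_le_ofReal (Real.rpow_le_rpow (bracket_pos y).le h hp)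

theorem lintegral_wt_lt_top {p : ℝ} (hp : 1 < p) : ∫⁻ x : ℝ, wt (-p) x < ⊤ := by
  have h := integrable_rpow_neg_one_add_norm_sq (E := ℝ) (μ := volume) (r := p) (by simpa using hp)
  refine lt_of_le_of_lt (le_of_eq ?_) h.lintegral_lt_top
  refine lintegral_congr fun x => ?_
  unfold wt bracket
  rw [Real.sqrt_eq_rpow, ← Real.rpow_mul (by positivity)]
  congr 2
  · simp
  · ring

/-- The bracket grows by at most a factor 2 over an interval of length one, so each term is
comparable with the integral over one tile of ℝ. The bound does not depend on the shift. -/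
theorem tsum_wt_shift_le {q : ℝ} (hq : 1 < q) (z : ℝ) :
    ∑' n : ℤ, wt (-q) (n + z) ≤ ENNReal.ofReal (2 ^ q) * ∫⁻ x : ℝ, wt (-q) x := by
  have hU : ∫⁻ x : ℝ, wt (-q) x = ∑' n : ℤ, ∫⁻ x in Ioc (z + n) (z + n + 1), wt (-q) x := by
    rw [← lintegral_iUnion (fun _ => measurableSet_Ioc) (pairwise_disjoint_Ioc_add_intCast z),
      iUnion_Ioc_add_intCast, Measure.restrict_univ]
  rw [hU, ← ENNReal.tsum_mul_left]
  refine ENNReal.tsum_le_tsum fun n => ?_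
  rw [← lintegral_const_mul _ (measurable_wt _)]
  have hv : wt (-q) (n + z) = ∫⁻ _ in Ioc (z + n) (z + n + 1), wt (-q) (n + z) := by
    simp
  rw [hv]
  refine setLIntegral_mono' measurableSet_Ioc fun x hx => ?_
  refine wt_neg_le (by linarith) two_pos ?_
  have h1 := bracket_add_le (n + z) (x - (n + z))
  have h2 : |x - (n + z)| ≤ 1 := by
    rw [abs_le]; constructor <;> linarith [hx.1, hx.2]
  have h3 := one_le_bracket (n + z)
  rw [add_sub_cancel] at h1
  linarith

/-- Since ⟨y⟩² ≤ 2⟨2y²⟩, decay of order p in a quadratic variable is decay of order 2p in the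
variable itself. This is how the threshold p > 1/2 arises. -/
theorem wt_two_mul_sq_le {p : ℝ} (hp : 0 ≤ p) (y : ℝ) :
    wt (-p) (2 * y ^ 2) ≤ ENNReal.ofReal (2 ^ p) * wt (-(2 * p)) y := by
  have h : bracket y ^ 2 ≤ 2 * bracket (2 * y ^ 2) := by
    refine le_of_sq_le_sq ?_ (by have := bracket_pos (2 * y ^ 2); positivity)
    rw [mul_pow, bracket_sq, bracket_sq]
    nlinarith [sq_nonneg (y ^ 2 - 1), sq_nonneg y, sq_nonneg (y ^ 2)]
  have hx := bracket_pos (2 * y ^ 2)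
  have hy := bracket_pos y
  unfold wt
  rw [← ENNReal.ofReal_mul (by positivity)]
  refine ENNReal.ofReal_le_ofReal ?_
  rw [Real.rpow_neg hx.le, Real.rpow_neg hy.le, ← div_eq_mul_inv, inv_eq_one_div,
    div_le_div_iff₀ (by positivity) (by positivity), one_mul, ← Real.mul_rpow two_pos.le hx.le,
    Real.rpow_mul hy.le]
  refine Real.rpow_le_rpow (by positivity) (by simpa using h) hp

/-- A nonnegative v only enlarges the bracket. If v = -2d², then |2y² + v| = 2|y-d||y+d| dominates
2(y-d)² or 2(y+d)² according to the sign of y, so two translates of the sum with v = 0 suffice. -/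
theorem tsum_wt_quadratic_le {p : ℝ} (hp : 1 / 2 < p) :
    ∃ C : ℝ≥0, ∀ z v : ℝ, ∑' n : ℤ, wt (-p) (2 * (n + z) ^ 2 + v) ≤ C := by
  set K : ℝ≥0∞ := ENNReal.ofReal (2 ^ p) *
    (ENNReal.ofReal (2 ^ (2 * p)) * ∫⁻ x : ℝ, wt (-(2 * p)) x) with hK
  have hKt : K ≠ ⊤ := by
    have := (lintegral_wt_lt_top (p := 2 * p) (by linarith)).ne
    simp [hK, ENNReal.mul_eq_top, this]
  have hp0 : 0 ≤ p := by linarith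
  have hbase : ∀ z : ℝ, ∑' n : ℤ, wt (-p) (2 * (n + z) ^ 2) ≤ K := fun z =>
    calc ∑' n : ℤ, wt (-p) (2 * (n + z) ^ 2)
        ≤ ∑' n : ℤ, ENNReal.ofReal (2 ^ p) * wt (-(2 * p)) (n + z) :=
          ENNReal.tsum_le_tsum fun n => wt_two_mul_sq_le hp0 _
      _ ≤ K := by
          rw [ENNReal.tsum_mul_left]
          exact mul_le_mul_right (tsum_wt_shift_le (by linarith) z) _
  refine ⟨(K + K).toNNReal, fun z v => ?_⟩
  rw [ENNReal.coe_toNNReal (by simp [hKt])]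
  rcases le_total 0 v with hv | hv
  · refine (ENNReal.tsum_le_tsum fun n => ?_).trans ((hbase z).trans le_self_add)
    refine wt_neg_anti hp0 (bracket_le_of_abs_le ?_)
    rw [abs_of_nonneg (by positivity), abs_of_nonneg (by positivity)]
    linarith
  · set d : ℝ := Real.sqrt (-v / 2) with hd
    have hd0 : 0 ≤ d := Real.sqrt_nonneg _
    have hd2 : v = -2 * d ^ 2 := by rw [hd, Real.sq_sqrt (by linarith)]; ring
    calc ∑' n : ℤ, wt (-p) (2 * (n + z) ^ 2 + v)
        ≤ ∑' n : ℤ, (wt (-p) (2 * (n + (z - d)) ^ 2) + wt (-p) (2 * (n + (z + d)) ^ 2)) := by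
          refine ENNReal.tsum_le_tsum fun n => ?_
          have key : ∀ y : ℝ, 0 ≤ y → 2 * (y - d) ^ 2 ≤ |2 * y ^ 2 + v| := fun y hy => by
            have e : 2 * y ^ 2 + v = 2 * ((y - d) * (y + d)) := by rw [hd2]; ring
            rw [e, abs_mul, abs_mul, abs_two, abs_of_nonneg (add_nonneg hy hd0), ← sq_abs (y - d),
              sq]
            have : |y - d| ≤ y + d := abs_le.2 ⟨by linarith, by linarith⟩
            nlinarith [abs_nonneg (y - d)]
          rcases le_total 0 ((n : ℝ) + z) with h | h
          · refine le_add_right (wt_neg_anti hp0 (bracket_le_of_abs_le ?_))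
            rw [abs_of_nonneg (by positivity)]
            have := key _ h
            rwa [add_sub_assoc] at this
          · refine le_add_left (wt_neg_anti hp0 (bracket_le_of_abs_le ?_))
            rw [abs_of_nonneg (by positivity)]
            have := key (-(n + z)) (by linarith)
            have e1 : (-((n : ℝ) + z) - d) ^ 2 = (n + (z + d)) ^ 2 := by ring
            rwa [neg_sq, e1] at this
      _ ≤ K + K := by
          rw [ENNReal.tsum_add]
          exact add_le_add (hbase _) (hbase _)

/-- The number of lattice points near a level set of the resonance function is bounded. -/
theorem tsum_wt_resonance_le {p : ℝ} (hp : 1 / 2 < p) :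
    ∃ C : ℝ≥0, ∀ (m : ℤ) (c : ℝ),
      ∑' n : ℤ, wt (-p) (c + (n : ℝ) ^ 2 + ((n + m : ℤ) : ℝ) ^ 2) ≤ C := by
  obtain ⟨C, hC⟩ := tsum_wt_quadratic_le hp
  -- Completing the square: n² + (n+m)² = 2(n + m/2)² + m²/2.
  refine ⟨C, fun m c => le_trans (le_of_eq ?_) (hC (m / 2) (c + m ^ 2 / 2))⟩
  refine tsum_congr fun n => ?_
  congr 1
  push_cast
  ring

/-- Cauchy–Schwarz for `ℝ≥0∞`-valued functions. -/
theorem sq_lintegral_mul_le {α : Type*} [MeasurableSpace α] (μ : Measure α) {f g : α → ℝ≥0∞}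
    (hf : AEMeasurable f μ) (hg : AEMeasurable g μ) :
    (∫⁻ x, f x * g x ∂μ) ^ 2 ≤ (∫⁻ x, f x ^ 2 ∂μ) * ∫⁻ x, g x ^ 2 ∂μ := by
  have h := ENNReal.lintegral_mul_le_Lp_mul_Lq μ Real.HolderConjugate.two_two hf hg
  simp only [Pi.mul_apply, ENNReal.rpow_two] at h
  calc (∫⁻ x, f x * g x ∂μ) ^ 2
      ≤ ((∫⁻ x, f x ^ 2 ∂μ) ^ (1 / 2 : ℝ) * (∫⁻ x, g x ^ 2 ∂μ) ^ (1 / 2 : ℝ)) ^ 2 := by gcongr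
    _ = _ := by
        rw [mul_pow, ← ENNReal.rpow_two, ← ENNReal.rpow_two, ← ENNReal.rpow_mul,
          ← ENNReal.rpow_mul]
        norm_num


/-! ### Space-time frequencies and the bilinear estimate -/

/-- The measure `∑ₙ ∫ dτ` on the space-time frequencies. -/
abbrev freqMeasure : Measure (ℤ × ℝ) := (Measure.count : Measure ℤ).prod (volume : Measure ℝ)

/-- The modulation `τ + n²`. -/
def modn (x : ℤ × ℝ) : ℝ := x.2 + (x.1 : ℝ) ^ 2

@[fun_prop]
theorem measurable_intCast_fst : Measurable fun x : ℤ × ℝ => (x.1 : ℝ) :=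
  (measurable_from_top (f := fun n : ℤ => (n : ℝ))).comp measurable_fst

@[fun_prop]
theorem measurable_modn : Measurable modn := by
  unfold modn; fun_prop

attribute [fun_prop] measurable_wt

@[fun_prop]
theorem measurable_wt_comp {α : Type*} [MeasurableSpace α] {f : α → ℝ} (p : ℝ)
    (hf : Measurable f) : Measurable fun x => wt p (f x) := (measurable_wt p).comp hf

@[fun_prop]
theorem measurable_modn_comp {α : Type*} [MeasurableSpace α] {f : α → ℤ × ℝ}
    (hf : Measurable f) : Measurable fun x => modn (f x) := measurable_modn.comp hf

theorem measurePreserving_neg_sub (y : ℤ × ℝ) :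
    MeasurePreserving (fun x : ℤ × ℝ => -x - y) freqMeasure freqMeasure := by
  have h1 : MeasurePreserving (fun n : ℤ => -n - y.1) Measure.count Measure.count := by
    refine ⟨measurable_from_top, ?_⟩
    ext s hs
    rw [Measure.map_apply measurable_from_top hs, Measure.count_apply hs,
      Measure.count_apply (measurable_from_top hs)]
    have : (fun n : ℤ => -n - y.1) ⁻¹' s = (fun n : ℤ => -n - y.1) '' s := by
      ext n
      constructor
      · intro h; exact ⟨-n - y.1, h, by ring⟩
      · rintro ⟨m, h, rfl⟩
        simpa using h
    rw [this, Function.Injective.encard_image]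
    intro a b h
    have : -a - y.1 = -b - y.1 := h
    linarith
  have h2 : MeasurePreserving (fun n : ℝ => -n - y.2) volume volume := by
    have := (measurePreserving_sub_right (volume : Measure ℝ) y.2).comp
      (Measure.measurePreserving_neg (volume : Measure ℝ))
    exact this
  exact h1.prod h2

theorem lintegral_neg_sub (y : ℤ × ℝ) {f : ℤ × ℝ → ℝ≥0∞} (hf : Measurable f) :
    ∫⁻ x, f (-x - y) ∂freqMeasure = ∫⁻ x, f x ∂freqMeasure :=
  (measurePreserving_neg_sub y).lintegral_comp hf

theorem lintegral_neg_sub' (y : ℤ × ℝ) {f : ℤ × ℝ → ℝ≥0∞} (hf : Measurable f) :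
    ∫⁻ x, f (-y - x) ∂freqMeasure = ∫⁻ x, f x ∂freqMeasure := by
  rw [← lintegral_neg_sub y hf]
  refine lintegral_congr fun x => ?_
  congr 1
  abel

theorem lintegral_freqMeasure {f : ℤ × ℝ → ℝ≥0∞} (hf : Measurable f) :
    ∫⁻ x, f x ∂freqMeasure = ∑' n : ℤ, ∫⁻ τ : ℝ, f (n, τ) := by
  rw [lintegral_prod _ hf.aemeasurable, lintegral_count]

/-- With the modulation σ of y as the variable in place of τ, the other modulation becomes a
quadratic polynomial in n up to sign conventions already matched by the reflection. The sum over n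
is bounded uniformly since 2β > 1/2, and ⟨σ⟩^{-2b} is integrable since 2b > 1. -/
theorem lintegral_wt_modn_le {β b : ℝ} (hβ : 1 / 4 < β) (hb : 1 / 2 < b) :
    ∃ C : ℝ≥0, ∀ x : ℤ × ℝ,
      ∫⁻ y, wt (-(2 * β)) (modn (-x - y)) * wt (-(2 * b)) (modn y) ∂freqMeasure ≤ C := by
  obtain ⟨C, hC⟩ := tsum_wt_resonance_le (p := 2 * β) (by linarith)
  have hI := lintegral_wt_lt_top (p := 2 * b) (by linarith)
  refine ⟨C * (∫⁻ σ : ℝ, wt (-(2 * b)) σ).toNNReal, fun x => ?_⟩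
  rw [ENNReal.coe_mul, ENNReal.coe_toNNReal hI.ne, lintegral_freqMeasure (by fun_prop)]
  calc ∑' n : ℤ, ∫⁻ τ : ℝ, wt (-(2 * β)) (modn (-x - (n, τ))) * wt (-(2 * b)) (modn (n, τ))
      = ∑' n : ℤ, ∫⁻ σ : ℝ, wt (-(2 * β)) ((-x.2 - σ) + (n : ℝ) ^ 2 + ((n + x.1 : ℤ) : ℝ) ^ 2)
          * wt (-(2 * b)) σ := by
        refine tsum_congr fun n => ?_
        rw [← lintegral_add_right_eq_self (μ := (volume : Measure ℝ)) _ (-(n : ℝ) ^ 2)]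
        refine lintegral_congr fun τ => ?_
        congr 2
        · simp only [modn, Prod.fst_sub, Prod.snd_sub, Prod.fst_neg, Prod.snd_neg]
          push_cast
          ring
        · simp [modn]
    _ = ∫⁻ σ : ℝ, (∑' n : ℤ, wt (-(2 * β)) ((-x.2 - σ) + (n : ℝ) ^ 2 +
          ((n + x.1 : ℤ) : ℝ) ^ 2)) * wt (-(2 * b)) σ := by
        rw [← lintegral_tsum (fun n => by fun_prop)]
        simp_rw [ENNReal.tsum_mul_right]
    _ ≤ ∫⁻ σ : ℝ, C * wt (-(2 * b)) σ :=
        lintegral_mono fun σ => mul_le_mul_left (hC _ _) _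
    _ = C * ∫⁻ σ : ℝ, wt (-(2 * b)) σ := lintegral_const_mul _ (measurable_wt _)

/-- The square of the `X^{s,b}` norm of a function of the frequencies, given its modulus. -/
def sqNorm (s b : ℝ) (g : ℤ × ℝ → ℝ≥0∞) : ℝ≥0∞ :=
  ∫⁻ x, wt (2 * b) (modn x) * wt (2 * s) x.1 * g x ^ 2 ∂freqMeasure

/-- The modulus of the Fourier transform of a product of conjugates. -/
def conv (g₁ g₂ : ℤ × ℝ → ℝ≥0∞) (x : ℤ × ℝ) : ℝ≥0∞ :=
  ∫⁻ y, g₁ y * g₂ (-x - y) ∂freqMeasure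

theorem measurable_conv {g₁ g₂ : ℤ × ℝ → ℝ≥0∞} (h₁ : Measurable g₁) (h₂ : Measurable g₂) :
    Measurable (conv g₁ g₂) := by
  unfold conv
  exact Measurable.lintegral_prod_right' (f := fun p : (ℤ × ℝ) × (ℤ × ℝ) =>
    g₁ p.2 * g₂ (-p.1 - p.2)) (by fun_prop)

theorem add_sq_le_two (a b : ℝ≥0∞) : (a + b) ^ 2 ≤ 2 * (a ^ 2 + b ^ 2) := by
  rcases eq_or_ne a ⊤ with rfl | ha
  · simp
  rcases eq_or_ne b ⊤ with rfl | hb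
  · simp
  lift a to ℝ≥0 using ha
  lift b to ℝ≥0 using hb
  have h : (a + b) ^ 2 ≤ 2 * (a ^ 2 + b ^ 2) := by
    rw [← NNReal.coe_le_coe]
    push_cast
    exact add_sq_le
  exact_mod_cast h

theorem lintegral_lintegral_sq_mul_sq {f₁ f₂ : ℤ × ℝ → ℝ≥0∞} (h₁ : Measurable f₁)
    (h₂ : Measurable f₂) :
    ∫⁻ x, ∫⁻ y, f₁ y ^ 2 * f₂ (-x - y) ^ 2 ∂freqMeasure ∂freqMeasure =
      (∫⁻ x, f₁ x ^ 2 ∂freqMeasure) * ∫⁻ x, f₂ x ^ 2 ∂freqMeasure := by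
  rw [lintegral_lintegral_swap (by fun_prop)]
  have : ∀ y, ∫⁻ x, f₁ y ^ 2 * f₂ (-x - y) ^ 2 ∂freqMeasure =
      f₁ y ^ 2 * ∫⁻ x, f₂ x ^ 2 ∂freqMeasure := fun y => by
    rw [lintegral_const_mul _ (by fun_prop),
      lintegral_neg_sub y (f := fun x => f₂ x ^ 2) (by fun_prop)]
  simp_rw [this]
  rw [lintegral_mul_const _ (by fun_prop)]

/-- The bilinear estimate when the output carries no weight. -/
theorem lintegral_conv_sq_le {β b : ℝ} (hβ : 1 / 4 < β) (hb : 1 / 2 < b) :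
    ∃ C : ℝ≥0, ∀ f₁ f₂ : ℤ × ℝ → ℝ≥0∞, Measurable f₁ → Measurable f₂ →
      ∫⁻ x, (∫⁻ y, wt (-β) (modn (-x - y)) * wt (-b) (modn y) * (f₁ y * f₂ (-x - y))
        ∂freqMeasure) ^ 2 ∂freqMeasure ≤
      C * ((∫⁻ x, f₁ x ^ 2 ∂freqMeasure) * ∫⁻ x, f₂ x ^ 2 ∂freqMeasure) := by
  obtain ⟨C, hC⟩ := lintegral_wt_modn_le hβ hb
  refine ⟨C, fun f₁ f₂ h₁ h₂ => ?_⟩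
  rw [← lintegral_lintegral_sq_mul_sq h₁ h₂, ← lintegral_const_mul]
  swap
  · exact Measurable.lintegral_prod_right' (f := fun p : (ℤ × ℝ) × (ℤ × ℝ) =>
      f₁ p.2 ^ 2 * f₂ (-p.1 - p.2) ^ 2) (by fun_prop)
  refine lintegral_mono fun x => ?_
  -- Cauchy–Schwarz in y: the squared weights integrate to a constant uniformly in x, and the
  -- remaining double integral factorises.
  refine (sq_lintegral_mul_le _ (by fun_prop) (by fun_prop)).trans ?_
  simp_rw [mul_pow, wt_sq, mul_neg]
  exact mul_le_mul_left (hC x) _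

/-- The bilinear estimate when one of the factors carries no weight. -/
theorem lintegral_wt_conv_sq_le {β b : ℝ} (hβ : 1 / 4 < β) (hb : 1 / 2 < b) :
    ∃ C : ℝ≥0, ∀ f₁ f₂ : ℤ × ℝ → ℝ≥0∞, Measurable f₁ → Measurable f₂ →
      ∫⁻ x, (∫⁻ y, wt (-β) (modn x) * wt (-b) (modn (-x - y)) * (f₁ y * f₂ (-x - y))
        ∂freqMeasure) ^ 2 ∂freqMeasure ≤
      C * ((∫⁻ x, f₁ x ^ 2 ∂freqMeasure) * ∫⁻ x, f₂ x ^ 2 ∂freqMeasure) := by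
  obtain ⟨C, hC⟩ := lintegral_wt_modn_le hβ hb
  refine ⟨C, fun f₁ f₂ h₁ h₂ => ?_⟩
  set I₂ := ∫⁻ x, f₂ x ^ 2 ∂freqMeasure with hI₂
  calc ∫⁻ x, (∫⁻ y, wt (-β) (modn x) * wt (-b) (modn (-x - y)) * (f₁ y * f₂ (-x - y))
        ∂freqMeasure) ^ 2 ∂freqMeasure
      ≤ ∫⁻ x, (∫⁻ y, wt (-(2 * β)) (modn x) * wt (-(2 * b)) (modn (-x - y)) * f₁ y ^ 2
          ∂freqMeasure) * I₂ ∂freqMeasure := by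
        refine lintegral_mono fun x => ?_
        -- Here the weight in x must survive for the outer integration, so both weights stay with f₁
        -- and f₂ alone forms the second factor of Cauchy–Schwarz.
        have := sq_lintegral_mul_le freqMeasure
          (f := fun y => wt (-β) (modn x) * wt (-b) (modn (-x - y)) * f₁ y)
          (g := fun y => f₂ (-x - y)) (by fun_prop) (by fun_prop)
        simp_rw [mul_pow, wt_sq, mul_neg] at this
        rw [lintegral_neg_sub' x (f := fun x => f₂ x ^ 2) (by fun_prop)] at this
        simpa only [mul_assoc] using this
    _ = (∫⁻ y, f₁ y ^ 2 * ∫⁻ x, wt (-(2 * β)) (modn x) * wt (-(2 * b)) (modn (-x - y))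
          ∂freqMeasure ∂freqMeasure) * I₂ := by
        rw [lintegral_mul_const _ (Measurable.lintegral_prod_right'
          (f := fun p : (ℤ × ℝ) × (ℤ × ℝ) => wt (-(2 * β)) (modn p.1) *
            wt (-(2 * b)) (modn (-p.1 - p.2)) * f₁ p.2 ^ 2) (by fun_prop)),
          lintegral_lintegral_swap (by fun_prop)]
        congr 1
        refine lintegral_congr fun y => ?_
        simp only
        rw [lintegral_mul_const _ (by fun_prop), mul_comm]
    _ ≤ (∫⁻ y, f₁ y ^ 2 * C ∂freqMeasure) * I₂ := by
        refine mul_le_mul_left (lintegral_mono fun y => mul_le_mul_right ?_ _) _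
        -- For fixed y the reflection x ↦ -x - y exchanges the two weights' arguments, which gives
        -- the same uniform integral as before.
        refine le_trans (le_of_eq ?_) (hC y)
        rw [← lintegral_neg_sub y (by fun_prop)]
        refine lintegral_congr fun x => ?_
        congr 3 <;> abel
    _ = C * ((∫⁻ x, f₁ x ^ 2 ∂freqMeasure) * I₂) := by
        rw [lintegral_mul_const _ (by fun_prop)]
        ring

/-- The resonance relation: the weights of the inputs are controlled by the modulations. -/
theorem wt_mul_wt_le {α : ℝ} (hα : 0 ≤ α) (x y : ℤ × ℝ) :
    wt α y.1 * wt α (-x - y).1 ≤ ENNReal.ofReal (4 ^ α) *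
      (wt α (modn x) + wt α (modn y) + wt α (modn (-x - y))) := by
  set z := -x - y with hz
  have h1 : x.1 + y.1 + z.1 = 0 := by simp [hz]
  have h2 : x.2 + y.2 + z.2 = 0 := by simp [hz]
  -- The three time frequencies cancel and only the squares are left. The product of the two
  -- brackets is at most half the sum of their squares, namely 1 + (y.1² + z.1²)/2.
  have key : bracket y.1 * bracket z.1 ≤ 1 + |modn x| + |modn y| + |modn z| := by
    have hs : 1 + (x.1 : ℝ) ^ 2 + (y.1 : ℝ) ^ 2 + (z.1 : ℝ) ^ 2 ≤
        1 + |modn x| + |modn y| + |modn z| := by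
      have e : (x.1 : ℝ) ^ 2 + (y.1 : ℝ) ^ 2 + (z.1 : ℝ) ^ 2 = modn x + modn y + modn z := by
        unfold modn; linarith
      linarith [le_abs_self (modn x), le_abs_self (modn y), le_abs_self (modn z)]
    nlinarith [sq_nonneg (bracket y.1 - bracket z.1), bracket_sq y.1, bracket_sq z.1,
      sq_nonneg (x.1 : ℝ), sq_nonneg (y.1 : ℝ), sq_nonneg (z.1 : ℝ)]
  -- The constant 4 counts the summands 1, |modn x|, |modn y|, |modn z|, each at most the largest of
  -- the three brackets.
  have main : ∀ w : ℝ, bracket y.1 * bracket z.1 ≤ 4 * bracket w →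
      wt α y.1 * wt α z.1 ≤ ENNReal.ofReal (4 ^ α) * wt α w := fun w hw => by
    unfold wt
    rw [← ENNReal.ofReal_mul (Real.rpow_nonneg (bracket_pos _).le _),
      ← ENNReal.ofReal_mul (by positivity),
      ← Real.mul_rpow (bracket_pos _).le (bracket_pos _).le,
      ← Real.mul_rpow (by norm_num) (bracket_pos _).le]
    exact ENNReal.ofReal_le_ofReal
      (Real.rpow_le_rpow (mul_pos (bracket_pos _) (bracket_pos _)).le hw hα)
  have hx := abs_le_bracket (modn x)
  have hy := abs_le_bracket (modn y)
  have hz' := abs_le_bracket (modn z)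
  have ox := one_le_bracket (modn x)
  have oy := one_le_bracket (modn y)
  have oz := one_le_bracket (modn z)
  rcases le_total (bracket (modn x)) (bracket (modn y)) with h | h
  · rcases le_total (bracket (modn y)) (bracket (modn z)) with h' | h'
    · exact (main _ (by linarith)).trans (mul_le_mul_right le_add_self _)
    · exact (main _ (by linarith)).trans
        (mul_le_mul_right (le_self_add.trans' le_add_self) _)
  · rcases le_total (bracket (modn x)) (bracket (modn z)) with h' | h'
    · exact (main _ (by linarith)).trans (mul_le_mul_right le_add_self _)
    · exact (main _ (by linarith)).trans
        (mul_le_mul_right (le_self_add.trans' le_self_add) _)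

/-- The bilinear estimate `X^{s,b} × X^{s,b} → X^{0,-β}` for the product of the conjugates. -/
theorem sqNorm_conv_le {s b β : ℝ} (hs : s ≤ 0) (hβ : 1 / 4 < β) (hsβ : -s ≤ β)
    (hβ' : β ≤ 1 / 2) (hb : 1 / 2 < b) :
    ∃ C : ℝ≥0, ∀ g₁ g₂ : ℤ × ℝ → ℝ≥0∞, Measurable g₁ → Measurable g₂ →
      sqNorm 0 (-β) (conv g₁ g₂) ≤ C * (sqNorm s b g₁ * sqNorm s b g₂) := by
  obtain ⟨C₁, hC₁⟩ := lintegral_conv_sq_le hβ hb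
  obtain ⟨C₂, hC₂⟩ := lintegral_wt_conv_sq_le hβ hb
  set A : ℝ≥0 := (ENNReal.ofReal (4 ^ (-s))).toNNReal with hA
  have hA' : ENNReal.ofReal (4 ^ (-s)) = A := (ENNReal.coe_toNNReal ENNReal.ofReal_ne_top).symm
  refine ⟨4 * A ^ 2 * (C₁ + C₂ + C₂), fun g₁ g₂ h₁ h₂ => ?_⟩
  -- Absorbing the weights of the norm into the function turns X^{s,b} norms into L² norms.
  set F : (ℤ × ℝ → ℝ≥0∞) → ℤ × ℝ → ℝ≥0∞ := fun g x => wt b (modn x) * wt s x.1 * g x with hF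
  have hFm : ∀ g, Measurable g → Measurable (F g) := fun g hg => by
    simp only [hF]; fun_prop
  have hFn : ∀ g, ∫⁻ x, F g x ^ 2 ∂freqMeasure = sqNorm s b g := fun g => by
    unfold sqNorm
    refine lintegral_congr fun x => ?_
    simp only [hF, mul_pow, wt_sq]
  have hFi : ∀ g x, g x = wt (-b) (modn x) * wt (-s) x.1 * F g x := fun g x => by
    simp only [hF]
    calc g x = (wt (-b + b) (modn x) * wt (-s + s) x.1) * g x := by simp [wt_zero]
      _ = _ := by simp only [← wt_mul]; ring
  have m₁ := hFm g₁ h₁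
  have m₂ := hFm g₂ h₂
  set f₁ := F g₁ with hf₁
  set f₂ := F g₂ with hf₂
  -- One term for each modulation that may pay for the derivatives: the output x in T₀, the factor y
  -- in T₁ and the factor -x - y in T₂. The weight of the paying modulation is then discarded.
  set T₀ : ℤ × ℝ → ℝ≥0∞ := fun x => ∫⁻ y, wt (-β) (modn (-x - y)) * wt (-b) (modn y) *
    (f₁ y * f₂ (-x - y)) ∂freqMeasure with hT₀
  set T₁ : ℤ × ℝ → ℝ≥0∞ := fun x => ∫⁻ y, wt (-β) (modn x) * wt (-b) (modn (-x - y)) *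
    (f₁ y * f₂ (-x - y)) ∂freqMeasure with hT₁
  set T₂ : ℤ × ℝ → ℝ≥0∞ := fun x => ∫⁻ y, wt (-β) (modn x) * wt (-b) (modn y) *
    (f₁ y * f₂ (-x - y)) ∂freqMeasure with hT₂
  -- Exchanging the two factors by y ↦ -x - y reduces T₂ to the form of T₁.
  have hT₂' : ∀ x, T₂ x = ∫⁻ y, wt (-β) (modn x) * wt (-b) (modn (-x - y)) *
      (f₂ y * f₁ (-x - y)) ∂freqMeasure := fun x => by
    simp only [hT₂]
    rw [← lintegral_neg_sub' x (by fun_prop)]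
    refine lintegral_congr fun y => ?_
    have : -x - (-x - y) = y := by abel
    rw [this, mul_comm (f₂ y)]
  have mT₀ : Measurable T₀ := Measurable.lintegral_prod_right'
    (f := fun p : (ℤ × ℝ) × (ℤ × ℝ) => wt (-β) (modn (-p.1 - p.2)) * wt (-b) (modn p.2) *
    (f₁ p.2 * f₂ (-p.1 - p.2))) (by fun_prop)
  have mT₁ : Measurable T₁ := Measurable.lintegral_prod_right'
    (f := fun p : (ℤ × ℝ) × (ℤ × ℝ) => wt (-β) (modn p.1) * wt (-b) (modn (-p.1 - p.2)) *
    (f₁ p.2 * f₂ (-p.1 - p.2))) (by fun_prop)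
  have mT₂ : Measurable T₂ := Measurable.lintegral_prod_right'
    (f := fun p : (ℤ × ℝ) × (ℤ × ℝ) => wt (-β) (modn p.1) * wt (-b) (modn p.2) *
    (f₁ p.2 * f₂ (-p.1 - p.2))) (by fun_prop)
  have hpt : ∀ x y : ℤ × ℝ, wt (-β) (modn x) * (g₁ y * g₂ (-x - y)) ≤ A *
      (wt (-β) (modn (-x - y)) * wt (-b) (modn y) * (f₁ y * f₂ (-x - y)) +
      wt (-β) (modn x) * wt (-b) (modn (-x - y)) * (f₁ y * f₂ (-x - y)) +
      wt (-β) (modn x) * wt (-b) (modn y) * (f₁ y * f₂ (-x - y))) := fun x y => by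
    rw [hFi g₁ y, hFi g₂ (-x - y), ← hf₁, ← hf₂]
    set z := -x - y with hz
    have r := wt_mul_wt_le (neg_nonneg.2 hs) x y
    rw [hA', ← hz] at r
    -- This is where -s ≤ β is needed: the output carries only the power β. A factor has the larger
    -- power b to spend.
    have e0 : wt (-β) (modn x) * wt (-s) (modn x) * (wt (-b) (modn y) * wt (-b) (modn z)) ≤
        wt (-β) (modn z) * wt (-b) (modn y) := by
      rw [wt_mul]
      calc _ ≤ 1 * (wt (-b) (modn y) * wt (-β) (modn z)) :=
            mul_le_mul' (wt_le_one (by linarith) _)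
              (mul_le_mul_right (wt_mono (by linarith) _) _)
        _ = _ := by ring
    have e1 : wt (-b) (modn y) * wt (-s) (modn y) * (wt (-β) (modn x) * wt (-b) (modn z)) ≤
        wt (-β) (modn x) * wt (-b) (modn z) := by
      rw [wt_mul]
      calc _ ≤ 1 * (wt (-β) (modn x) * wt (-b) (modn z)) :=
            mul_le_mul_left (wt_le_one (by linarith) _) _
        _ = _ := by ring
    have e2 : wt (-b) (modn z) * wt (-s) (modn z) * (wt (-β) (modn x) * wt (-b) (modn y)) ≤
        wt (-β) (modn x) * wt (-b) (modn y) := by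
      rw [wt_mul]
      calc _ ≤ 1 * (wt (-β) (modn x) * wt (-b) (modn y)) :=
            mul_le_mul_left (wt_le_one (by linarith) _) _
        _ = _ := by ring
    calc _ = (wt (-s) y.1 * wt (-s) z.1) * (wt (-β) (modn x) * wt (-b) (modn y) *
          wt (-b) (modn z) * (f₁ y * f₂ z)) := by ring
      _ ≤ (A * (wt (-s) (modn x) + wt (-s) (modn y) + wt (-s) (modn z))) *
          (wt (-β) (modn x) * wt (-b) (modn y) * wt (-b) (modn z) * (f₁ y * f₂ z)) :=
          mul_le_mul_left r _
      _ = A * ((wt (-β) (modn x) * wt (-s) (modn x) * (wt (-b) (modn y) * wt (-b) (modn z))) *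
            (f₁ y * f₂ z) +
          (wt (-b) (modn y) * wt (-s) (modn y) * (wt (-β) (modn x) * wt (-b) (modn z))) *
            (f₁ y * f₂ z) +
          (wt (-b) (modn z) * wt (-s) (modn z) * (wt (-β) (modn x) * wt (-b) (modn y))) *
            (f₁ y * f₂ z)) := by ring
      _ ≤ _ := by gcongr
  have hT : ∀ x, wt (-β) (modn x) * conv g₁ g₂ x ≤ A * (T₀ x + T₁ x + T₂ x) := fun x => by
    unfold conv
    rw [← lintegral_const_mul _ (by fun_prop)]
    refine (lintegral_mono (hpt x)).trans (le_of_eq ?_)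
    rw [lintegral_const_mul _ (by fun_prop), lintegral_add_right _ (by fun_prop),
      lintegral_add_right _ (by fun_prop)]
  calc sqNorm 0 (-β) (conv g₁ g₂)
      = ∫⁻ x, (wt (-β) (modn x) * conv g₁ g₂ x) ^ 2 ∂freqMeasure := by
        unfold sqNorm
        refine lintegral_congr fun x => ?_
        rw [mul_pow, wt_sq, mul_zero, wt_zero, mul_one]
    _ ≤ ∫⁻ x, (4 * A ^ 2) * (T₀ x ^ 2 + T₁ x ^ 2 + T₂ x ^ 2) ∂freqMeasure := by
        refine lintegral_mono fun x => ?_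
        calc (wt (-β) (modn x) * conv g₁ g₂ x) ^ 2 ≤ (A * (T₀ x + T₁ x + T₂ x)) ^ 2 := by
              exact pow_le_pow_left' (hT x) 2
          _ = A ^ 2 * (T₀ x + T₁ x + T₂ x) ^ 2 := by ring
          _ ≤ A ^ 2 * (2 * ((2 * (T₀ x ^ 2 + T₁ x ^ 2)) + 2 * T₂ x ^ 2)) := by
              gcongr
              refine (add_sq_le_two _ _).trans ?_
              gcongr
              · exact add_sq_le_two _ _
              · exact le_mul_of_one_le_left (zero_le) (by norm_num)
          _ = _ := by ring
    _ = (4 * A ^ 2) * (∫⁻ x, T₀ x ^ 2 ∂freqMeasure + ∫⁻ x, T₁ x ^ 2 ∂freqMeasure +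
          ∫⁻ x, T₂ x ^ 2 ∂freqMeasure) := by
        rw [lintegral_const_mul _ (by fun_prop), lintegral_add_right _ (by fun_prop),
          lintegral_add_right _ (by fun_prop)]
    _ ≤ (4 * A ^ 2) * (C₁ * (sqNorm s b g₁ * sqNorm s b g₂) +
          C₂ * (sqNorm s b g₁ * sqNorm s b g₂) + C₂ * (sqNorm s b g₁ * sqNorm s b g₂)) := by
        gcongr
        · rw [← hFn g₁, ← hFn g₂]; exact hC₁ _ _ m₁ m₂
        · rw [← hFn g₁, ← hFn g₂]; exact hC₂ _ _ m₁ m₂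
        · simp_rw [hT₂']
          rw [← hFn g₁, ← hFn g₂, mul_comm (∫⁻ x, F g₁ x ^ 2 ∂freqMeasure)]
          exact hC₂ _ _ m₂ m₁
    _ = _ := by push_cast; ring


/-! ### Time cutoff and the kernel of the localised Duhamel integral -/

theorem exists_norm_schwartz_le (f : SchwartzMap ℝ ℂ) :
    ∃ C : ℝ, 0 ≤ C ∧ ∀ x, ‖f x‖ ≤ C / (1 + x ^ 2) := by
  obtain ⟨C₀, h₀, hC₀⟩ := f.decay 0 0
  obtain ⟨C₂, h₂, hC₂⟩ := f.decay 2 0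
  refine ⟨C₀ + C₂, by positivity, fun x => ?_⟩
  rw [le_div_iff₀ (by positivity)]
  have e0 := hC₀ x
  have e2 := hC₂ x
  simp only [pow_zero, one_mul, norm_iteratedFDeriv_zero, Real.norm_eq_abs, sq_abs] at e0 e2
  linarith

/-- A function whose inverse Fourier transform is `1` on `[-1,1]`. -/
theorem exists_cutoff_transform : ∃ (P : ℝ → ℂ) (C : ℝ), 0 ≤ C ∧ Differentiable ℝ P ∧
    (∀ r, ‖P r‖ ≤ C / (1 + r ^ 2)) ∧ (∀ r, ‖deriv P r‖ ≤ C / (1 + r ^ 2)) ∧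
    ∀ t : ℝ, |t| ≤ 1 → ∫ r : ℝ, Complex.exp (Complex.I * r * t) * P r = 1 := by
  let φ : ContDiffBump (0 : ℝ) := ⟨1, 2, one_pos, one_lt_two⟩
  have h1 : HasCompactSupport fun x : ℝ => (φ x : ℂ) :=
    φ.hasCompactSupport.comp_left (g := fun y : ℝ => (y : ℂ)) (by simp)
  have h2 : ContDiff ℝ ∞ fun x : ℝ => (φ x : ℂ) :=
    Complex.ofRealCLM.contDiff.comp φ.contDiff
  let f : SchwartzMap ℝ ℂ := h1.toSchwartzMap h2
  let F : SchwartzMap ℝ ℂ := FourierTransform.fourier f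
  obtain ⟨C₀, h₀, hC₀⟩ := exists_norm_schwartz_le F
  obtain ⟨C₁, h₁, hC₁⟩ := exists_norm_schwartz_le (SchwartzMap.derivCLM ℝ ℂ F)
  have hpi : (1 : ℝ) ≤ 2 * Real.pi := by linarith [Real.pi_gt_three]
  -- The Fourier transform F is taken with the phase 2πxξ. The rescaling r ↦ a F(ar) gives the
  -- inversion formula with phase e^{irt} and no prefactor.
  set a : ℝ := (2 * Real.pi)⁻¹ with ha
  have ha0 : 0 < a := by positivity
  have ha1 : a ≤ 1 := inv_le_one_of_one_le₀ hpi
  have hscale : ∀ (C : ℝ), 0 ≤ C → ∀ r : ℝ, a * (C / (1 + (r * a) ^ 2)) ≤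
      (C₀ + C₁ + C) * (2 * Real.pi) / (1 + r ^ 2) := fun C hC r => by
    have e : 1 + r ^ 2 ≤ (2 * Real.pi) ^ 2 * (1 + (r * a) ^ 2) := by
      have : (2 * Real.pi) ^ 2 * (1 + (r * a) ^ 2) = (2 * Real.pi) ^ 2 + r ^ 2 := by
        rw [ha]; field_simp
      rw [this]
      nlinarith
    rw [← mul_div_assoc, div_le_div_iff₀ (by positivity) (by positivity)]
    have e2 : a * C * (1 + r ^ 2) ≤ a * C * ((2 * Real.pi) ^ 2 * (1 + (r * a) ^ 2)) := by gcongr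
    have e3 : a * C * ((2 * Real.pi) ^ 2 * (1 + (r * a) ^ 2)) =
        C * (2 * Real.pi) * (1 + (r * a) ^ 2) := by rw [ha]; field_simp
    refine e2.trans (e3.trans_le ?_)
    gcongr
    linarith
  have hd : ∀ r : ℝ, HasDerivAt (fun r : ℝ => (a : ℂ) * F (r * a))
      ((a : ℂ) * (a • deriv F (r * a))) r :=
    fun r => by
      have := (F.differentiable.differentiableAt (x := r * a)).hasDerivAt.scomp r
        ((hasDerivAt_id r).mul_const a)
      simpa using this.const_mul (a : ℂ)
  refine ⟨fun r => (a : ℂ) * F (r * a), (C₀ + C₁ + (C₀ + C₁)) * (2 * Real.pi), by positivity,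
    fun r => (hd r).differentiableAt, fun r => ?_, fun r => ?_, fun t ht => ?_⟩
  · rw [norm_mul, Complex.norm_real, Real.norm_eq_abs, abs_of_pos ha0]
    refine (mul_le_mul_of_nonneg_left (hC₀ _) ha0.le).trans ((hscale C₀ h₀ r).trans ?_)
    gcongr; linarith
  · rw [(hd r).deriv, norm_mul, Complex.norm_real, norm_smul, Real.norm_eq_abs, abs_of_pos ha0]
    have e := hC₁ (r * a)
    rw [SchwartzMap.derivCLM_apply] at e
    refine (mul_le_mul_of_nonneg_left ?_ ha0.le).trans ((hscale C₁ h₁ r).trans ?_)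
    · calc a * ‖deriv F (r * a)‖ ≤ 1 * ‖deriv F (r * a)‖ := by gcongr
        _ ≤ _ := by simpa using e
    · gcongr; linarith
  · have hinv : FourierTransformInv.fourierInv F = f := by simp [F]
    have h3 : (FourierTransformInv.fourierInv (F : ℝ → ℂ)) t = 1 := by
      rw [← SchwartzMap.fourierInv_coe, hinv]
      change (φ t : ℂ) = 1
      rw [φ.one_of_mem_closedBall (by simpa using ht)]
      simp
    rw [Real.fourierInv_eq'] at h3
    have h4 := Measure.integral_comp_mul_right
      (fun v : ℝ => Complex.exp (Complex.I * (2 * Real.pi * v) * t) * F v) a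
    rw [ha, inv_inv, abs_of_pos (by positivity), ← ha] at h4
    calc ∫ r : ℝ, Complex.exp (Complex.I * r * t) * ((a : ℂ) * F (r * a))
        = (a : ℂ) * ∫ r : ℝ, Complex.exp (Complex.I * (2 * Real.pi * ((r * a : ℝ) : ℂ)) * t) *
            F (r * a) := by
          rw [← integral_const_mul]
          refine integral_congr_ae (Eventually.of_forall fun r => ?_)
          have : (2 * Real.pi * ((r * a : ℝ) : ℂ) : ℂ) = r := by
            rw [ha]; push_cast; field_simp
          simp only [this]
          ring
      _ = ∫ v : ℝ, Complex.exp (Complex.I * (2 * Real.pi * v) * t) * F v := by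
          have h5 : (a : ℂ) * ((2 * Real.pi : ℝ) : ℂ) = 1 := by
            rw [← Complex.ofReal_mul, ha, inv_mul_cancel₀ (by positivity), Complex.ofReal_one]
          rw [h4, Complex.real_smul, ← mul_assoc, h5, one_mul]
      _ = 1 := by
          rw [← h3]
          refine integral_congr_ae (Eventually.of_forall fun v => ?_)
          simp only [smul_eq_mul]
          congr 2
          simp only [RCLike.inner_apply, conj_trivial]
          push_cast
          ring

/-- The chosen cutoff, on the Fourier side. -/
def cutP : ℝ → ℂ := exists_cutoff_transform.choose

theorem cutP_spec : ∃ C : ℝ, 0 ≤ C ∧ Differentiable ℝ cutP ∧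
    (∀ r, ‖cutP r‖ ≤ C / (1 + r ^ 2)) ∧ (∀ r, ‖deriv cutP r‖ ≤ C / (1 + r ^ 2)) ∧
    ∀ t : ℝ, |t| ≤ 1 → ∫ r : ℝ, Complex.exp (Complex.I * r * t) * cutP r = 1 :=
  exists_cutoff_transform.choose_spec

theorem continuous_cutP : Continuous cutP := by
  obtain ⟨C, -, h, -⟩ := cutP_spec
  exact h.continuous

theorem integral_exp_mul_cutP {t : ℝ} (ht : |t| ≤ 1) :
    ∫ r : ℝ, Complex.exp (Complex.I * r * t) * cutP r = 1 := by
  obtain ⟨C, -, -, -, -, h⟩ := cutP_spec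
  exact h t ht

theorem wt_neg_two (r : ℝ) : wt (-2) r = ENNReal.ofReal (1 / (1 + r ^ 2)) := by
  unfold wt
  rw [Real.rpow_neg (bracket_pos _).le, Real.rpow_two, bracket_sq, one_div]

theorem enorm_cutP_le : ∃ C : ℝ≥0, ∀ r, ‖cutP r‖ₑ ≤ C * wt (-2) r := by
  obtain ⟨C, h0, -, h, -⟩ := cutP_spec
  refine ⟨C.toNNReal, fun r => ?_⟩
  rw [wt_neg_two, ← ofReal_norm, ENNReal.ofNNReal_toNNReal, ← ENNReal.ofReal_mul h0]
  exact ENNReal.ofReal_le_ofReal ((h r).trans (by rw [mul_one_div]))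

/-- The Fourier transform of the localised primitive of `e^{ist}`, at scale one. -/
def cutE (r s : ℝ) : ℂ := (cutP (r - s) - cutP r) / (Complex.I * s)

theorem measurable_cutE : Measurable fun p : ℝ × ℝ => cutE p.1 p.2 := by
  unfold cutE
  have := continuous_cutP.measurable
  have hc : Measurable fun x : ℝ => (x : ℂ) := Complex.measurable_ofReal
  exact ((this.comp (measurable_fst.sub measurable_snd)).sub (this.comp measurable_fst)).div
    (measurable_const.mul (hc.comp measurable_snd))

/-- For |s| ≥ 1 the two terms of the numerator are estimated separately and the denominator supplies
⟨s⟩^{-1}. For |s| ≤ 1 the mean value inequality cancels the denominator; the decay of the derivative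
persists along the segment because 1 + r² ≤ 3(1 + x²) when |r - x| ≤ 1. -/
theorem enorm_cutE_le : ∃ C : ℝ≥0, ∀ r s,
    ‖cutE r s‖ₑ ≤ C * (wt (-1) s * (wt (-2) (r - s) + wt (-2) r)) := by
  obtain ⟨C, h0, hd, hP, hP', -⟩ := cutP_spec
  refine ⟨(6 * C).toNNReal, fun r s => ?_⟩
  have hb := bracket_pos s
  have key : ‖cutE r s‖ ≤ 6 * C * ((bracket s)⁻¹ * (1 / (1 + (r - s) ^ 2) + 1 / (1 + r ^ 2))) := by
    unfold cutE
    rw [norm_div, norm_mul, Complex.norm_I, one_mul, Complex.norm_real, Real.norm_eq_abs]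
    rcases eq_or_ne s 0 with rfl | hs
    -- At s = 0 the quotient has the default value 0, so the bound is trivial there.
    · simp only [abs_zero, div_zero]; positivity
    have hs' : 0 < |s| := abs_pos.2 hs
    rw [div_le_iff₀ hs']
    rcases le_total 1 |s| with h1 | h1
    · have hbs : bracket s ≤ 2 * |s| := (bracket_le_one_add_abs s).trans (by linarith)
      have e1 : 1 ≤ 2 * ((bracket s)⁻¹ * |s|) := by
        rw [← div_eq_inv_mul, ← mul_div_assoc, le_div_iff₀ hb]; linarith
      calc ‖cutP (r - s) - cutP r‖ ≤ ‖cutP (r - s)‖ + ‖cutP r‖ := norm_sub_le _ _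
        _ ≤ C / (1 + (r - s) ^ 2) + C / (1 + r ^ 2) := add_le_add (hP _) (hP _)
        _ = 1 * (C * (1 / (1 + (r - s) ^ 2) + 1 / (1 + r ^ 2))) := by ring
        _ ≤ (2 * ((bracket s)⁻¹ * |s|)) * (C * (1 / (1 + (r - s) ^ 2) + 1 / (1 + r ^ 2))) := by
            gcongr
        _ ≤ (2 * ((bracket s)⁻¹ * |s|)) * (3 * C * (1 / (1 + (r - s) ^ 2) + 1 / (1 + r ^ 2))) := by
            gcongr; linarith
        _ = _ := by ring
    · have hbs : bracket s ≤ 2 := (bracket_le_one_add_abs s).trans (by linarith)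
      have e1 : 1 ≤ 2 * (bracket s)⁻¹ := by
        rw [← div_eq_mul_inv, le_div_iff₀ hb]; linarith
      have hseg : ∀ x ∈ Set.uIcc (r - s) r, ‖deriv cutP x‖ ≤ 3 * C / (1 + r ^ 2) := fun x hx => by
        refine (hP' x).trans ?_
        rw [div_le_div_iff₀ (by positivity) (by positivity)]
        have hx' : |r - x| ≤ 1 := by
          have := Set.abs_sub_right_of_mem_uIcc hx
          rw [sub_sub_cancel] at this
          exact this.trans h1
        have : 1 + r ^ 2 ≤ 3 * (1 + x ^ 2) := by
          have h2 := sq_le_sq' (by linarith [abs_le.1 hx']) (abs_le.1 hx').2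
          nlinarith [sq_nonneg (r - 2 * x)]
        nlinarith
      have hmv := (convex_uIcc (r - s) r).norm_image_sub_le_of_norm_deriv_le (𝕜 := ℝ)
        (fun x _ => hd x) hseg (x := r) (y := r - s) Set.right_mem_uIcc Set.left_mem_uIcc
      have : ‖r - s - r‖ = |s| := by rw [Real.norm_eq_abs, ← abs_neg]; congr 1; ring
      rw [this] at hmv
      refine hmv.trans ?_
      gcongr
      calc 3 * C / (1 + r ^ 2) = 1 * (3 * C * (1 / (1 + r ^ 2))) := by ring
        _ ≤ (2 * (bracket s)⁻¹) * (3 * C * (1 / (1 + (r - s) ^ 2) + 1 / (1 + r ^ 2))) := by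
            gcongr
            exact le_add_of_nonneg_left (by positivity)
        _ = _ := by ring
  rw [← ofReal_norm]
  refine (ENNReal.ofReal_le_ofReal key).trans (le_of_eq ?_)
  have hw1 : wt (-1) s = ENNReal.ofReal (bracket s)⁻¹ := by
    unfold wt; rw [Real.rpow_neg_one]
  rw [wt_neg_two, wt_neg_two, hw1, ← ENNReal.ofReal_add (by positivity) (by positivity),
    ENNReal.ofNNReal_toNNReal, ← ENNReal.ofReal_mul (by positivity),
    ← ENNReal.ofReal_mul (by positivity)]

/-- The Fourier transform of `t ↦ ψ((t - t₀)/δ) ∫_{t₀}^t e^{iσs} ds`, at the frequency `ρ`. -/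
def duhKernel (δ t₀ ρ σ : ℝ) : ℂ :=
  Complex.exp (Complex.I * (σ - ρ) * t₀) * ((δ : ℂ) ^ 2 * cutE (δ * ρ) (δ * σ))

theorem measurable_duhKernel (δ t₀ : ℝ) :
    Measurable fun p : ℝ × ℝ => duhKernel δ t₀ p.1 p.2 := by
  unfold duhKernel
  have h := measurable_cutE.comp (f := fun p : ℝ × ℝ => (δ * p.1, δ * p.2)) (by fun_prop)
  have hc : Continuous fun p : ℝ × ℝ => Complex.exp (Complex.I * (p.2 - p.1) * t₀) := by fun_prop
  exact hc.measurable.mul (measurable_const.mul h)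

theorem enorm_exp_I_mul (x : ℝ) : ‖Complex.exp (Complex.I * x)‖ₑ = 1 := by
  rw [mul_comm, ← ofReal_norm, Complex.norm_exp_ofReal_mul_I, ENNReal.ofReal_one]

/-- The base point t₀ enters only through a unimodular phase, so all estimates derived from this
bound are uniform in t₀. The uniqueness argument restarts at arbitrary times and relies on this. -/
theorem enorm_duhKernel_le : ∃ C : ℝ≥0, ∀ δ t₀ ρ σ : ℝ, 0 < δ → ‖duhKernel δ t₀ ρ σ‖ₑ ≤
    C * (ENNReal.ofReal (δ ^ 2) *
      (wt (-1) (δ * σ) * (wt (-2) (δ * (ρ - σ)) + wt (-2) (δ * ρ)))) := by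
  obtain ⟨C, hC⟩ := enorm_cutE_le
  refine ⟨C, fun δ t₀ ρ σ hδ => ?_⟩
  unfold duhKernel
  have e1 : Complex.exp (Complex.I * (σ - ρ) * t₀) =
      Complex.exp (Complex.I * (((σ - ρ) * t₀ : ℝ) : ℂ)) := by push_cast; ring_nf
  have e2 : ‖((δ : ℂ) ^ 2)‖ₑ = ENNReal.ofReal (δ ^ 2) := by
    rw [← ofReal_norm]; simp
  rw [enorm_mul, enorm_mul, e1, enorm_exp_I_mul, one_mul, e2, mul_sub]
  calc _ ≤ ENNReal.ofReal (δ ^ 2) * (C * (wt (-1) (δ * σ) * (wt (-2) (δ * ρ - δ * σ) +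
        wt (-2) (δ * ρ)))) := by gcongr; exact hC _ _
    _ = _ := by ring

theorem lintegral_comp_mul_left {δ : ℝ} (hδ : 0 < δ) {f : ℝ → ℝ≥0∞} (hf : Measurable f) :
    ∫⁻ x, f (δ * x) = ENNReal.ofReal δ⁻¹ * ∫⁻ x, f x := by
  rw [← lintegral_map hf (measurable_const_mul δ), Real.map_volume_mul_left hδ.ne',
    lintegral_smul_measure, abs_of_pos (inv_pos.2 hδ), smul_eq_mul]

theorem bracket_le_inv_mul {δ : ℝ} (hδ : 0 < δ) (hδ' : δ ≤ 1) (x : ℝ) :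
    bracket x ≤ δ⁻¹ * bracket (δ * x) := by
  refine le_of_sq_le_sq ?_ (by have := bracket_pos (δ * x); positivity)
  rw [mul_pow, bracket_sq, bracket_sq]
  have : 1 ≤ δ⁻¹ := (one_le_inv₀ hδ).2 hδ'
  have e : δ⁻¹ ^ 2 * (1 + (δ * x) ^ 2) = δ⁻¹ ^ 2 + x ^ 2 := by field_simp
  rw [e]
  nlinarith

/-- The kernel at scale δ decays in δρ and δσ. Passing to weights in these variables costs δ^{-p},
which the factor δ² of the kernel more than compensates. -/
theorem wt_le_scale {δ p : ℝ} (hδ : 0 < δ) (hδ' : δ ≤ 1) (hp : 0 ≤ p) (x : ℝ) :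
    wt p x ≤ ENNReal.ofReal (δ ^ (-p)) * wt p (δ * x) := by
  have := wt_pos_le hp (inv_nonneg.2 hδ.le) (bracket_le_inv_mul hδ hδ' x)
  rwa [Real.inv_rpow hδ.le, ← Real.rpow_neg hδ.le] at this

theorem wt_le_two_mul {p : ℝ} (hp : 0 ≤ p) (x y : ℝ) :
    wt p (x + y) ≤ ENNReal.ofReal (2 ^ p) * (wt p x * wt p y) := by
  unfold wt
  rw [← ENNReal.ofReal_mul (Real.rpow_nonneg (bracket_pos _).le _),
    ← ENNReal.ofReal_mul (by positivity), ← Real.mul_rpow (bracket_pos _).le (bracket_pos _).le,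
    ← Real.mul_rpow two_pos.le (mul_pos (bracket_pos _) (bracket_pos _)).le]
  exact ENNReal.ofReal_le_ofReal
    (Real.rpow_le_rpow (bracket_pos _).le (bracket_add_le_mul x y) hp)

/-- Young's inequality `L¹ * L² → L²`. -/
theorem lintegral_convolution_sq_le {φ f : ℝ → ℝ≥0∞} (hφ : Measurable φ) (hf : Measurable f) :
    ∫⁻ ρ, (∫⁻ σ, φ (ρ - σ) ^ 2 * f σ) ^ 2 ≤ (∫⁻ x, φ x ^ 2) ^ 2 * ∫⁻ x, f x ^ 2 := by
  calc ∫⁻ ρ, (∫⁻ σ, φ (ρ - σ) ^ 2 * f σ) ^ 2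
      ≤ ∫⁻ ρ, (∫⁻ x, φ x ^ 2) * ∫⁻ σ, (φ (ρ - σ) * f σ) ^ 2 := by
        refine lintegral_mono fun ρ => ?_
        -- Writing the convolution kernel as φ² lets Cauchy–Schwarz split it evenly between the two
        -- factors.
        have := sq_lintegral_mul_le volume (f := fun σ => φ (ρ - σ))
          (g := fun σ => φ (ρ - σ) * f σ) (by fun_prop) (by fun_prop)
        rw [lintegral_sub_left_eq_self (fun x => φ x ^ 2) ρ] at this
        simpa only [sq, mul_assoc] using this
    _ = (∫⁻ x, φ x ^ 2) * ∫⁻ σ, ∫⁻ ρ, (φ (ρ - σ) * f σ) ^ 2 := by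
        rw [lintegral_const_mul _ (Measurable.lintegral_prod_right'
          (f := fun p : ℝ × ℝ => (φ (p.1 - p.2) * f p.2) ^ 2) (by fun_prop)),
          lintegral_lintegral_swap (by fun_prop)]
    _ = (∫⁻ x, φ x ^ 2) * ∫⁻ σ, (∫⁻ x, φ x ^ 2) * f σ ^ 2 := by
        congr 1
        refine lintegral_congr fun σ => ?_
        simp_rw [mul_pow]
        rw [lintegral_mul_const _ (by fun_prop),
          lintegral_sub_right_eq_self (fun x => φ x ^ 2) σ]
    _ = _ := by rw [lintegral_const_mul _ (by fun_prop), sq, mul_assoc]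

/-- The smoothing estimate for the localised primitive, with a gain for short times. -/
theorem lintegral_duhKernel_sq_le {b β : ℝ} (hb : 0 ≤ b) (hb1 : b < 1) (hβ : 0 ≤ β)
    (hβ1 : β < 1 / 2) (hbβ : b + β ≤ 1) :
    ∃ C : ℝ≥0, ∀ (δ t₀ : ℝ), 0 < δ → δ ≤ 1 → ∀ g : ℝ → ℝ≥0∞, Measurable g →
      ∫⁻ ρ, wt (2 * b) ρ * (∫⁻ σ, ‖duhKernel δ t₀ ρ σ‖ₑ * g σ) ^ 2 ≤
        C * ENNReal.ofReal (δ ^ (2 * (1 - b - β))) * ∫⁻ σ, wt (-(2 * β)) σ * g σ ^ 2 := by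
  obtain ⟨C, hC⟩ := enorm_duhKernel_le
  have i1 := (lintegral_wt_lt_top (p := 2 - b) (by linarith)).ne
  have i2 := (lintegral_wt_lt_top (p := 2 * (2 - b)) (by linarith)).ne
  have i3 := (lintegral_wt_lt_top (p := 2 * (1 - β)) (by linarith)).ne
  set I₁ := ∫⁻ x, wt (-(2 - b)) x with hI₁
  set I₂ := ∫⁻ x, wt (-(2 * (2 - b))) x with hI₂
  set I₃ := ∫⁻ x, wt (-(2 * (1 - β))) x with hI₃
  set B : ℝ≥0∞ := ENNReal.ofReal (2 ^ b) with hB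
  set K : ℝ≥0∞ := 2 * C ^ 2 * (B ^ 2 * I₁ ^ 2 + I₂ * I₃) with hK
  have hKt : K ≠ ⊤ := by
    simp [hK, hB, ENNReal.mul_eq_top, i1, i2, i3]
  refine ⟨K.toNNReal, fun δ t₀ hδ hδ' g hg => ?_⟩
  rw [ENNReal.coe_toNNReal hKt]
  set f : ℝ → ℝ≥0∞ := fun σ => wt (-β) σ * g σ with hf
  have hfm : Measurable f := by simp only [hf]; fun_prop
  have hff : ∀ σ, g σ = wt β σ * f σ := fun σ => by
    simp only [hf]
    rw [← mul_assoc, wt_mul, add_neg_cancel, wt_zero, one_mul]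
  have hfn : ∫⁻ σ, f σ ^ 2 = ∫⁻ σ, wt (-(2 * β)) σ * g σ ^ 2 := by
    refine lintegral_congr fun σ => ?_
    simp only [hf, mul_pow, wt_sq, mul_neg]
  -- The power is 2 from the kernel, minus b and minus β from rescaling the output and input
  -- weights.
  set D : ℝ≥0∞ := ENNReal.ofReal (δ ^ (2 - b - β)) with hD
  -- The two terms of `cutE` behave differently: A₁ is a convolution, handled by Young's inequality,
  -- and A₂ has a product kernel, handled by Cauchy–Schwarz.
  set A₁ : ℝ → ℝ≥0∞ := fun ρ => ∫⁻ σ, wt (-((2 - b) / 2)) (δ * (ρ - σ)) ^ 2 * f σ with hA₁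
  set A₂ : ℝ → ℝ≥0∞ := fun ρ => wt (-(2 - b)) (δ * ρ) * ∫⁻ σ, wt (-(1 - β)) (δ * σ) * f σ
    with hA₂
  have mA₁ : Measurable A₁ := Measurable.lintegral_prod_right'
    (f := fun p : ℝ × ℝ => wt (-((2 - b) / 2)) (δ * (p.1 - p.2)) ^ 2 * f p.2) (by fun_prop)
  have mA₂ : Measurable A₂ := by simp only [hA₂]; fun_prop
  have hpt : ∀ ρ σ, wt b ρ * (‖duhKernel δ t₀ ρ σ‖ₑ * g σ) ≤
      C * D * (B * (wt (-((2 - b) / 2)) (δ * (ρ - σ)) ^ 2 * f σ) +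
        wt (-(2 - b)) (δ * ρ) * (wt (-(1 - β)) (δ * σ) * f σ)) := fun ρ σ => by
    have s1 := wt_le_scale hδ hδ' hb ρ
    have s2 := wt_le_scale hδ hδ' hβ σ
    have s3 : wt b (δ * ρ) ≤ B * (wt b (δ * σ) * wt b (δ * (ρ - σ))) := by
      have := wt_le_two_mul hb (δ * σ) (δ * (ρ - σ))
      rwa [← mul_add, add_sub_cancel] at this
    have eD : ENNReal.ofReal (δ ^ (-b)) * ENNReal.ofReal (δ ^ (-β)) * ENNReal.ofReal (δ ^ 2) =
        D := by
      rw [← ENNReal.ofReal_mul (by positivity), ← ENNReal.ofReal_mul (by positivity),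
        ← Real.rpow_add hδ, ← Real.rpow_natCast, ← Real.rpow_add hδ, hD]
      congr 2
      push_cast; ring
    rw [hff σ]
    calc wt b ρ * (‖duhKernel δ t₀ ρ σ‖ₑ * (wt β σ * f σ))
        ≤ (ENNReal.ofReal (δ ^ (-b)) * wt b (δ * ρ)) * ((C * (ENNReal.ofReal (δ ^ 2) *
          (wt (-1) (δ * σ) * (wt (-2) (δ * (ρ - σ)) + wt (-2) (δ * ρ))))) *
          ((ENNReal.ofReal (δ ^ (-β)) * wt β (δ * σ)) * f σ)) := by
          gcongr
          exact hC δ t₀ ρ σ hδ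
      _ = C * D * (wt b (δ * ρ) * (wt (-1) (δ * σ) * wt β (δ * σ)) * wt (-2) (δ * (ρ - σ)) * f σ +
          (wt b (δ * ρ) * wt (-2) (δ * ρ)) * (wt (-1) (δ * σ) * wt β (δ * σ) * f σ)) := by
          rw [← eD]; ring
      _ ≤ C * D * (B * (wt b (δ * σ) * wt b (δ * (ρ - σ))) * (wt (-1) (δ * σ) * wt β (δ * σ)) *
          wt (-2) (δ * (ρ - σ)) * f σ +
          (wt b (δ * ρ) * wt (-2) (δ * ρ)) * (wt (-1) (δ * σ) * wt β (δ * σ) * f σ)) := by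
          gcongr
      _ = C * D * (B * ((wt b (δ * σ) * (wt (-1) (δ * σ) * wt β (δ * σ))) *
          (wt b (δ * (ρ - σ)) * wt (-2) (δ * (ρ - σ))) * f σ) +
          (wt b (δ * ρ) * wt (-2) (δ * ρ)) * (wt (-1) (δ * σ) * wt β (δ * σ) * f σ)) := by
          ring
      _ ≤ C * D * (B * (1 * wt (-(2 - b)) (δ * (ρ - σ)) * f σ) +
          wt (-(2 - b)) (δ * ρ) * (wt (-(1 - β)) (δ * σ) * f σ)) := by
          simp only [wt_mul]
          gcongr
          -- The total exponent b - 1 + β of ⟨δσ⟩ is nonpositive by the hypothesis b + β ≤ 1.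
          · exact wt_le_one (by linarith) _
          · exact le_of_eq (by congr 1; ring)
          · exact le_of_eq (by congr 1; ring)
          · exact le_of_eq (by congr 1; ring)
      _ = _ := by
          rw [wt_sq, one_mul]
          congr 7
          ring
  have hpt2 : ∀ ρ, wt b ρ * ∫⁻ σ, ‖duhKernel δ t₀ ρ σ‖ₑ * g σ ≤ C * D * (B * A₁ ρ + A₂ ρ) :=
    fun ρ => by
      have hm : Measurable fun σ => ‖duhKernel δ t₀ ρ σ‖ₑ * g σ :=
        ((measurable_duhKernel δ t₀).comp (measurable_const.prodMk measurable_id)).enorm.mul hg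
      rw [← lintegral_const_mul _ hm]
      refine (lintegral_mono (hpt ρ)).trans (le_of_eq ?_)
      rw [lintegral_const_mul _ (by fun_prop), lintegral_add_right _ (by fun_prop),
        lintegral_const_mul _ (by fun_prop), lintegral_const_mul _ (by fun_prop)]
  have n1 : ∫⁻ ρ, A₁ ρ ^ 2 ≤ (ENNReal.ofReal δ⁻¹) ^ 2 * I₁ ^ 2 * ∫⁻ σ, f σ ^ 2 := by
    have := lintegral_convolution_sq_le (φ := fun x => wt (-((2 - b) / 2)) (δ * x)) (f := f)
      (by fun_prop) hfm
    refine this.trans (le_of_eq ?_)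
    rw [lintegral_comp_mul_left hδ (f := fun x => wt (-((2 - b) / 2)) x ^ 2) (by fun_prop)]
    simp_rw [wt_sq]
    rw [mul_pow, hI₁]
    congr 6
    ext x
    congr 1
    ring
  have n2 : ∫⁻ ρ, A₂ ρ ^ 2 ≤ (ENNReal.ofReal δ⁻¹) ^ 2 * (I₂ * I₃) * ∫⁻ σ, f σ ^ 2 := by
    simp only [hA₂, mul_pow]
    rw [lintegral_mul_const _ (by fun_prop),
      lintegral_comp_mul_left hδ (f := fun x => wt (-(2 - b)) x ^ 2) (by fun_prop)]
    have := sq_lintegral_mul_le volume (f := fun σ => wt (-(1 - β)) (δ * σ)) (g := f)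
      (by fun_prop) (by fun_prop)
    rw [lintegral_comp_mul_left hδ (f := fun x => wt (-(1 - β)) x ^ 2) (by fun_prop)] at this
    simp_rw [wt_sq, mul_neg] at this ⊢
    calc _ ≤ ENNReal.ofReal δ⁻¹ * I₂ * (ENNReal.ofReal δ⁻¹ * I₃ * ∫⁻ σ, f σ ^ 2) := by gcongr
      _ = _ := by ring
  -- Each squared term also carries δ^{-2} from rescaling integrals; together with D² this leaves
  -- δ^{2(1-b-β)}.
  have eD2 : D ^ 2 * (ENNReal.ofReal δ⁻¹) ^ 2 = ENNReal.ofReal (δ ^ (2 * (1 - b - β))) := by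
    rw [← mul_pow, hD, ← ENNReal.ofReal_mul (by positivity), ← ENNReal.ofReal_pow (by positivity),
      ← Real.rpow_neg_one δ, ← Real.rpow_add hδ, ← Real.rpow_natCast, ← Real.rpow_mul hδ.le]
    congr 2
    push_cast; ring
  calc ∫⁻ ρ, wt (2 * b) ρ * (∫⁻ σ, ‖duhKernel δ t₀ ρ σ‖ₑ * g σ) ^ 2
      = ∫⁻ ρ, (wt b ρ * ∫⁻ σ, ‖duhKernel δ t₀ ρ σ‖ₑ * g σ) ^ 2 := by
        simp_rw [mul_pow, wt_sq]
    _ ≤ ∫⁻ ρ, 2 * C ^ 2 * D ^ 2 * (B ^ 2 * A₁ ρ ^ 2 + A₂ ρ ^ 2) := by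
        refine lintegral_mono fun ρ => ?_
        calc _ ≤ (C * D * (B * A₁ ρ + A₂ ρ)) ^ 2 := pow_le_pow_left' (hpt2 ρ) 2
          _ = C ^ 2 * D ^ 2 * (B * A₁ ρ + A₂ ρ) ^ 2 := by ring
          _ ≤ C ^ 2 * D ^ 2 * (2 * ((B * A₁ ρ) ^ 2 + A₂ ρ ^ 2)) := by
              gcongr; exact add_sq_le_two _ _
          _ = _ := by ring
    _ = 2 * C ^ 2 * D ^ 2 * (B ^ 2 * (∫⁻ ρ, A₁ ρ ^ 2) + ∫⁻ ρ, A₂ ρ ^ 2) := by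
        rw [lintegral_const_mul _ (by fun_prop), lintegral_add_right _ (by fun_prop),
          lintegral_const_mul _ (by fun_prop)]
    _ ≤ 2 * C ^ 2 * D ^ 2 * (B ^ 2 * ((ENNReal.ofReal δ⁻¹) ^ 2 * I₁ ^ 2 * (∫⁻ σ, f σ ^ 2)) +
          (ENNReal.ofReal δ⁻¹) ^ 2 * (I₂ * I₃) * ∫⁻ σ, f σ ^ 2) := by gcongr
    _ = K * (D ^ 2 * (ENNReal.ofReal δ⁻¹) ^ 2) * ∫⁻ σ, f σ ^ 2 := by rw [hK]; ring
    _ = _ := by rw [eD2, hfn]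


/-! ### Inversion in time, the nonlinearity and the Duhamel operator -/

/-- The inverse Fourier transform in time. -/
def ift (G : ℤ × ℝ → ℂ) (t : ℝ) (n : ℤ) : ℂ :=
  (2 * Real.pi : ℂ)⁻¹ * ∫ τ : ℝ, Complex.exp (Complex.I * τ * t) * G (n, τ)

theorem enorm_two_pi_inv_le : ‖(2 * Real.pi : ℂ)⁻¹‖ₑ ≤ 1 := by
  rw [← ofReal_norm]
  have h : ‖(2 * Real.pi : ℂ)⁻¹‖ ≤ 1 := by
    rw [norm_inv]
    refine inv_le_one_of_one_le₀ ?_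
    rw [norm_mul, Complex.norm_real, Real.norm_eq_abs, abs_of_pos Real.pi_pos]
    simp only [Complex.norm_ofNat]
    linarith [Real.pi_gt_three]
  simpa using ENNReal.ofReal_le_ofReal h

theorem enorm_exp_I_mul_mul (x y : ℝ) : ‖Complex.exp (Complex.I * x * y)‖ₑ = 1 := by
  have : Complex.I * x * y = Complex.I * ((x * y : ℝ) : ℂ) := by push_cast; ring
  rw [this, enorm_exp_I_mul]

theorem norm_exp_I_mul_mul (x y : ℝ) : ‖Complex.exp (Complex.I * x * y)‖ = 1 := by
  have : Complex.I * x * y = ((x * y : ℝ) : ℂ) * Complex.I := by push_cast; ring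
  rw [this, Complex.norm_exp_ofReal_mul_I]

theorem sqNorm_eq_tsum {s b : ℝ} {g : ℤ × ℝ → ℝ≥0∞} (hg : Measurable g) :
    sqNorm s b g =
      ∑' n : ℤ, wt (2 * s) n * ∫⁻ τ : ℝ, wt (2 * b) (τ + (n : ℝ) ^ 2) * g (n, τ) ^ 2 := by
  unfold sqNorm
  rw [lintegral_freqMeasure (by fun_prop)]
  refine tsum_congr fun n => ?_
  rw [← lintegral_const_mul _ (by fun_prop)]
  refine lintegral_congr fun τ => ?_
  simp only [modn]
  ring

/-- Weighted Cauchy–Schwarz on a single slice. Translating by n² removes n from the constant, so the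
bound can be summed over n. -/
theorem sq_lintegral_slice_le {q : ℝ} (n : ℤ) {g : ℝ → ℝ≥0∞} (hg : Measurable g) (p : ℝ) :
    (∫⁻ τ : ℝ, wt (-p) (τ + (n : ℝ) ^ 2) * g τ) ^ 2 ≤
      (∫⁻ σ : ℝ, wt (-(2 * (p + q))) σ) * ∫⁻ τ : ℝ, wt (2 * q) (τ + (n : ℝ) ^ 2) * g τ ^ 2 := by
  have := sq_lintegral_mul_le volume (f := fun τ : ℝ => wt (-(p + q)) (τ + (n : ℝ) ^ 2))
    (g := fun τ => wt q (τ + (n : ℝ) ^ 2) * g τ) (by fun_prop) (by fun_prop)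
  simp_rw [mul_pow, wt_sq, mul_neg] at this
  rw [lintegral_add_right_eq_self (fun σ => wt (-(2 * (p + q))) σ)] at this
  refine le_trans (le_of_eq ?_) this
  congr 1
  refine lintegral_congr fun τ => ?_
  rw [← mul_assoc, wt_mul]
  congr 2
  ring

/-- On each slice ⟨τ + n²⟩^{-2b} is integrable because 2b > 1. This is the Fourier side of the
embedding of X^{s,b} into bounded functions of time with values in H^s. -/
theorem tsum_sq_lintegral_le {b : ℝ} (hb : 1 / 2 < b) :
    ∃ C : ℝ≥0, ∀ (s : ℝ) (g : ℤ × ℝ → ℝ≥0∞), Measurable g →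
      ∑' n : ℤ, wt (2 * s) n * (∫⁻ τ : ℝ, g (n, τ)) ^ 2 ≤ C * sqNorm s b g := by
  have i := (lintegral_wt_lt_top (p := 2 * b) (by linarith)).ne
  refine ⟨(∫⁻ σ : ℝ, wt (-(2 * b)) σ).toNNReal, fun s g hg => ?_⟩
  rw [ENNReal.coe_toNNReal i, sqNorm_eq_tsum hg, ← ENNReal.tsum_mul_left]
  refine ENNReal.tsum_le_tsum fun n => ?_
  have := sq_lintegral_slice_le (q := b) n (g := fun τ => g (n, τ)) (by fun_prop) 0
  simp only [neg_zero, wt_zero, one_mul, zero_add] at this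
  calc _ ≤ wt (2 * s) n * _ := mul_le_mul_right this _
    _ = _ := by ring

/-- It makes the inversion formula meaningful for every mode, and shows that representatives of
finite norm are genuine extensions. -/
theorem integrable_slice {s b : ℝ} (hb : 1 / 2 < b) {G : ℤ × ℝ → ℂ} (hG : Measurable G)
    (h : sqNorm s b (fun x => ‖G x‖ₑ) < ⊤) (n : ℤ) : Integrable fun τ => G (n, τ) := by
  obtain ⟨C, hC⟩ := tsum_sq_lintegral_le hb
  have h1 := (ENNReal.le_tsum n).trans (hC s (fun x => ‖G x‖ₑ) hG.enorm)
  have h2 := h1.trans_lt (ENNReal.mul_lt_top ENNReal.coe_lt_top h)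
  refine ⟨(hG.comp (measurable_const.prodMk measurable_id)).aestronglyMeasurable, ?_⟩
  unfold HasFiniteIntegral
  by_contra hc
  simp only [not_lt, top_le_iff] at hc
  simp only [hc] at h2
  rw [ENNReal.top_pow two_ne_zero, ENNReal.mul_top (wt_ne_zero _ _)] at h2
  exact lt_irrefl _ h2

theorem enorm_ift_le (G : ℤ × ℝ → ℂ) (t : ℝ) (n : ℤ) :
    ‖ift G t n‖ₑ ≤ ∫⁻ τ : ℝ, ‖G (n, τ)‖ₑ := by
  unfold ift
  rw [enorm_mul]
  calc _ ≤ 1 * ∫⁻ τ : ℝ, ‖Complex.exp (Complex.I * τ * t) * G (n, τ)‖ₑ :=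
        mul_le_mul' enorm_two_pi_inv_le (enorm_integral_le_lintegral_enorm _)
    _ = _ := by simp_rw [enorm_mul, enorm_exp_I_mul_mul, one_mul]

theorem tsum_enorm_ift_sq_le {b : ℝ} (hb : 1 / 2 < b) :
    ∃ C : ℝ≥0, ∀ (s : ℝ) (G : ℤ × ℝ → ℂ) (t : ℝ), Measurable G →
      ∑' n : ℤ, wt (2 * s) n * ‖ift G t n‖ₑ ^ 2 ≤ C * sqNorm s b (fun x => ‖G x‖ₑ) := by
  obtain ⟨C, hC⟩ := tsum_sq_lintegral_le hb
  refine ⟨C, fun s G t hG => le_trans ?_ (hC s _ hG.enorm)⟩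
  refine ENNReal.tsum_le_tsum fun n => ?_
  gcongr
  exact enorm_ift_le G t n

theorem continuous_ift {G : ℤ × ℝ → ℂ} {n : ℤ} (h : Integrable fun τ => G (n, τ)) :
    Continuous fun t => ift G t n := by
  unfold ift
  refine continuous_const.mul (continuous_of_dominated
    (bound := fun τ => ‖G (n, τ)‖) ?_ ?_ h.norm ?_)
  · intro t
    exact (by fun_prop : Continuous fun τ : ℝ =>
      Complex.exp (Complex.I * τ * t)).aestronglyMeasurable.mul
      h.aestronglyMeasurable
  · intro t
    refine Eventually.of_forall fun τ => ?_
    rw [norm_mul, norm_exp_I_mul_mul, one_mul]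
  · refine Eventually.of_forall fun τ => ?_
    fun_prop

/-- `∫_{t₀}^t e^{iσs} ds`. -/
def eint (σ t₀ t : ℝ) : ℂ := ∫ s in t₀..t, Complex.exp (Complex.I * σ * s)

theorem eint_eq {σ : ℝ} (hσ : σ ≠ 0) (t₀ t : ℝ) :
    eint σ t₀ t = (Complex.exp (Complex.I * σ * t) - Complex.exp (Complex.I * σ * t₀)) /
      (Complex.I * σ) := by
  unfold eint
  rw [integral_exp_mul_complex (by simpa using hσ)]

theorem eint_add (σ t₀ t₁ t : ℝ) : eint σ t₀ t₁ + eint σ t₁ t = eint σ t₀ t := by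
  unfold eint
  exact intervalIntegral.integral_add_adjacent_intervals
    (Continuous.intervalIntegrable (by fun_prop) _ _)
    (Continuous.intervalIntegrable (by fun_prop) _ _)

theorem continuous_eint (t₀ : ℝ) : Continuous fun p : ℝ × ℝ => eint p.1 t₀ p.2 := by
  unfold eint
  exact intervalIntegral.continuous_parametric_intervalIntegral_of_continuous (by fun_prop)
    continuous_snd

theorem norm_eint_le_abs (σ t₀ t : ℝ) : ‖eint σ t₀ t‖ ≤ |t - t₀| := by
  have := intervalIntegral.norm_integral_le_of_norm_le_const (a := t₀) (b := t) (C := 1)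
    (f := fun s : ℝ => Complex.exp (Complex.I * σ * s)) (fun s _ => (norm_exp_I_mul_mul σ s).le)
  simpa [eint] using this

/-- The trivial bound |t - t₀| and the oscillatory bound 2/|σ| are added. The decay ⟨σ⟩^{-1} is what
lets Duhamel's integral converge for forcings that are only in X^{0,-β} with β < 1/2. -/
theorem enorm_eint_le (σ t₀ t : ℝ) :
    ‖eint σ t₀ t‖ₑ ≤ ENNReal.ofReal (|t - t₀| + 2) * wt (-1) σ := by
  have hb := bracket_pos σ
  have h1 : ‖eint σ t₀ t‖ * |σ| ≤ 2 := by
    rcases eq_or_ne σ 0 with rfl | hσ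
    · simp
    rw [eint_eq hσ, norm_div, norm_mul, Complex.norm_I, one_mul, Complex.norm_real,
      Real.norm_eq_abs, div_mul_cancel₀ _ (abs_ne_zero.2 hσ)]
    refine (norm_sub_le _ _).trans ?_
    rw [norm_exp_I_mul_mul, norm_exp_I_mul_mul]
    norm_num
  have h2 : ‖eint σ t₀ t‖ ≤ (|t - t₀| + 2) * (bracket σ) ^ (-1 : ℝ) := by
    rw [Real.rpow_neg_one, ← div_eq_mul_inv, le_div_iff₀ hb]
    have := bracket_le_one_add_abs σ
    calc _ ≤ ‖eint σ t₀ t‖ * (1 + |σ|) := by gcongr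
      _ = ‖eint σ t₀ t‖ + ‖eint σ t₀ t‖ * |σ| := by ring
      _ ≤ _ := add_le_add (norm_eint_le_abs σ t₀ t) h1
  unfold wt
  rw [← ofReal_norm, ← ENNReal.ofReal_mul (by positivity)]
  exact ENNReal.ofReal_le_ofReal h2

/-- The Fourier transform of the product of the conjugates of two functions. -/
def nl (G₁ G₂ : ℤ × ℝ → ℂ) (x : ℤ × ℝ) : ℂ :=
  (2 * Real.pi : ℂ)⁻¹ * ∫ y, starRingEnd ℂ (G₁ y) * starRingEnd ℂ (G₂ (-x - y)) ∂freqMeasure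

theorem measurable_conj {α : Type*} [MeasurableSpace α] {f : α → ℂ} (hf : Measurable f) :
    Measurable fun x => starRingEnd ℂ (f x) := Complex.continuous_conj.measurable.comp hf

theorem enorm_conj (z : ℂ) : ‖starRingEnd ℂ z‖ₑ = ‖z‖ₑ := by
  rw [← ofReal_norm, ← ofReal_norm, RCLike.norm_conj]

theorem measurable_nl {G₁ G₂ : ℤ × ℝ → ℂ} (h₁ : Measurable G₁) (h₂ : Measurable G₂) :
    Measurable (nl G₁ G₂) := by
  unfold nl
  have hm : Measurable fun p : (ℤ × ℝ) × (ℤ × ℝ) =>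
      starRingEnd ℂ (G₁ p.2) * starRingEnd ℂ (G₂ (-p.1 - p.2)) :=
    (measurable_conj (h₁.comp measurable_snd)).mul (measurable_conj (h₂.comp (by fun_prop)))
  exact measurable_const.mul (hm.stronglyMeasurable.integral_prod_right').measurable

theorem enorm_nl_le (G₁ G₂ : ℤ × ℝ → ℂ) (x : ℤ × ℝ) :
    ‖nl G₁ G₂ x‖ₑ ≤ conv (fun y => ‖G₁ y‖ₑ) (fun y => ‖G₂ y‖ₑ) x := by
  unfold nl conv
  rw [enorm_mul]
  calc _ ≤ 1 * ∫⁻ y, ‖starRingEnd ℂ (G₁ y) * starRingEnd ℂ (G₂ (-x - y))‖ₑ ∂freqMeasure :=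
        mul_le_mul' enorm_two_pi_inv_le (enorm_integral_le_lintegral_enorm _)
    _ = _ := by simp_rw [enorm_mul, enorm_conj, one_mul]

theorem sqNorm_mono {s b : ℝ} {g h : ℤ × ℝ → ℝ≥0∞} (H : ∀ᵐ x ∂freqMeasure, g x ≤ h x) :
    sqNorm s b g ≤ sqNorm s b h := by
  unfold sqNorm
  refine lintegral_mono_ae (H.mono fun x hx => ?_)
  gcongr

theorem sqNorm_mono_left {s s' b : ℝ} (h : s ≤ s') (g : ℤ × ℝ → ℝ≥0∞) :
    sqNorm s b g ≤ sqNorm s' b g := by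
  unfold sqNorm
  refine lintegral_mono fun x => ?_
  gcongr
  exact wt_mono (by linarith) _

theorem sqNorm_add_le {s b : ℝ} {g h : ℤ × ℝ → ℝ≥0∞} (hg : Measurable g) (hh : Measurable h) :
    sqNorm s b (fun x => g x + h x) ≤ 2 * (sqNorm s b g + sqNorm s b h) := by
  unfold sqNorm
  rw [← lintegral_add_right _ (by fun_prop), ← lintegral_const_mul _ (by fun_prop)]
  refine lintegral_mono fun x => ?_
  calc _ ≤ wt (2 * b) (modn x) * wt (2 * s) x.1 * (2 * (g x ^ 2 + h x ^ 2)) := by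
        gcongr; exact add_sq_le_two _ _
    _ = _ := by ring

theorem ae_lt_top_of_sqNorm {s b : ℝ} {g : ℤ × ℝ → ℝ≥0∞} (hg : Measurable g)
    (h : sqNorm s b g < ⊤) : ∀ᵐ x ∂freqMeasure, g x < ⊤ := by
  have := ae_lt_top (μ := freqMeasure)
    (f := fun x => wt (2 * b) (modn x) * wt (2 * s) x.1 * g x ^ 2) (by fun_prop) h.ne
  refine this.mono fun x hx => ?_
  by_contra hc
  simp only [not_lt, top_le_iff] at hc
  rw [hc, ENNReal.top_pow two_ne_zero, ENNReal.mul_top] at hx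
  · exact lt_irrefl _ hx
  · exact mul_ne_zero (wt_ne_zero _ _) (wt_ne_zero _ _)

/-- The splitting is UU - WW = (U-W)U + W(U-W) under conjugation. Finiteness of both convolutions at
x is essential: a divergent integral would take the default value 0 and linearity would fail. -/
theorem enorm_nl_sub_le {U W : ℤ × ℝ → ℂ} (hU : Measurable U) (hW : Measurable W) {x : ℤ × ℝ}
    (h₁ : conv (fun y => ‖U y‖ₑ) (fun y => ‖U y‖ₑ) x < ⊤)
    (h₂ : conv (fun y => ‖W y‖ₑ) (fun y => ‖W y‖ₑ) x < ⊤) :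
    ‖nl U U x - nl W W x‖ₑ ≤ conv (fun y => ‖U y - W y‖ₑ) (fun y => ‖U y‖ₑ) x +
      conv (fun y => ‖W y‖ₑ) (fun y => ‖U y - W y‖ₑ) x := by
  have hi : ∀ {G : ℤ × ℝ → ℂ}, Measurable G →
      conv (fun y => ‖G y‖ₑ) (fun y => ‖G y‖ₑ) x < ⊤ →
      Integrable (fun y => starRingEnd ℂ (G y) * starRingEnd ℂ (G (-x - y))) freqMeasure := by
    intro G hG h
    refine ⟨((measurable_conj hG).mul
      (measurable_conj (hG.comp (by fun_prop)))).aestronglyMeasurable, ?_⟩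
    unfold HasFiniteIntegral
    simpa only [enorm_mul, enorm_conj, conv] using h
  have hD : Measurable fun y => ‖U y - W y‖ₑ := (hU.sub hW).enorm
  have hDU : Measurable fun y => ‖U y - W y‖ₑ * ‖U (-x - y)‖ₑ :=
    hD.mul (hU.enorm.comp (by fun_prop))
  unfold nl conv
  rw [← mul_sub, ← integral_sub (hi hU h₁) (hi hW h₂), enorm_mul,
    ← lintegral_add_left hDU]
  refine (mul_le_mul' enorm_two_pi_inv_le (enorm_integral_le_lintegral_enorm _)).trans ?_
  rw [one_mul]
  refine lintegral_mono fun y => ?_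
  have e : starRingEnd ℂ (U y) * starRingEnd ℂ (U (-x - y)) -
      starRingEnd ℂ (W y) * starRingEnd ℂ (W (-x - y)) =
      starRingEnd ℂ (U y - W y) * starRingEnd ℂ (U (-x - y)) +
      starRingEnd ℂ (W y) * starRingEnd ℂ (U (-x - y) - W (-x - y)) := by
    simp only [map_sub]; ring
  simp only [e]
  refine (enorm_add_le _ _).trans ?_
  simp only [enorm_mul, enorm_conj]
  exact le_rfl

/-- The integral term of Duhamel's formula for a forcing with Fourier transform `k`. -/
def duhTerm (k : ℤ × ℝ → ℂ) (t₀ t : ℝ) (n : ℤ) : ℂ :=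
  (2 * Real.pi : ℂ)⁻¹ * ∫ τ : ℝ, k (n, τ) * eint (τ + (n : ℝ) ^ 2) t₀ t

/-- The Fourier transform of the localised integral term of Duhamel's formula. -/
def duhOp (δ t₀ : ℝ) (k : ℤ × ℝ → ℂ) (x : ℤ × ℝ) : ℂ :=
  ∫ τ : ℝ, duhKernel δ t₀ (modn x) (τ + (x.1 : ℝ) ^ 2) * k (x.1, τ)

theorem measurable_duhOp (δ t₀ : ℝ) {k : ℤ × ℝ → ℂ} (hk : Measurable k) :
    Measurable (duhOp δ t₀ k) := by
  unfold duhOp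
  have hm : Measurable fun p : (ℤ × ℝ) × ℝ =>
      duhKernel δ t₀ (modn p.1) (p.2 + (p.1.1 : ℝ) ^ 2) * k (p.1.1, p.2) := by
    refine ((measurable_duhKernel δ t₀).comp
      (f := fun p : (ℤ × ℝ) × ℝ => (modn p.1, p.2 + (p.1.1 : ℝ) ^ 2)) ?_).mul
      (hk.comp (by fun_prop))
    have := measurable_intCast_fst.comp (measurable_fst : Measurable (Prod.fst : (ℤ × ℝ) × ℝ → _))
    exact (measurable_modn.comp measurable_fst).prodMk (measurable_snd.add (this.pow_const 2))
  exact (hm.stronglyMeasurable.integral_prod_right').measurable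

/-- The energy estimate for the localised integral term. -/
theorem sqNorm_duhOp_le {b β : ℝ} (hb : 0 ≤ b) (hb1 : b < 1) (hβ : 0 ≤ β)
    (hβ1 : β < 1 / 2) (hbβ : b + β ≤ 1) :
    ∃ C : ℝ≥0, ∀ (δ t₀ : ℝ), 0 < δ → δ ≤ 1 → ∀ k : ℤ × ℝ → ℂ, Measurable k →
      sqNorm 0 b (fun x => ‖duhOp δ t₀ k x‖ₑ) ≤
        C * ENNReal.ofReal (δ ^ (2 * (1 - b - β))) * sqNorm 0 (-β) (fun x => ‖k x‖ₑ) := by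
  obtain ⟨C, hC⟩ := lintegral_duhKernel_sq_le hb hb1 hβ hβ1 hbβ
  refine ⟨C, fun δ t₀ hδ hδ' k hk => ?_⟩
  rw [sqNorm_eq_tsum (measurable_duhOp δ t₀ hk).enorm, sqNorm_eq_tsum hk.enorm,
    ← ENNReal.tsum_mul_left]
  refine ENNReal.tsum_le_tsum fun n => ?_
  rw [mul_zero, wt_zero, one_mul, one_mul]
  -- In the variable σ = τ + n² the claim for each mode is the one-dimensional kernel estimate, with
  -- the same constant.
  set m : ℝ := (n : ℝ) ^ 2 with hm
  have hg : Measurable fun σ : ℝ => ‖k (n, σ - m)‖ₑ := (hk.comp (by fun_prop)).enorm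
  have h := hC δ t₀ hδ hδ' (fun σ => ‖k (n, σ - m)‖ₑ) hg
  rw [← lintegral_add_right_eq_self
    (fun σ => wt (-(2 * β)) σ * ‖k (n, σ - m)‖ₑ ^ 2) m] at h
  simp only [add_sub_cancel_right] at h
  rw [mul_neg]
  refine le_trans ?_ h
  rw [← lintegral_add_right_eq_self (fun ρ => wt (2 * b) ρ * _) m]
  refine lintegral_mono fun τ => ?_
  gcongr
  refine (enorm_integral_le_lintegral_enorm _).trans (le_of_eq ?_)
  rw [← lintegral_add_right_eq_self (fun σ => ‖duhKernel δ t₀ (τ + m) σ‖ₑ * ‖k (n, σ - m)‖ₑ) m]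
  simp only [add_sub_cancel_right, enorm_mul, modn, hm]

/-- `X^{0,-β}` functions are integrable against `⟨σ⟩^{-1}`, slice by slice. -/
theorem sq_lintegral_wt_neg_one_le {β : ℝ} (hβ1 : β < 1 / 2) :
    ∃ C : ℝ≥0, ∀ (g : ℤ × ℝ → ℝ≥0∞), Measurable g → ∀ n : ℤ,
      (∫⁻ τ : ℝ, wt (-1) (τ + (n : ℝ) ^ 2) * g (n, τ)) ^ 2 ≤ C * sqNorm 0 (-β) g := by
  have i := (lintegral_wt_lt_top (p := 2 * (1 - β)) (by linarith)).ne
  refine ⟨(∫⁻ σ : ℝ, wt (-(2 * (1 - β))) σ).toNNReal, fun g hg n => ?_⟩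
  rw [ENNReal.coe_toNNReal i, sqNorm_eq_tsum hg]
  have := sq_lintegral_slice_le (q := -β) n (g := fun τ => g (n, τ)) (by fun_prop) 1
  refine this.trans (mul_le_mul' (le_of_eq (by congr 1)) ?_)
  have h2 := ENNReal.le_tsum (f := fun n : ℤ => wt (2 * 0) n *
    ∫⁻ τ : ℝ, wt (2 * -β) (τ + (n : ℝ) ^ 2) * g (n, τ) ^ 2) n
  simpa [wt_zero] using h2

theorem lintegral_wt_neg_one_lt_top {β : ℝ} (hβ1 : β < 1 / 2) {g : ℤ × ℝ → ℝ≥0∞}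
    (hg : Measurable g) (h : sqNorm 0 (-β) g < ⊤) (n : ℤ) :
    ∫⁻ τ : ℝ, wt (-1) (τ + (n : ℝ) ^ 2) * g (n, τ) < ⊤ := by
  obtain ⟨C, hC⟩ := sq_lintegral_wt_neg_one_le hβ1
  have := (hC g hg n).trans_lt (ENNReal.mul_lt_top ENNReal.coe_lt_top h)
  exact ((ENNReal.pow_lt_top_iff).1 this).resolve_right two_ne_zero

/-- These bounds serve only to justify Fubini and linearity, so the constant may depend on δ. The
sum 2 + 2DI in it covers the supremum and the integral in ρ at once. -/
theorem lintegral_enorm_duhKernel_le {δ : ℝ} (hδ : 0 < δ) (hδ' : δ ≤ 1) (t₀ : ℝ) :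
    ∃ C : ℝ≥0, (∀ ρ σ, ‖duhKernel δ t₀ ρ σ‖ₑ ≤ C * wt (-1) σ) ∧
      ∀ σ, ∫⁻ ρ, ‖duhKernel δ t₀ ρ σ‖ₑ ≤ C * wt (-1) σ := by
  obtain ⟨C, hC⟩ := enorm_duhKernel_le
  have i := (lintegral_wt_lt_top (p := 2) (by norm_num)).ne
  set I := ∫⁻ x : ℝ, wt (-2) x with hI
  set D := ENNReal.ofReal δ⁻¹ with hD
  have hw : ∀ σ, wt (-1) (δ * σ) ≤ D * wt (-1) σ := fun σ => by
    have := wt_neg_le (p := 1) (x := δ * σ) zero_le_one (inv_pos.2 hδ) (bracket_le_inv_mul hδ hδ' σ)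
    rwa [Real.rpow_one] at this
  set K : ℝ≥0∞ := C * (ENNReal.ofReal (δ ^ 2) * (D * (2 + 2 * (D * I)))) with hK
  have hKt : K ≠ ⊤ := by
    simp [hK, hD, ENNReal.mul_eq_top, i]
  refine ⟨K.toNNReal, fun ρ σ => ?_, fun σ => ?_⟩
  · rw [ENNReal.coe_toNNReal hKt]
    refine (hC δ t₀ ρ σ hδ).trans ?_
    calc _ ≤ C * (ENNReal.ofReal (δ ^ 2) * ((D * wt (-1) σ) * (1 + 1))) := by
          gcongr
          · exact hw σ
          · exact wt_le_one (by norm_num) _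
          · exact wt_le_one (by norm_num) _
      _ = C * (ENNReal.ofReal (δ ^ 2) * (D * 2)) * wt (-1) σ := by ring
      _ ≤ _ := by
          rw [hK]; gcongr; exact le_self_add
  · rw [ENNReal.coe_toNNReal hKt]
    refine (lintegral_mono fun ρ => hC δ t₀ ρ σ hδ).trans ?_
    rw [lintegral_const_mul _ (by fun_prop), lintegral_const_mul _ (by fun_prop),
      lintegral_const_mul _ (by fun_prop), lintegral_add_right _ (by fun_prop),
      lintegral_sub_right_eq_self (fun ρ => wt (-2) (δ * ρ)) σ,
      lintegral_comp_mul_left hδ (measurable_wt _), ← hI, ← hD]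
    calc _ ≤ C * (ENNReal.ofReal (δ ^ 2) * ((D * wt (-1) σ) * (D * I + D * I))) := by
          gcongr; exact hw σ
      _ = C * (ENNReal.ofReal (δ ^ 2) * (D * (2 * (D * I)))) * wt (-1) σ := by ring
      _ ≤ _ := by
          rw [hK]; gcongr; exact le_add_self

theorem integrable_duhKernel_mul {β δ : ℝ} (hβ1 : β < 1 / 2) (hδ : 0 < δ) (hδ' : δ ≤ 1) (t₀ : ℝ)
    {k : ℤ × ℝ → ℂ} (hk : Measurable k) (h : sqNorm 0 (-β) (fun x => ‖k x‖ₑ) < ⊤) (ρ : ℝ)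
    (n : ℤ) : Integrable fun τ : ℝ => duhKernel δ t₀ ρ (τ + (n : ℝ) ^ 2) * k (n, τ) := by
  obtain ⟨C, hC, -⟩ := lintegral_enorm_duhKernel_le hδ hδ' t₀
  refine ⟨(((measurable_duhKernel δ t₀).comp (f := fun τ : ℝ => (ρ, τ + (n : ℝ) ^ 2))
    (by fun_prop)).mul (hk.comp (by fun_prop))).aestronglyMeasurable, ?_⟩
  unfold HasFiniteIntegral
  refine lt_of_le_of_lt ?_ (ENNReal.mul_lt_top (a := C)
    ENNReal.coe_lt_top (lintegral_wt_neg_one_lt_top hβ1 hk.enorm h n))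
  rw [← lintegral_const_mul _ (by have := hk.enorm; fun_prop)]
  refine lintegral_mono fun τ => ?_
  rw [enorm_mul, ← mul_assoc]
  exact mul_le_mul_left (hC _ _) _

theorem duhOp_sub {β δ : ℝ} (hβ1 : β < 1 / 2) (hδ : 0 < δ) (hδ' : δ ≤ 1) (t₀ : ℝ)
    {k₁ k₂ : ℤ × ℝ → ℂ} (hk₁ : Measurable k₁) (h₁ : sqNorm 0 (-β) (fun x => ‖k₁ x‖ₑ) < ⊤)
    (hk₂ : Measurable k₂) (h₂ : sqNorm 0 (-β) (fun x => ‖k₂ x‖ₑ) < ⊤) (x : ℤ × ℝ) :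
    duhOp δ t₀ k₁ x - duhOp δ t₀ k₂ x = duhOp δ t₀ (fun y => k₁ y - k₂ y) x := by
  unfold duhOp
  rw [← integral_sub (integrable_duhKernel_mul hβ1 hδ hδ' t₀ hk₁ h₁ _ _)
    (integrable_duhKernel_mul hβ1 hδ hδ' t₀ hk₂ h₂ _ _)]
  simp_rw [mul_sub]


/-! ### Duhamel's formula in Fourier variables and the limit of the truncated squares -/

theorem integrable_cutP : Integrable cutP := by
  obtain ⟨C, hC⟩ := enorm_cutP_le
  refine ⟨continuous_cutP.aestronglyMeasurable, ?_⟩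
  unfold HasFiniteIntegral
  refine (lintegral_mono hC).trans_lt ?_
  rw [lintegral_const_mul _ (measurable_wt _)]
  exact ENNReal.mul_lt_top ENNReal.coe_lt_top (lintegral_wt_lt_top one_lt_two)

theorem integral_exp_mul_cutP_scale {δ s : ℝ} (hδ : 0 < δ) (hs : |s| ≤ δ) :
    ∫ ρ : ℝ, Complex.exp (Complex.I * ρ * s) * cutP (δ * ρ) = (δ : ℂ)⁻¹ := by
  have h := Measure.integral_comp_mul_left
    (fun r : ℝ => Complex.exp (Complex.I * r * ((s / δ : ℝ) : ℂ)) * cutP r) δ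
  rw [integral_exp_mul_cutP (by rw [abs_div, abs_of_pos hδ]; exact div_le_one_of_le₀ hs hδ.le),
    abs_of_pos (inv_pos.2 hδ), Complex.real_smul, mul_one, Complex.ofReal_inv] at h
  rw [← h]
  refine integral_congr_ae (Eventually.of_forall fun ρ => ?_)
  have hδ' : (δ : ℂ) ≠ 0 := by exact_mod_cast hδ.ne'
  simp only
  congr 2
  push_cast
  field_simp

/-- Shifting the transform of the cutoff by σ multiplies its inverse transform by e^{iσ(t-t₀)}, and
the cutoff is 1 for |t - t₀| ≤ δ. The difference quotient in the kernel therefore inverts to the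
primitive of e^{iσs}. -/
theorem integral_exp_mul_duhKernel {δ t₀ t σ : ℝ} (hδ : 0 < δ) (ht : |t - t₀| ≤ δ) (hσ : σ ≠ 0) :
    ∫ ρ : ℝ, Complex.exp (Complex.I * ρ * t) * duhKernel δ t₀ ρ σ = eint σ t₀ t := by
  have hδ' : (δ : ℂ) ≠ 0 := by exact_mod_cast hδ.ne'
  have hσ' : (σ : ℂ) ≠ 0 := by exact_mod_cast hσ
  set s := t - t₀ with hs
  have i1 : Integrable fun ρ : ℝ => Complex.exp (Complex.I * ρ * s) * cutP (δ * ρ) :=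
    (integrable_cutP.comp_mul_left' hδ.ne').bdd_mul (c := 1)
      (by fun_prop : Continuous fun ρ : ℝ => Complex.exp (Complex.I * ρ * s)).aestronglyMeasurable
      (Eventually.of_forall fun ρ => (norm_exp_I_mul_mul ρ s).le)
  have i2 : Integrable fun ρ : ℝ => Complex.exp (Complex.I * ρ * s) * cutP (δ * ρ - δ * σ) := by
    have := (integrable_cutP.comp_mul_left' hδ.ne').comp_sub_right σ
    simp only [mul_sub] at this
    exact this.bdd_mul (c := 1)
      (by fun_prop : Continuous fun ρ : ℝ => Complex.exp (Complex.I * ρ * s)).aestronglyMeasurable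
      (Eventually.of_forall fun ρ => (norm_exp_I_mul_mul ρ s).le)
  have e2 : ∫ ρ : ℝ, Complex.exp (Complex.I * ρ * s) * cutP (δ * ρ - δ * σ) =
      Complex.exp (Complex.I * σ * s) * (δ : ℂ)⁻¹ := by
    rw [← integral_exp_mul_cutP_scale hδ ht, ← integral_const_mul,
      ← integral_sub_right_eq_self (fun ρ : ℝ => Complex.exp (Complex.I * σ * s) *
        (Complex.exp (Complex.I * ρ * s) * cutP (δ * ρ))) σ]
    refine integral_congr_ae (Eventually.of_forall fun ρ => ?_)
    simp only [mul_sub, ← mul_assoc, ← Complex.exp_add]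
    congr 2
    push_cast
    ring
  calc ∫ ρ : ℝ, Complex.exp (Complex.I * ρ * t) * duhKernel δ t₀ ρ σ
      = ∫ ρ : ℝ, (Complex.exp (Complex.I * σ * t₀) * ((δ : ℂ) / (Complex.I * σ))) *
          (Complex.exp (Complex.I * ρ * s) * cutP (δ * ρ - δ * σ) -
            Complex.exp (Complex.I * ρ * s) * cutP (δ * ρ)) := by
        refine integral_congr_ae (Eventually.of_forall fun ρ => ?_)
        have e : Complex.exp (Complex.I * ρ * t) * Complex.exp (Complex.I * (σ - ρ) * t₀) =
            Complex.exp (Complex.I * σ * t₀) * Complex.exp (Complex.I * ρ * s) := by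
          rw [← Complex.exp_add, ← Complex.exp_add]
          congr 1
          rw [hs]; push_cast; ring
        simp only [duhKernel, cutE]
        rw [← mul_assoc, e]
        push_cast
        field_simp
    _ = Complex.exp (Complex.I * σ * t₀) * ((δ : ℂ) / (Complex.I * σ)) *
          (Complex.exp (Complex.I * σ * s) * (δ : ℂ)⁻¹ - (δ : ℂ)⁻¹) := by
        rw [integral_const_mul, integral_sub i2 i1, e2, integral_exp_mul_cutP_scale hδ ht]
    _ = _ := by
        rw [eint_eq hσ]
        have e : Complex.exp (Complex.I * σ * t) =
            Complex.exp (Complex.I * σ * t₀) * Complex.exp (Complex.I * σ * s) := by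
          rw [← Complex.exp_add]; congr 1; rw [hs]; push_cast; ring
        rw [e]
        field_simp

/-- Near `t₀`, the localised integral term is the integral term of Duhamel's formula. -/
theorem ift_duhOp {β δ : ℝ} (hβ1 : β < 1 / 2) (hδ : 0 < δ) (hδ' : δ ≤ 1) {t₀ t : ℝ}
    (ht : |t - t₀| ≤ δ) {k : ℤ × ℝ → ℂ} (hk : Measurable k)
    (h : sqNorm 0 (-β) (fun x => ‖k x‖ₑ) < ⊤) (n : ℤ) :
    ift (duhOp δ t₀ k) t n =
      Complex.exp (-Complex.I * (n : ℂ) ^ 2 * t) * duhTerm k t₀ t n := by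
  obtain ⟨C, -, hC⟩ := lintegral_enorm_duhKernel_le hδ hδ' t₀
  set m : ℝ := (n : ℝ) ^ 2 with hm
  have hkm : Measurable fun τ : ℝ => k (n, τ) := hk.comp (by fun_prop)
  have hKm : Measurable fun p : ℝ × ℝ => duhKernel δ t₀ (p.1 + m) (p.2 + m) :=
    (measurable_duhKernel δ t₀).comp (f := fun p : ℝ × ℝ => (p.1 + m, p.2 + m)) (by fun_prop)
  have hFm : Measurable (Function.uncurry fun (ρ τ : ℝ) => Complex.exp (Complex.I * ρ * t) *
      (duhKernel δ t₀ (ρ + m) (τ + m) * k (n, τ))) :=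
    (by fun_prop : Continuous fun p : ℝ × ℝ => Complex.exp (Complex.I * p.1 * t)).measurable.mul
      (hKm.mul (hkm.comp measurable_snd))
  -- Absolute convergence: integrating the kernel in ρ leaves ⟨σ⟩^{-1}, against which the forcing is
  -- integrable on each slice.
  have hint : Integrable (Function.uncurry fun (ρ τ : ℝ) => Complex.exp (Complex.I * ρ * t) *
      (duhKernel δ t₀ (ρ + m) (τ + m) * k (n, τ))) (volume.prod volume) := by
    refine ⟨hFm.aestronglyMeasurable, ?_⟩
    unfold HasFiniteIntegral
    rw [lintegral_prod_symm _ hFm.enorm.aemeasurable]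
    refine lt_of_le_of_lt ?_ (ENNReal.mul_lt_top (a := C)
      ENNReal.coe_lt_top (lintegral_wt_neg_one_lt_top hβ1 hk.enorm h n))
    rw [← lintegral_const_mul _ (by have := hk.enorm; fun_prop)]
    refine lintegral_mono fun τ => ?_
    simp only [Function.uncurry, enorm_mul, enorm_exp_I_mul_mul, one_mul]
    have hK1 : Measurable fun ρ : ℝ => ‖duhKernel δ t₀ (ρ + m) (τ + m)‖ₑ :=
      (hKm.comp (f := fun ρ : ℝ => (ρ, τ)) (by fun_prop)).enorm
    rw [lintegral_mul_const _ hK1,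
      lintegral_add_right_eq_self (fun ρ => ‖duhKernel δ t₀ ρ (τ + m)‖ₑ) m, ← mul_assoc]
    exact mul_le_mul_left (hC _) _
  unfold ift duhTerm
  rw [mul_left_comm]
  congr 1
  calc ∫ ρ : ℝ, Complex.exp (Complex.I * ρ * t) * duhOp δ t₀ k (n, ρ)
      = ∫ ρ : ℝ, ∫ τ : ℝ, Complex.exp (Complex.I * ρ * t) *
          (duhKernel δ t₀ (ρ + m) (τ + m) * k (n, τ)) := by
        refine integral_congr_ae (Eventually.of_forall fun ρ => ?_)
        simp only [duhOp, modn]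
        rw [integral_const_mul]
    _ = ∫ τ : ℝ, ∫ ρ : ℝ, Complex.exp (Complex.I * ρ * t) *
          (duhKernel δ t₀ (ρ + m) (τ + m) * k (n, τ)) := integral_integral_swap hint
    _ = ∫ τ : ℝ, Complex.exp (-Complex.I * (n : ℂ) ^ 2 * t) *
          (k (n, τ) * eint (τ + m) t₀ t) := by
        -- The excluded frequency is the one at which `cutE` divides by zero; it forms a null set.
        have hne : ∀ᵐ τ : ℝ, τ ≠ -m := by
          rw [ae_iff]; simp
        refine integral_congr_ae (hne.mono fun τ hτ => ?_)
        have hσ : τ + m ≠ 0 := fun h0 => hτ (by linarith)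
        simp only
        rw [← integral_exp_mul_duhKernel hδ ht hσ, ← integral_const_mul, ← integral_const_mul,
          ← integral_sub_right_eq_self _ m]
        refine integral_congr_ae (Eventually.of_forall fun ρ => ?_)
        simp only [sub_add_cancel]
        have e : Complex.exp (Complex.I * ((ρ - m : ℝ) : ℂ) * t) =
            Complex.exp (-Complex.I * (n : ℂ) ^ 2 * t) * Complex.exp (Complex.I * ρ * t) := by
          rw [← Complex.exp_add]; congr 1; rw [hm]; push_cast; ring
        rw [e]
        ring
    _ = _ := integral_const_mul _ _

/-- The `n`-th coefficient of the product of the conjugates of two frequency truncations. -/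
def quad (N : ℕ) (c d : ℤ → ℂ) (n : ℤ) : ℂ :=
  ∑ m ∈ (Finset.Icc (-(N : ℤ)) N).filter (fun m => -n - m ∈ Finset.Icc (-(N : ℤ)) N),
    starRingEnd ℂ (c m) * starRingEnd ℂ (d (-n - m))

/-- The map (τ₁, τ) ↦ (τ₁, -τ - τ₁) is a measure-preserving shear, so this is the integrability of a
tensor product. -/
theorem integrable_conj_mul_conj {g₁ g₂ : ℝ → ℂ} (h₁ : Integrable g₁) (h₂ : Integrable g₂) :
    Integrable (fun p : ℝ × ℝ => starRingEnd ℂ (g₁ p.1) * starRingEnd ℂ (g₂ (-p.2 - p.1)))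
      (volume.prod volume) := by
  have hc : ∀ {g : ℝ → ℂ}, Integrable g → Integrable fun x => starRingEnd ℂ (g x) :=
    fun {g} h => by
      have := Complex.conjLIE.toContinuousLinearEquiv.toContinuousLinearMap.integrable_comp h
      simpa using this
  have h := (hc h₁).mul_prod (hc h₂)
  have hmp : MeasurePreserving (fun p : ℝ × ℝ => (p.1, -p.2 - p.1))
      (volume.prod volume) (volume.prod volume) := by
    refine (MeasurePreserving.id volume).skew_product (g := fun a b => -b - a) (by fun_prop)
      (Eventually.of_forall fun a => ?_)
    exact ((measurePreserving_sub_right (volume : Measure ℝ) a).comp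
      (Measure.measurePreserving_neg (volume : Measure ℝ))).map_eq
  have := (hmp.integrable_comp h.aestronglyMeasurable).2 h
  exact this

theorem conj_exp_I_mul_mul (x y : ℝ) : starRingEnd ℂ (Complex.exp (Complex.I * x * y)) =
    Complex.exp (-(Complex.I * x * y)) := by
  rw [← Complex.exp_conj]
  congr 1
  simp

/-- Conjugation reverses the time frequencies, so the product of the modes τ₁ and τ₂ has frequency τ
= -τ₁ - τ₂. -/
theorem conj_mul_conj_integral {g₁ g₂ : ℝ → ℂ} (h₁ : Integrable g₁) (h₂ : Integrable g₂) (s : ℝ) :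
    starRingEnd ℂ (∫ τ : ℝ, Complex.exp (Complex.I * τ * s) * g₁ τ) *
      starRingEnd ℂ (∫ τ : ℝ, Complex.exp (Complex.I * τ * s) * g₂ τ) =
    ∫ p : ℝ × ℝ, Complex.exp (Complex.I * p.2 * s) *
      (starRingEnd ℂ (g₁ p.1) * starRingEnd ℂ (g₂ (-p.2 - p.1))) := by
  have hi : Integrable (fun p : ℝ × ℝ => Complex.exp (Complex.I * p.2 * s) *
      (starRingEnd ℂ (g₁ p.1) * starRingEnd ℂ (g₂ (-p.2 - p.1)))) (volume.prod volume) :=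
    (integrable_conj_mul_conj h₁ h₂).bdd_mul (c := 1)
      (by fun_prop : Continuous fun p : ℝ × ℝ =>
        Complex.exp (Complex.I * p.2 * s)).aestronglyMeasurable
      (Eventually.of_forall fun p => (norm_exp_I_mul_mul p.2 s).le)
  rw [Measure.volume_eq_prod, integral_prod _ hi, ← integral_conj, ← integral_conj,
    ← integral_mul_const]
  refine integral_congr_ae (Eventually.of_forall fun τ₁ => ?_)
  simp only
  rw [← integral_const_mul, ← integral_sub_left_eq_self _ volume (-τ₁)]
  refine integral_congr_ae (Eventually.of_forall fun τ => ?_)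
  simp only [map_mul, conj_exp_I_mul_mul]
  have e : Complex.exp (-(Complex.I * τ₁ * s)) *
      Complex.exp (-(Complex.I * ((-τ₁ - τ : ℝ) : ℂ) * s)) = Complex.exp (Complex.I * τ * s) := by
    rw [← Complex.exp_add]; congr 1; push_cast; ring
  have e' : -τ₁ - τ = -τ - τ₁ := by ring
  rw [← e, e']
  ring

/-- The slices are integrable and the time interval is bounded, so Fubini lets the time integral
fall on the exponential alone. -/
theorem integral_exp_mul_conj_mul_conj {g₁ g₂ : ℝ → ℂ} (h₁ : Integrable g₁) (h₂ : Integrable g₂)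
    (m t₀ t : ℝ) :
    ∫ s in t₀..t, Complex.exp (Complex.I * m * s) *
      (starRingEnd ℂ (∫ τ : ℝ, Complex.exp (Complex.I * τ * s) * g₁ τ) *
      starRingEnd ℂ (∫ τ : ℝ, Complex.exp (Complex.I * τ * s) * g₂ τ)) =
    ∫ τ₁ : ℝ, ∫ τ : ℝ, starRingEnd ℂ (g₁ τ₁) * starRingEnd ℂ (g₂ (-τ - τ₁)) *
      eint (τ + m) t₀ t := by
  have hI := integrable_conj_mul_conj h₁ h₂
  have hi2 : Integrable (Function.uncurry fun (s : ℝ) (p : ℝ × ℝ) =>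
      Complex.exp (Complex.I * ((p.2 + m : ℝ) : ℂ) * s) *
      (starRingEnd ℂ (g₁ p.1) * starRingEnd ℂ (g₂ (-p.2 - p.1))))
      ((volume.restrict (Set.uIoc t₀ t)).prod (volume.prod volume)) := by
    have : IsFiniteMeasure (volume.restrict (Set.uIoc t₀ t)) := by
      unfold Set.uIoc; infer_instance
    have h1 : Integrable (fun q : ℝ × (ℝ × ℝ) => (1 : ℂ) *
        (starRingEnd ℂ (g₁ q.2.1) * starRingEnd ℂ (g₂ (-q.2.2 - q.2.1))))
        ((volume.restrict (Set.uIoc t₀ t)).prod (volume.prod volume)) :=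
      Integrable.mul_prod (f := fun _ : ℝ => (1 : ℂ)) (integrable_const _) hI
    simp only [one_mul] at h1
    exact h1.bdd_mul (c := 1) (by fun_prop : Continuous fun q : ℝ × (ℝ × ℝ) =>
        Complex.exp (Complex.I * ((q.2.2 + m : ℝ) : ℂ) * q.1)).aestronglyMeasurable
      (Eventually.of_forall fun q => (norm_exp_I_mul_mul _ _).le)
  calc _ = ∫ s in t₀..t, ∫ p : ℝ × ℝ, Complex.exp (Complex.I * ((p.2 + m : ℝ) : ℂ) * s) *
      (starRingEnd ℂ (g₁ p.1) * starRingEnd ℂ (g₂ (-p.2 - p.1))) := by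
        refine intervalIntegral.integral_congr fun s _ => ?_
        rw [conj_mul_conj_integral h₁ h₂, ← integral_const_mul]
        refine integral_congr_ae (Eventually.of_forall fun p => ?_)
        simp only
        rw [← mul_assoc, ← Complex.exp_add]
        congr 2
        push_cast; ring
    _ = ∫ p : ℝ × ℝ, starRingEnd ℂ (g₁ p.1) * starRingEnd ℂ (g₂ (-p.2 - p.1)) *
          eint (p.2 + m) t₀ t := by
        rw [Measure.volume_eq_prod, intervalIntegral_integral_swap hi2]
        refine integral_congr_ae (Eventually.of_forall fun p => ?_)
        simp only [eint]
        rw [intervalIntegral.integral_mul_const, mul_comm]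
    _ = _ := by
        rw [Measure.volume_eq_prod, integral_prod]
        exact hI.mul_bdd (c := |t - t₀|) ((continuous_eint t₀).comp
          (by fun_prop : Continuous fun p : ℝ × ℝ => (p.2 + m, t))).aestronglyMeasurable
          (Eventually.of_forall fun p => norm_eint_le_abs _ _ _)

/-- The primitives of the truncated nonlinearities converge to the integral term of Duhamel's
formula, and are bounded uniformly. -/
theorem tendsto_integral_quad {G₁ G₂ : ℤ × ℝ → ℂ} (hG₁ : Measurable G₁) (hG₂ : Measurable G₂)
    (h₁ : ∀ m : ℤ, Integrable fun τ => G₁ (m, τ)) (h₂ : ∀ m : ℤ, Integrable fun τ => G₂ (m, τ))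
    (n : ℤ) (t₀ t : ℝ)
    (h : ∫⁻ τ : ℝ, wt (-1) (τ + (n : ℝ) ^ 2) *
      conv (fun y => ‖G₁ y‖ₑ) (fun y => ‖G₂ y‖ₑ) (n, τ) < ⊤) :
    Tendsto (fun N : ℕ => ∫ s in t₀..t, Complex.exp (Complex.I * ((n : ℝ) ^ 2 : ℝ) * s) *
      quad N (ift G₁ s) (ift G₂ s) n) atTop (𝓝 (duhTerm (nl G₁ G₂) t₀ t n)) ∧
    ∀ N : ℕ, ‖∫ s in t₀..t, Complex.exp (Complex.I * ((n : ℝ) ^ 2 : ℝ) * s) *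
      quad N (ift G₁ s) (ift G₂ s) n‖ₑ ≤ ENNReal.ofReal (|t - t₀| + 2) *
        ∫⁻ τ : ℝ, wt (-1) (τ + (n : ℝ) ^ 2) *
          conv (fun y => ‖G₁ y‖ₑ) (fun y => ‖G₂ y‖ₑ) (n, τ) := by
  set M : ℝ≥0∞ := ∫⁻ τ : ℝ, wt (-1) (τ + (n : ℝ) ^ 2) *
          conv (fun y => ‖G₁ y‖ₑ) (fun y => ‖G₂ y‖ₑ) (n, τ) with hM
  -- H is the full integrand over the frequencies of one factor and the output frequency. By the
  -- decay of `eint`, its absolute integrability is the hypothesis `h`.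
  set H : (ℤ × ℝ) → ℝ → ℂ := fun y τ => starRingEnd ℂ (G₁ y) * starRingEnd ℂ (G₂ (-(n, τ) - y)) *
    eint (τ + (n : ℝ) ^ 2) t₀ t with hH
  have hHm : Measurable (Function.uncurry H) := by
    refine ((measurable_conj (hG₁.comp measurable_fst)).mul
      (measurable_conj (hG₂.comp (f := fun p : (ℤ × ℝ) × ℝ => -(n, p.2) - p.1) ?_))).mul ?_
    · exact ((measurable_const.prodMk measurable_snd).neg).sub measurable_fst
    · exact ((continuous_eint t₀).measurable.comp (f := fun τ : ℝ => (τ + (n : ℝ) ^ 2, t))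
        (by fun_prop)).comp measurable_snd
  have hHl : ∫⁻ y, ∫⁻ τ, ‖H y τ‖ₑ ∂volume ∂freqMeasure ≤ ENNReal.ofReal (|t - t₀| + 2) * M := by
    rw [lintegral_lintegral_swap hHm.enorm.aemeasurable, hM, ← lintegral_const_mul]
    swap
    · have := measurable_conv hG₁.enorm hG₂.enorm
      fun_prop
    refine lintegral_mono fun τ => ?_
    unfold conv
    have m1 : Measurable fun y => ‖G₁ y‖ₑ * ‖G₂ (-(n, τ) - y)‖ₑ :=
      hG₁.enorm.mul (hG₂.enorm.comp (by fun_prop))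
    rw [← mul_assoc, ← lintegral_const_mul _ m1]
    refine lintegral_mono fun y => ?_
    simp only [hH, enorm_mul, enorm_conj]
    rw [mul_comm]
    exact mul_le_mul_left (enorm_eint_le _ _ _) _
  have hHi : Integrable (Function.uncurry H) (freqMeasure.prod volume) := by
    refine ⟨hHm.aestronglyMeasurable, ?_⟩
    unfold HasFiniteIntegral
    rw [lintegral_prod _ hHm.enorm.aemeasurable]
    exact hHl.trans_lt (ENNReal.mul_lt_top ENNReal.ofReal_lt_top h)
  set φ : ℤ × ℝ → ℂ := fun y => ∫ τ, H y τ with hφ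
  have hφi : Integrable φ freqMeasure := hHi.integral_prod_left
  set a : ℤ → ℂ := fun m => ∫ τ₁ : ℝ, φ (m, τ₁) with ha
  have hai : Integrable a Measure.count := hφi.integral_prod_left
  -- The sum over modes converges absolutely, hence along any exhausting family of finite sets, in
  -- particular along the truncations.
  have has : HasSum a (∫ y, φ y ∂freqMeasure) := by
    have e : ∫ y, φ y ∂freqMeasure = ∑' m, a m := by
      rw [integral_prod _ hφi, integral_countable hai]
      simp [ha]
    rw [e]
    exact (integrable_count_iff.1 hai).of_norm.hasSum
  have hae : ∑' m, ‖a m‖ₑ ≤ ENNReal.ofReal (|t - t₀| + 2) * M := by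
    refine le_trans ?_ hHl
    have hm1 : Measurable fun y => ∫⁻ τ, ‖H y τ‖ₑ := hHm.enorm.lintegral_prod_right'
    rw [lintegral_freqMeasure hm1]
    refine ENNReal.tsum_le_tsum fun m => ?_
    refine (enorm_integral_le_lintegral_enorm _).trans (lintegral_mono fun τ₁ => ?_)
    exact enorm_integral_le_lintegral_enorm _
  set c : ℂ := (2 * Real.pi : ℂ)⁻¹ with hc
  have hcr : starRingEnd ℂ c = c := by
    have : c = (((2 * Real.pi)⁻¹ : ℝ) : ℂ) := by rw [hc]; push_cast; rfl
    rw [this, Complex.conj_ofReal]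
  have hterm : ∀ m : ℤ, ∫ s in t₀..t, Complex.exp (Complex.I * ((n : ℝ) ^ 2 : ℝ) * s) *
      (starRingEnd ℂ (ift G₁ s m) * starRingEnd ℂ (ift G₂ s (-n - m))) = c * c * a m := fun m => by
    have := integral_exp_mul_conj_mul_conj (h₁ m) (h₂ (-n - m)) ((n : ℝ) ^ 2) t₀ t
    have e : a m = _ := this.symm
    rw [e, ← intervalIntegral.integral_const_mul]
    refine intervalIntegral.integral_congr fun s _ => ?_
    simp only [ift, map_mul, ← hc, hcr]
    ring
  have hquad : ∀ N : ℕ, ∫ s in t₀..t, Complex.exp (Complex.I * ((n : ℝ) ^ 2 : ℝ) * s) *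
      quad N (ift G₁ s) (ift G₂ s) n =
      c * c * ∑ m ∈ (Finset.Icc (-(N : ℤ)) N).filter (fun m => -n - m ∈ Finset.Icc (-(N : ℤ)) N),
        a m := fun N => by
    unfold quad
    simp_rw [Finset.mul_sum]
    rw [intervalIntegral.integral_finsetSum]
    · exact Finset.sum_congr rfl fun m _ => hterm m
    · intro m _
      refine Continuous.intervalIntegrable ?_ _ _
      have c1 := continuous_ift (h₁ m)
      have c2 := continuous_ift (h₂ (-n - m))
      exact (by fun_prop : Continuous fun s : ℝ =>
        Complex.exp (Complex.I * ((n : ℝ) ^ 2 : ℝ) * s)).mul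
        ((Complex.continuous_conj.comp c1).mul (Complex.continuous_conj.comp c2))
  have hduh : duhTerm (nl G₁ G₂) t₀ t n = c * c * ∫ y, φ y ∂freqMeasure := by
    have e : ∫ y, φ y ∂freqMeasure = ∫ τ, ∫ y, H y τ ∂freqMeasure := integral_integral_swap hHi
    rw [e, mul_assoc, ← integral_const_mul c]
    unfold duhTerm
    rw [← hc]
    congr 1
    refine integral_congr_ae (Eventually.of_forall fun τ => ?_)
    simp only [nl, hH, ← hc]
    rw [integral_mul_const, mul_assoc]
  refine ⟨?_, fun N => ?_⟩
  · simp_rw [hquad]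
    rw [hduh]
    refine Tendsto.const_mul _ (has.comp ?_)
    -- A mode m with |m| ≤ K survives the truncation as soon as |-n - m| ≤ N as well, hence for N ≥
    -- K + |n|.
    refine tendsto_atTop.2 fun S => ?_
    obtain ⟨K, hK⟩ : ∃ K : ℕ, ∀ m ∈ S, |m| ≤ K := by
      refine ⟨(S.sup fun m => m.natAbs), fun m hm => ?_⟩
      rw [Int.abs_eq_natAbs]
      exact_mod_cast Finset.le_sup (f := fun m : ℤ => m.natAbs) hm
    filter_upwards [eventually_ge_atTop (K + n.natAbs)] with N hN m hm
    have h1 := abs_le.1 (hK m hm)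
    have h2 : |n| = n.natAbs := Int.abs_eq_natAbs n
    have h3 := abs_le.1 h2.le
    have hN' : (K : ℤ) + n.natAbs ≤ N := by exact_mod_cast hN
    simp only [Finset.mem_filter, Finset.mem_Icc]
    omega
  · rw [hquad, enorm_mul, enorm_mul]
    calc _ ≤ 1 * 1 * ∑ m ∈ (Finset.Icc (-(N : ℤ)) N).filter
          (fun m => -n - m ∈ Finset.Icc (-(N : ℤ)) N), ‖a m‖ₑ := by
          gcongr
          · exact enorm_two_pi_inv_le
          · exact enorm_two_pi_inv_le
          · exact enorm_sum_le _ _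
      _ ≤ ∑' m, ‖a m‖ₑ := by
          rw [one_mul, one_mul]
          exact ENNReal.sum_le_tsum _
      _ ≤ _ := hae

theorem integrable_mul_eint {k : ℤ × ℝ → ℂ} (hk : Measurable k) {n : ℤ}
    (h : ∫⁻ τ : ℝ, wt (-1) (τ + (n : ℝ) ^ 2) * ‖k (n, τ)‖ₑ < ⊤) (t₀ t : ℝ) :
    Integrable fun τ : ℝ => k (n, τ) * eint (τ + (n : ℝ) ^ 2) t₀ t := by
  refine ⟨((hk.comp (by fun_prop)).mul ((continuous_eint t₀).measurable.comp
    (f := fun τ : ℝ => (τ + (n : ℝ) ^ 2, t)) (by fun_prop))).aestronglyMeasurable, ?_⟩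
  unfold HasFiniteIntegral
  refine lt_of_le_of_lt ?_ (ENNReal.mul_lt_top (a := ENNReal.ofReal (|t - t₀| + 2))
    ENNReal.ofReal_lt_top h)
  rw [← lintegral_const_mul _ (by have := hk.enorm; fun_prop)]
  refine lintegral_mono fun τ => ?_
  rw [enorm_mul, mul_comm, ← mul_assoc]
  exact mul_le_mul_left (enorm_eint_le _ _ _) _

theorem duhTerm_add {k : ℤ × ℝ → ℂ} (hk : Measurable k) {n : ℤ}
    (h : ∫⁻ τ : ℝ, wt (-1) (τ + (n : ℝ) ^ 2) * ‖k (n, τ)‖ₑ < ⊤) (t₀ t₁ t : ℝ) :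
    duhTerm k t₀ t₁ n + duhTerm k t₁ t n = duhTerm k t₀ t n := by
  unfold duhTerm
  rw [← mul_add, ← integral_add (integrable_mul_eint hk h _ _) (integrable_mul_eint hk h _ _)]
  simp_rw [← mul_add, eint_add]

theorem duhTerm_fun_add {k₁ k₂ : ℤ × ℝ → ℂ} (m₁ : Measurable k₁) (m₂ : Measurable k₂) {n : ℤ}
    (h₁ : ∫⁻ τ : ℝ, wt (-1) (τ + (n : ℝ) ^ 2) * ‖k₁ (n, τ)‖ₑ < ⊤)
    (h₂ : ∫⁻ τ : ℝ, wt (-1) (τ + (n : ℝ) ^ 2) * ‖k₂ (n, τ)‖ₑ < ⊤) (t₀ t : ℝ) :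
    duhTerm (fun x => k₁ x + k₂ x) t₀ t n = duhTerm k₁ t₀ t n + duhTerm k₂ t₀ t n := by
  unfold duhTerm
  rw [← mul_add, ← integral_add (integrable_mul_eint m₁ h₁ _ _) (integrable_mul_eint m₂ h₂ _ _)]
  simp_rw [← add_mul]

theorem continuous_duhTerm {k : ℤ × ℝ → ℂ} (hk : Measurable k) {n : ℤ}
    (h : ∫⁻ τ : ℝ, wt (-1) (τ + (n : ℝ) ^ 2) * ‖k (n, τ)‖ₑ < ⊤) (t₀ : ℝ) :
    Continuous fun t => duhTerm k t₀ t n := by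
  have hwm : Measurable fun τ : ℝ => wt (-1) (τ + (n : ℝ) ^ 2) * ‖k (n, τ)‖ₑ := by
    have := hk.enorm; fun_prop
  rw [continuous_iff_continuousAt]
  intro t₁
  unfold duhTerm
  refine continuousAt_const.mul (continuousAt_of_dominated
    (bound := fun τ => (|t₁ - t₀| + 1 + 2) * (wt (-1) (τ + (n : ℝ) ^ 2) * ‖k (n, τ)‖ₑ).toReal)
    (Eventually.of_forall fun t => ?_) ?_ ?_ ?_)
  · exact ((hk.comp (by fun_prop)).mul ((continuous_eint t₀).measurable.comp
      (f := fun τ : ℝ => (τ + (n : ℝ) ^ 2, t)) (by fun_prop))).aestronglyMeasurable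
  · filter_upwards [Metric.ball_mem_nhds t₁ one_pos] with t ht
    refine Eventually.of_forall fun τ => ?_
    have h1 : |t - t₀| + 2 ≤ |t₁ - t₀| + 1 + 2 := by
      have : |t - t₁| < 1 := by simpa [Real.dist_eq] using ht
      have h3 := abs_sub_le t t₁ t₀
      linarith
    have h2 := enorm_eint_le (τ + (n : ℝ) ^ 2) t₀ t
    have h4 := ENNReal.toReal_mono (by simp [ENNReal.mul_eq_top, wt_ne_top]) h2
    rw [toReal_enorm, ENNReal.toReal_mul, ENNReal.toReal_ofReal (by positivity)] at h4
    rw [norm_mul, ENNReal.toReal_mul, toReal_enorm]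
    calc _ ≤ ‖k (n, τ)‖ * ((|t - t₀| + 2) * (wt (-1) (τ + (n : ℝ) ^ 2)).toReal) := by gcongr
      _ ≤ ‖k (n, τ)‖ * ((|t₁ - t₀| + 1 + 2) * (wt (-1) (τ + (n : ℝ) ^ 2)).toReal) := by gcongr
      _ = _ := by ring
  · exact (integrable_toReal_of_lintegral_ne_top hwm.aemeasurable h.ne).const_mul _
  · refine Eventually.of_forall fun τ => ?_
    exact (continuous_const.mul ((continuous_eint t₀).comp
      (by fun_prop : Continuous fun t : ℝ => (τ + (n : ℝ) ^ 2, t)))).continuousAt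


/-! ### Fourier series of test functions and periodic distributions -/

theorem deriv_mem_testFn {φ : ℝ → ℂ} (h : φ ∈ TestFn) : deriv φ ∈ TestFn := by
  refine ⟨(contDiff_infty_iff_deriv.1 h.1).2, fun x => ?_⟩
  rw [← deriv_comp_add_const]
  congr 1
  funext y
  exact h.2 y

theorem differentiable_testFn (φ : TestFn) : Differentiable ℝ φ.1 :=
  φ.2.1.differentiable (by simp)

/-- Differentiation on `C^∞(𝕋)`. -/
def testDeriv : TestFn →ₗ[ℂ] TestFn where
  toFun φ := ⟨deriv φ.1, deriv_mem_testFn φ.2⟩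
  map_add' φ ψ := by
    refine Subtype.ext (funext fun x => ?_)
    exact deriv_add (differentiable_testFn φ x) (differentiable_testFn ψ x)
  map_smul' c φ := by
    refine Subtype.ext (funext fun x => ?_)
    exact deriv_const_smul c (differentiable_testFn φ x)

theorem laplacian_eq (θ : TestFn) : laplacian θ = testDeriv (testDeriv θ) := rfl

theorem iteratedDeriv_testFn (j : ℕ) (φ : TestFn) :
    iteratedDeriv j φ.1 = ((testDeriv^[j]) φ).1 := by
  induction j generalizing φ with
  | zero => simp
  | succ j ih =>
    rw [iteratedDeriv_succ', Function.iterate_succ_apply, ← ih]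
    rfl

theorem exists_bound_testFn (φ : TestFn) : ∃ M : ℝ, ∀ x, ‖φ.1 x‖ ≤ M := by
  obtain ⟨M, hM⟩ := (isCompact_Icc (a := (0 : ℝ)) (b := 2 * Real.pi)).exists_bound_of_continuousOn
    φ.2.1.continuous.continuousOn
  refine ⟨M, fun x => ?_⟩
  obtain ⟨y, hy, hxy⟩ := φ.2.2.exists_mem_Ico₀ Real.two_pi_pos x
  rw [hxy]
  exact hM y (Ico_subset_Icc_self hy)

/-- The test function `x ↦ e^{inx}`. -/
def expT (n : ℤ) : TestFn := ⟨expFn n, expFn_mem n⟩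

theorem hasDerivAt_expFn (n : ℤ) (x : ℝ) :
    HasDerivAt (expFn n) (Complex.I * n * expFn n x) x := by
  unfold expFn
  have h : HasDerivAt (fun y : ℝ => Complex.I * n * (y : ℂ)) (Complex.I * n * 1) x :=
    (Complex.ofRealCLM.hasDerivAt (x := x)).const_mul _
  have := h.cexp
  rwa [mul_one, mul_comm (Complex.exp _)] at this

theorem norm_expFn (n : ℤ) (x : ℝ) : ‖expFn n x‖ = 1 := by
  unfold expFn
  have : Complex.I * n * x = ((n * x : ℝ) : ℂ) * Complex.I := by push_cast; ring
  rw [this, Complex.norm_exp_ofReal_mul_I]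

theorem expFn_mul (m n : ℤ) (x : ℝ) : expFn m x * expFn n x = expFn (m + n) x := by
  unfold expFn
  rw [← Complex.exp_add]
  congr 1
  push_cast; ring

theorem continuous_expFn (n : ℤ) : Continuous (expFn n) := (expFn_mem n).1.continuous

/-- `∫_{-π}^{π} φ(x) e^{inx} dx`. -/
def testCoeff (n : ℤ) (φ : TestFn) : ℂ :=
  ∫ x in (-Real.pi)..Real.pi, φ.1 x * expFn n x

theorem intervalIntegrable_testCoeff (n : ℤ) (φ : TestFn) :
    IntervalIntegrable (fun x => φ.1 x * expFn n x) volume (-Real.pi) Real.pi :=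
  (φ.2.1.continuous.mul (continuous_expFn n)).intervalIntegrable _ _

theorem testCoeff_add (n : ℤ) (φ ψ : TestFn) :
    testCoeff n (φ + ψ) = testCoeff n φ + testCoeff n ψ := by
  unfold testCoeff
  rw [← intervalIntegral.integral_add (intervalIntegrable_testCoeff n φ)
    (intervalIntegrable_testCoeff n ψ)]
  refine intervalIntegral.integral_congr fun x _ => ?_
  simp only [Submodule.coe_add, Pi.add_apply]
  ring

theorem testCoeff_smul (n : ℤ) (c : ℂ) (φ : TestFn) :
    testCoeff n (c • φ) = c * testCoeff n φ := by
  unfold testCoeff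
  rw [← intervalIntegral.integral_const_mul]
  refine intervalIntegral.integral_congr fun x _ => ?_
  simp only [Submodule.coe_smul, Pi.smul_apply, smul_eq_mul]
  ring

/-- Integration by parts; the boundary terms cancel by periodicity. -/
theorem testCoeff_testDeriv (n : ℤ) (φ : TestFn) :
    testCoeff n (testDeriv φ) = -(Complex.I * n) * testCoeff n φ := by
  have h := intervalIntegral.integral_deriv_mul_eq_sub (a := -Real.pi) (b := Real.pi)
    (u := φ.1) (v := expFn n) (u' := deriv φ.1) (v' := fun x => Complex.I * n * expFn n x)
    (fun x _ => (differentiable_testFn φ x).hasDerivAt) (fun x _ => hasDerivAt_expFn n x)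
    ((deriv_mem_testFn φ.2).1.continuous.intervalIntegrable _ _)
    ((continuous_const.mul (continuous_expFn n)).intervalIntegrable _ _)
  have hb : φ.1 Real.pi * expFn n Real.pi - φ.1 (-Real.pi) * expFn n (-Real.pi) = 0 := by
    have e1 := φ.2.2 (-Real.pi)
    have e2 := (expFn_mem n).2 (-Real.pi)
    rw [show -Real.pi + 2 * Real.pi = Real.pi by ring] at e1 e2
    rw [e1, e2, sub_self]
  have hi : IntervalIntegrable (fun x => φ.1 x * (Complex.I * n * expFn n x)) volume
      (-Real.pi) Real.pi :=
    (φ.2.1.continuous.mul (continuous_const.mul (continuous_expFn n))).intervalIntegrable _ _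
  have ha := intervalIntegral.integral_add (intervalIntegrable_testCoeff n (testDeriv φ)) hi
  have h := ha.symm.trans (h.trans hb)
  have e : ∫ x in (-Real.pi)..Real.pi, φ.1 x * (Complex.I * n * expFn n x) =
      Complex.I * n * testCoeff n φ := by
    unfold testCoeff
    rw [← intervalIntegral.integral_const_mul]
    refine intervalIntegral.integral_congr fun x _ => ?_
    ring
  rw [e] at h
  have h' : testCoeff n (testDeriv φ) + Complex.I * n * testCoeff n φ = 0 := h
  linear_combination h'

theorem testCoeff_laplacian (n : ℤ) (φ : TestFn) :
    testCoeff n (laplacian φ) = -(n : ℂ) ^ 2 * testCoeff n φ := by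
  rw [laplacian_eq, testCoeff_testDeriv, testCoeff_testDeriv]
  linear_combination (n : ℂ) ^ 2 * testCoeff n φ * Complex.I_sq

theorem norm_testCoeff_le {φ : TestFn} {M : ℝ} (hM : ∀ x, ‖φ.1 x‖ ≤ M) (n : ℤ) :
    ‖testCoeff n φ‖ ≤ 2 * Real.pi * M := by
  have := intervalIntegral.norm_integral_le_of_norm_le_const (a := -Real.pi) (b := Real.pi)
    (f := fun x => φ.1 x * expFn n x) (C := M) (fun x _ => by
      rw [norm_mul, norm_expFn, mul_one]; exact hM x)
  refine this.trans (le_of_eq ?_)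
  rw [abs_of_pos (by linarith [Real.pi_pos])]
  ring

/-- The Fourier coefficients of a test function decay, with control by four derivatives. -/
theorem norm_testCoeff_mul_le {φ : TestFn} {M : ℝ}
    (hM : ∀ j ≤ 4, ∀ x, ‖iteratedDeriv j φ.1 x‖ ≤ M) (n : ℤ) :
    ‖testCoeff n φ‖ * (1 + (n : ℝ) ^ 2) ^ 2 ≤ 8 * Real.pi * M := by
  -- ψ = (1 - Δ)²φ, whose coefficients are (1 + n²)² times those of φ. Its sup norm is at most (1 +
  -- 2 + 1)M.
  set ψ : TestFn := φ + (-2 : ℂ) • laplacian φ + laplacian (laplacian φ) with hψ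
  have h1 : testCoeff n ψ = testCoeff n φ * (((1 + (n : ℝ) ^ 2) ^ 2 : ℝ) : ℂ) := by
    rw [hψ, testCoeff_add, testCoeff_add, testCoeff_smul, testCoeff_laplacian,
      testCoeff_laplacian, testCoeff_laplacian]
    push_cast
    ring
  have h2 : ∀ x, ‖ψ.1 x‖ ≤ 4 * M := fun x => by
    have e0 := hM 0 (by norm_num) x
    have e2 := hM 2 (by norm_num) x
    have e4 := hM 4 (by norm_num) x
    rw [iteratedDeriv_testFn] at e0 e2 e4
    change ‖φ.1 x‖ ≤ M at e0
    change ‖(laplacian φ).1 x‖ ≤ M at e2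
    change ‖(laplacian (laplacian φ)).1 x‖ ≤ M at e4
    have : ψ.1 x = φ.1 x + (-2 : ℂ) * (laplacian φ).1 x + (laplacian (laplacian φ)).1 x := rfl
    rw [this]
    refine (norm_add₃_le).trans ?_
    rw [norm_mul, norm_neg, Complex.norm_ofNat]
    linarith
  have h3 := norm_testCoeff_le h2 n
  rw [h1, norm_mul, Complex.norm_real, Real.norm_of_nonneg (by positivity)] at h3
  linarith

theorem exists_norm_testCoeff_mul_le (φ : TestFn) :
    ∃ C : ℝ, 0 ≤ C ∧ ∀ n, ‖testCoeff n φ‖ * (1 + (n : ℝ) ^ 2) ^ 2 ≤ C := by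
  choose M hM using fun j : ℕ => exists_bound_testFn ((testDeriv^[j]) φ)
  have hM0 : ∀ j, 0 ≤ M j := fun j => (norm_nonneg _).trans (hM j 0)
  refine ⟨8 * Real.pi * ∑ j ∈ Finset.range 5, M j, ?_, fun n => norm_testCoeff_mul_le ?_ n⟩
  · have := Finset.sum_nonneg (s := Finset.range 5) fun j _ => hM0 j
    have := Real.pi_pos
    positivity
  · intro j hj x
    rw [iteratedDeriv_testFn]
    exact (hM j x).trans (Finset.single_le_sum (f := M) (fun j _ => hM0 j)
      (Finset.mem_range.2 (by omega)))

theorem summable_inv_one_add_sq : Summable fun n : ℤ => (1 + (n : ℝ) ^ 2)⁻¹ := by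
  have h := tsum_wt_shift_le one_lt_two 0
  have ht : ∑' n : ℤ, wt (-2) (n + 0) ≠ ⊤ := ne_top_of_le_ne_top
    (ENNReal.mul_ne_top ENNReal.ofReal_ne_top (lintegral_wt_lt_top one_lt_two).ne) h
  have := ENNReal.summable_toReal ht
  refine this.congr fun n => ?_
  rw [add_zero, wt_neg_two, ENNReal.toReal_ofReal (by positivity), one_div]

theorem summable_of_mul_le {E : Type*} [SeminormedAddCommGroup E] [CompleteSpace E] {a : ℤ → E}
    {C : ℝ} (h : ∀ n, ‖a n‖ * (1 + (n : ℝ) ^ 2) ≤ C) : Summable a := by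
  refine Summable.of_norm_bounded (summable_inv_one_add_sq.mul_left C) fun n => ?_
  rw [← div_eq_mul_inv, le_div_iff₀ (by positivity)]
  exact h n

theorem summable_testCoeff (φ : TestFn) : Summable fun n => testCoeff n φ := by
  obtain ⟨C, h0, hC⟩ := exists_norm_testCoeff_mul_le φ
  refine summable_of_mul_le (C := C) fun n => le_trans ?_ (hC n)
  gcongr
  nlinarith [sq_nonneg (n : ℝ)]

/-- The Fourier series of a test function. -/
theorem hasSum_testCoeff (φ : TestFn) (x : ℝ) :
    HasSum (fun n => (2 * Real.pi : ℂ)⁻¹ * testCoeff n φ * expFn (-n) x) (φ.1 x) := by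
  have : Fact (0 < 2 * Real.pi) := ⟨Real.two_pi_pos⟩
  let f : C(AddCircle (2 * Real.pi), ℂ) := ⟨φ.2.2.lift, by
    have hq : Continuous fun x : ℝ => φ.2.2.lift (x : AddCircle (2 * Real.pi)) := by
      simpa using φ.2.1.continuous
    exact (QuotientAddGroup.isQuotientMap_mk _).continuous_iff.2 hq⟩
  have hf : ∀ y : ℝ, f (y : AddCircle (2 * Real.pi)) = φ.1 y := fun y => φ.2.2.lift_coe y
  have hfo : ∀ (n : ℤ) (y : ℝ), fourier n (y : AddCircle (2 * Real.pi)) = expFn n y :=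
    fun n y => by
      rw [fourier_coe_apply]
      unfold expFn
      congr 1
      have : (Real.pi : ℂ) ≠ 0 := by exact_mod_cast Real.pi_ne_zero
      push_cast
      field_simp
  -- `fourierCoeff` pairs with e^{-inx} and `testCoeff` with e^{inx}, hence the sign and the later
  -- reindexing by negation.
  have hc : ∀ n : ℤ, fourierCoeff f n = (2 * Real.pi : ℂ)⁻¹ * testCoeff (-n) φ := fun n => by
    rw [fourierCoeff_eq_intervalIntegral _ n (-Real.pi)]
    unfold testCoeff
    rw [show -Real.pi + 2 * Real.pi = Real.pi by ring, Complex.real_smul]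
    congr 1
    · push_cast; simp
    · refine intervalIntegral.integral_congr fun y _ => ?_
      simp only [hf, hfo, smul_eq_mul]
      ring
  have hs : Summable (fourierCoeff f) := by
    have h1 := ((summable_testCoeff φ).mul_left (2 * Real.pi : ℂ)⁻¹)
    have h2 := (Equiv.neg ℤ).summable_iff.2 h1
    refine h2.congr fun n => ?_
    simp [hc]
  have h := has_pointwise_sum_fourier_series_of_summable hs (x : AddCircle (2 * Real.pi))
  rw [hf] at h
  have h' := (Equiv.neg ℤ).hasSum_iff.2 h
  refine h'.congr_fun ?_ |> fun h => h
  intro n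
  simp [hc, hfo]

theorem testDeriv_expT (n : ℤ) : testDeriv (expT n) = (Complex.I * n) • expT n := by
  refine Subtype.ext (funext fun x => ?_)
  exact (hasDerivAt_expFn n x).deriv

theorem laplacian_expT (n : ℤ) : laplacian (expT n) = (-(n : ℂ) ^ 2) • expT n := by
  rw [laplacian_eq, testDeriv_expT, map_smul, testDeriv_expT, smul_smul]
  congr 1
  linear_combination (n : ℂ) ^ 2 * Complex.I_sq

/-- A partial sum of the Fourier series of a test function. -/
def fourierSum (A : Finset ℤ) (φ : TestFn) : TestFn :=
  ∑ n ∈ A, ((2 * Real.pi : ℂ)⁻¹ * testCoeff n φ) • expT (-n)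

theorem testDeriv_fourierSum (A : Finset ℤ) (φ : TestFn) :
    testDeriv (fourierSum A φ) = fourierSum A (testDeriv φ) := by
  unfold fourierSum
  rw [map_sum]
  refine Finset.sum_congr rfl fun n _ => ?_
  rw [map_smul, testDeriv_expT, smul_smul, testCoeff_testDeriv]
  congr 1
  push_cast
  ring

theorem iterate_testDeriv_sub_fourierSum (A : Finset ℤ) (j : ℕ) (φ : TestFn) :
    (testDeriv^[j]) (φ - fourierSum A φ) =
      (testDeriv^[j]) φ - fourierSum A ((testDeriv^[j]) φ) := by
  induction j generalizing φ with
  | zero => simp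
  | succ j ih =>
    rw [Function.iterate_succ_apply, Function.iterate_succ_apply, map_sub, testDeriv_fourierSum, ih]

/-- The error is the tail of an absolutely convergent series, uniformly in x. Since partial sums
commute with differentiation, the same bound controls every derivative. -/
theorem norm_sub_fourierSum_le (A : Finset ℤ) (φ : TestFn) (x : ℝ) :
    ‖(φ - fourierSum A φ).1 x‖ ≤ ∑' n : { n // n ∉ A }, ‖testCoeff n φ‖ := by
  have h := hasSum_testCoeff φ x
  have hA : (fourierSum A φ).1 x = ∑ n ∈ A, (2 * Real.pi : ℂ)⁻¹ * testCoeff n φ * expFn (-n) x := by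
    unfold fourierSum
    rw [Submodule.coe_sum, Finset.sum_apply]
    rfl
  have h2 : (φ - fourierSum A φ).1 x =
      ∑' n : { n // n ∉ A }, (2 * Real.pi : ℂ)⁻¹ * testCoeff n φ * expFn (-n) x := by
    have := h.summable.sum_add_tsum_subtype_compl A
    rw [h.tsum_eq] at this
    change φ.1 x - (fourierSum A φ).1 x = _
    rw [hA, ← this, add_sub_cancel_left]
  rw [h2]
  have hs : Summable fun n : { n // n ∉ A } => ‖testCoeff n φ‖ :=
    (summable_testCoeff φ).norm.subtype _
  refine tsum_of_norm_bounded hs.hasSum fun n => ?_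
  rw [norm_mul, norm_mul, norm_expFn, mul_one]
  have : ‖(2 * Real.pi : ℂ)⁻¹‖ ≤ 1 := by
    have := enorm_two_pi_inv_le
    rw [← ofReal_norm] at this
    simpa using (ENNReal.ofReal_le_one.1 this)
  exact mul_le_of_le_one_left (norm_nonneg _) this

theorem coeff_eq (Λ : Distr) (n : ℤ) : coeff Λ n = (2 * Real.pi : ℂ)⁻¹ * Λ.1 (expT (-n)) := rfl

/-- A distribution is determined by its Fourier coefficients. -/
theorem Distr.ext_coeff {Λ Λ' : Distr} (h : ∀ n, coeff Λ n = coeff Λ' n) : Λ = Λ' := by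
  rw [← sub_eq_zero]
  set D := Λ - Λ' with hD
  have hpi : (2 * Real.pi : ℂ)⁻¹ ≠ 0 := by
    refine inv_ne_zero (mul_ne_zero two_ne_zero ?_)
    exact_mod_cast Real.pi_ne_zero
  have h0 : ∀ n, D.1 (expT n) = 0 := fun n => by
    have := h (-n)
    rw [coeff_eq, coeff_eq, neg_neg] at this
    have := mul_left_cancel₀ hpi this
    change Λ.1 (expT n) - Λ'.1 (expT n) = 0
    rw [this, sub_self]
  obtain ⟨k, C, hk⟩ := D.2
  have hS : ∀ (A : Finset ℤ) (φ : TestFn), D.1 (fourierSum A φ) = 0 := fun A φ => by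
    unfold fourierSum
    rw [map_sum]
    exact Finset.sum_eq_zero fun n _ => by rw [map_smul, h0, smul_zero]
  refine Subtype.ext (LinearMap.ext fun φ => ?_)
  change D.1 φ = 0
  -- The tails of the first k derivatives bound the C^k norm of the error, where k is the order of
  -- the functional; they vanish as the finite set grows.
  set r : Finset ℤ → ℝ := fun A => ∑ j ∈ Finset.range (k + 1),
    ∑' n : { n // n ∉ A }, ‖testCoeff n ((testDeriv^[j]) φ)‖ with hr
  have hle : ∀ A, ‖D.1 φ‖ ≤ C * r A := fun A => by
    have e : D.1 φ = D.1 (φ - fourierSum A φ) := by rw [map_sub, hS, sub_zero]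
    rw [e]
    refine hk _ _ fun j hj x => ?_
    rw [iteratedDeriv_testFn, iterate_testDeriv_sub_fourierSum]
    refine (norm_sub_fourierSum_le _ _ _).trans ?_
    exact Finset.single_le_sum (f := fun j => ∑' n : { n // n ∉ A },
      ‖testCoeff n ((testDeriv^[j]) φ)‖) (fun j _ => tsum_nonneg fun n => norm_nonneg _)
      (Finset.mem_range.2 (by omega))
  have hlim : Tendsto (fun A => C * r A) atTop (𝓝 0) := by
    have : Tendsto r atTop (𝓝 (∑ j ∈ Finset.range (k + 1), (0 : ℝ))) :=
      tendsto_finsetSum _ fun j _ => tendsto_tsum_compl_atTop_zero fun n : ℤ =>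
        ‖testCoeff n ((testDeriv^[j]) φ)‖
    simpa using this.const_mul C
  exact norm_le_zero_iff.1 (ge_of_tendsto' hlim hle)

theorem testCoeff_expT (m n : ℤ) : testCoeff m (expT (-n)) =
    if m = n then (2 * Real.pi : ℂ) else 0 := by
  have hcongr : testCoeff m (expT (-n)) = ∫ x in (-Real.pi)..Real.pi, expFn (m - n) x := by
    unfold testCoeff
    refine intervalIntegral.integral_congr fun x _ => ?_
    change expFn (-n) x * expFn m x = _
    rw [expFn_mul]
    congr 1; ring
  rw [hcongr]
  split_ifs with h
  · subst h
    simp [expFn]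
    ring
  · have hne : Complex.I * ((m - n : ℤ) : ℂ) ≠ 0 :=
      mul_ne_zero Complex.I_ne_zero (by exact_mod_cast sub_ne_zero.2 h)
    have e : ∫ x in (-Real.pi)..Real.pi, expFn (m - n) x =
        (expFn (m - n) Real.pi - expFn (m - n) (-Real.pi)) / (Complex.I * ((m - n : ℤ) : ℂ)) := by
      unfold expFn
      rw [integral_exp_mul_complex hne]
    have e2 := (expFn_mem (m - n)).2 (-Real.pi)
    rw [show -Real.pi + 2 * Real.pi = Real.pi by ring] at e2
    rw [e, e2, sub_self, zero_div]

theorem norm_mul_testCoeff_le {c : ℤ → ℂ} {K : ℝ} (hc : ∀ n, ‖c n‖ ≤ K * (1 + (n : ℝ) ^ 2))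
    {φ : TestFn} {C : ℝ} (hC : ∀ n : ℤ, ‖testCoeff n φ‖ * (1 + (n : ℝ) ^ 2) ^ 2 ≤ C) (n : ℤ) :
    ‖c n * testCoeff n φ‖ * (1 + (n : ℝ) ^ 2) ≤ K * C := by
  have hK : 0 ≤ K := by simpa using (norm_nonneg _).trans (hc 0)
  rw [norm_mul]
  calc _ ≤ K * (1 + (n : ℝ) ^ 2) * ‖testCoeff n φ‖ * (1 + (n : ℝ) ^ 2) := by
        gcongr; exact hc n
    _ = K * (‖testCoeff n φ‖ * (1 + (n : ℝ) ^ 2) ^ 2) := by ring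
    _ ≤ _ := by gcongr; exact hC n

theorem summable_mul_testCoeff {c : ℤ → ℂ} {K : ℝ} (hc : ∀ n, ‖c n‖ ≤ K * (1 + (n : ℝ) ^ 2))
    (φ : TestFn) : Summable fun n => c n * testCoeff n φ := by
  obtain ⟨C, -, hC⟩ := exists_norm_testCoeff_mul_le φ
  exact summable_of_mul_le (norm_mul_testCoeff_le hc hC)

/-- The distribution with given Fourier coefficients of polynomial growth. -/
def ofCoeff (c : ℤ → ℂ) (h : ∃ K : ℝ, ∀ n, ‖c n‖ ≤ K * (1 + (n : ℝ) ^ 2)) : Distr where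
  val :=
    { toFun := fun φ => ∑' n, c n * testCoeff n φ
      map_add' := fun φ ψ => by
        obtain ⟨K, hK⟩ := h
        rw [← (summable_mul_testCoeff hK φ).tsum_add (summable_mul_testCoeff hK ψ)]
        exact tsum_congr fun n => by rw [testCoeff_add, mul_add]
      map_smul' := fun a φ => by
        rw [RingHom.id_apply, smul_eq_mul, ← tsum_mul_left]
        exact tsum_congr fun n => by rw [testCoeff_smul, mul_left_comm] }
  property := by
    obtain ⟨K, hK⟩ := h
    -- Four derivatives give decay (1+n²)^{-2}. The growth of c takes back one power and the other
    -- makes the series summable.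
    refine ⟨4, K * (8 * Real.pi) * ∑' n : ℤ, (1 + (n : ℝ) ^ 2)⁻¹, fun φ M hM => ?_⟩
    have hb := norm_mul_testCoeff_le hK (norm_testCoeff_mul_le hM)
    have := tsum_of_norm_bounded (f := fun n => c n * testCoeff n φ)
      (summable_inv_one_add_sq.mul_left (K * (8 * Real.pi * M))).hasSum fun n => by
        rw [← div_eq_mul_inv, le_div_iff₀ (by positivity)]
        exact hb n
    refine this.trans (le_of_eq ?_)
    rw [tsum_mul_left]
    ring

theorem pair_ofCoeff (c : ℤ → ℂ) (h) (φ : TestFn) :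
    pair (ofCoeff c h) φ = ∑' n, c n * testCoeff n φ := rfl

theorem coeff_ofCoeff (c : ℤ → ℂ) (h) (n : ℤ) : coeff (ofCoeff c h) n = c n := by
  change (2 * Real.pi : ℂ)⁻¹ * (∑' m, c m * testCoeff m (expT (-n))) = c n
  have hpi : (2 * Real.pi : ℂ) ≠ 0 := by
    refine mul_ne_zero two_ne_zero ?_
    exact_mod_cast Real.pi_ne_zero
  rw [tsum_eq_single n fun m hm => by rw [testCoeff_expT, if_neg hm, mul_zero],
    testCoeff_expT, if_pos rfl]
  field_simp

theorem coeff_sub (Λ Λ' : Distr) (n : ℤ) : coeff (Λ - Λ') n = coeff Λ n - coeff Λ' n := by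
  rw [coeff_eq, coeff_eq, coeff_eq, ← mul_sub]
  rfl


/-! ### From the distributional equation to Duhamel's formula -/

/-- A primitive of a test function of zero mean is a test function. -/
theorem exists_primitive {T : ℝ} {h : ℝ → ℂ} (hh : ContDiff ℝ ∞ h)
    (hs : HasCompactSupport h) (hT : tsupport h ⊆ Ioo (-T) T) (h0 : ∫ t in (-T)..T, h t = 0) :
    ∃ η : ℝ → ℂ, ContDiff ℝ ∞ η ∧ HasCompactSupport η ∧ tsupport η ⊆ Ioo (-T) T ∧ deriv η = h := by
  -- Compactness leaves a gap between the support and the endpoints. If the support is empty, any A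
  -- below T will do.
  obtain ⟨A, hA, hAT⟩ : ∃ A : ℝ, tsupport h ⊆ Icc (-A) A ∧ A < T := by
    rcases (tsupport h).eq_empty_or_nonempty with he | hne
    · exact ⟨T - 1, by simp [he], by linarith⟩
    · obtain ⟨x, hx, hmax⟩ := hs.isCompact.exists_isMaxOn hne continuous_abs.continuousOn
      refine ⟨|x|, fun y hy => abs_le.1 (hmax hy), abs_lt.2 (hT hx)⟩
  have hzero : ∀ x, x ∉ Icc (-A) A → h x = 0 := fun x hx =>
    image_eq_zero_of_notMem_tsupport fun hx' => hx (hA hx')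
  set η : ℝ → ℂ := fun t => ∫ s in (-T)..t, h s with hη
  have hd : ∀ t, HasDerivAt η (h t) t := fun t =>
    intervalIntegral.integral_hasDerivAt_right (hh.continuous.intervalIntegrable _ _)
      (hh.continuous.stronglyMeasurableAtFilter _ _) hh.continuous.continuousAt
  have hd' : deriv η = h := funext fun t => (hd t).deriv
  have hsupp : Function.support η ⊆ Icc (-A) A := by
    intro t ht
    by_contra hc
    refine ht ?_
    rw [mem_Icc, not_and_or, not_le, not_le] at hc
    have hz : ∀ a b : ℝ, (∀ s ∈ Set.uIcc a b, s ∉ Icc (-A) A) → ∫ s in a..b, h s = 0 :=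
      fun a b hab => by
        rw [intervalIntegral.integral_congr (g := fun _ => (0 : ℂ)) fun s hs => hzero s (hab s hs)]
        simp
    rcases hc with hc | hc
    · refine hz _ _ fun s hs hs' => ?_
      have := (Set.mem_uIcc.1 hs)
      rcases this with h1 | h1 <;> linarith [h1.1, h1.2, hs'.1]
    -- To the right of A the primitive is the total integral, which is zero, minus an integral over
    -- points where h vanishes.
    · have e : ∫ s in (-T)..t, h s = (∫ s in (-T)..T, h s) - ∫ s in t..T, h s := by
        rw [eq_sub_iff_add_eq]
        exact intervalIntegral.integral_add_adjacent_intervals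
          (hh.continuous.intervalIntegrable _ _) (hh.continuous.intervalIntegrable _ _)
      change ∫ s in (-T)..t, h s = 0
      rw [e, h0, hz, sub_zero]
      intro s hs hs'
      have := (Set.mem_uIcc.1 hs)
      rcases this with h1 | h1 <;> linarith [h1.1, h1.2, hs'.2]
  refine ⟨η, ?_, HasCompactSupport.of_support_subset_isCompact isCompact_Icc hsupp, ?_, hd'⟩
  · rw [contDiff_infty_iff_deriv]
    exact ⟨fun t => (hd t).differentiableAt, hd' ▸ hh⟩
  · exact (closure_minimal hsupp isClosed_Icc).trans (Icc_subset_Ioo (by linarith) hAT)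

/-- The lemma of du Bois-Reymond. -/
theorem eq_of_integral_deriv_mul_eq_zero {T : ℝ} (hT : 0 < T) {D : ℝ → ℂ} (hD : Continuous D)
    (h : ∀ η : ℝ → ℂ, ContDiff ℝ ∞ η → HasCompactSupport η → tsupport η ⊆ Ioo (-T) T →
      ∫ t in (-T)..T, deriv η t * D t = 0) {t : ℝ} (ht : t ∈ Icc (-T) T) : D t = D 0 := by
  let χ : ContDiffBump (0 : ℝ) := ⟨T / 4, T / 2, by positivity, by linarith⟩
  set χ₀ : ℝ → ℂ := fun x => (χ.normed volume x : ℂ) with hχ₀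
  have hof : ContDiff ℝ ∞ fun x : ℝ => (x : ℂ) := Complex.ofRealCLM.contDiff
  have cχ : ContDiff ℝ ∞ χ₀ := hof.comp χ.contDiff_normed
  have sχ : tsupport χ₀ ⊆ Ioo (-T) T := by
    have h1 : tsupport χ₀ ⊆ tsupport (χ.normed volume) :=
      closure_mono fun x hx hx' => hx (by simp [hχ₀, hx'])
    refine h1.trans ?_
    rw [χ.tsupport_normed_eq, Real.closedBall_eq_Icc]
    have : χ.rOut = T / 2 := rfl
    rw [this]
    exact Icc_subset_Ioo (by linarith) (by linarith)
  have hint : ∀ {g : ℝ → ℂ}, tsupport g ⊆ Ioo (-T) T → ∫ x in (-T)..T, g x = ∫ x, g x :=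
    fun {g} hg => by
      refine intervalIntegral.integral_eq_integral_of_support_subset ?_
      exact (subset_tsupport g).trans (hg.trans Ioo_subset_Ioc_self)
  have iχ : ∫ x in (-T)..T, χ₀ x = 1 := by
    rw [hint sχ, hχ₀, integral_complex_ofReal, χ.integral_normed, Complex.ofReal_one]
  have ii : ∀ {g : ℝ → ℂ}, Continuous g → IntervalIntegrable g volume (-T) T :=
    fun hg => hg.intervalIntegrable _ _
  set c : ℂ := ∫ x in (-T)..T, χ₀ x * D x with hc
  have key : ∀ᵐ x : ℝ, x ∈ Ioo (-T) T → D x - c = 0 := by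
    have hDc : Continuous fun x => D x - c := hD.sub continuous_const
    refine isOpen_Ioo.ae_eq_zero_of_integral_contDiff_smul_eq_zero
      (hDc.locallyIntegrable.locallyIntegrableOn _) fun g hg hgc hgs => ?_
    set G : ℝ → ℂ := fun x => (g x : ℂ) with hG
    have cG : ContDiff ℝ ∞ G := hof.comp hg
    have ssG : Function.support G ⊆ Function.support g :=
      fun x hx hx' => hx (by simp [hG, hx'])
    have sG : tsupport G ⊆ Ioo (-T) T := (closure_mono ssG).trans hgs
    set m : ℂ := ∫ x in (-T)..T, G x with hm
    -- Subtracting the mean times a fixed normalised bump gives mean zero, so H is the derivative of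
    -- an admissible test function.
    set H : ℝ → ℂ := fun x => G x - m * χ₀ x with hH
    have cH : ContDiff ℝ ∞ H := cG.sub (contDiff_const.mul cχ)
    have sH : tsupport H ⊆ Ioo (-T) T := by
      have h1 : tsupport H ⊆ tsupport G ∪ tsupport χ₀ := by
        refine closure_minimal (fun x hx => ?_)
          ((isClosed_tsupport _).union (isClosed_tsupport _))
        by_contra hx'
        rw [mem_union, not_or] at hx'
        refine hx ?_
        simp only [hH]
        rw [image_eq_zero_of_notMem_tsupport hx'.1, image_eq_zero_of_notMem_tsupport hx'.2]
        simp
      exact h1.trans (union_subset sG sχ)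
    have iH : ∫ x in (-T)..T, H x = 0 := by
      simp only [hH]
      rw [intervalIntegral.integral_sub (ii cG.continuous)
        (ii (g := fun x => m * χ₀ x) (continuous_const.mul cχ.continuous)),
        intervalIntegral.integral_const_mul, iχ, mul_one, sub_self]
    have kH : HasCompactSupport H :=
      isCompact_Icc.of_isClosed_subset (isClosed_tsupport _) (sH.trans Ioo_subset_Icc_self)
    obtain ⟨η, e1, e2, e3, e4⟩ := exists_primitive cH kH sH iH
    have e5 := h η e1 e2 e3
    rw [e4] at e5
    have ssD : Function.support (fun x => G x * (D x - c)) ⊆ Function.support G :=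
      fun x hx hx' => hx (by simp [hx'])
    have sGD : tsupport (fun x => G x * (D x - c)) ⊆ Ioo (-T) T := (closure_mono ssD).trans sG
    have e6 : ∫ x, g x • (D x - c) = ∫ x in (-T)..T, G x * (D x - c) := by
      rw [hint sGD]
      rfl
    rw [e6, ← e5]
    have i1 : ∫ x in (-T)..T, G x * (D x - c) =
        (∫ x in (-T)..T, G x * D x) - ∫ x in (-T)..T, G x * c := by
      rw [← intervalIntegral.integral_sub (ii (g := fun x => G x * D x) (cG.continuous.mul hD))
        (ii (g := fun x => G x * c) (cG.continuous.mul continuous_const))]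
      simp_rw [mul_sub]
    have i2 : ∫ x in (-T)..T, H x * D x =
        (∫ x in (-T)..T, G x * D x) - ∫ x in (-T)..T, m * (χ₀ x * D x) := by
      rw [← intervalIntegral.integral_sub (ii (g := fun x => G x * D x) (cG.continuous.mul hD))
        (ii (g := fun x => m * (χ₀ x * D x)) (continuous_const.mul (cχ.continuous.mul hD)))]
      refine intervalIntegral.integral_congr fun x _ => ?_
      simp only [hH]; ring
    rw [i1, i2, intervalIntegral.integral_mul_const, intervalIntegral.integral_const_mul]
  -- Equality almost everywhere on the open interval becomes equality on the closed interval by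
  -- continuity, so the endpoints are included.
  have hE : EqOn D (fun _ => c) (Icc (-T) T) := by
    have h1 : EqOn D (fun _ => c) (Ioo (-T) T) := by
      refine Measure.eqOn_Ioo_of_ae_eq (μ := volume) ?_ hD.continuousOn continuousOn_const
      rw [EventuallyEq, ae_restrict_iff' measurableSet_Ioo]
      exact key.mono fun x hx hx' => sub_eq_zero.1 (hx hx')
    have h2 := h1.closure hD continuous_const
    rwa [closure_Ioo (by linarith)] at h2
  rw [hE ht, hE ⟨by linarith, hT.le⟩]

theorem quad_eq_zero {N : ℕ} {m : ℤ} (c d : ℤ → ℂ)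
    (hm : m ∉ Finset.Icc (-(2 * N : ℤ)) (2 * N)) : quad N c d m = 0 := by
  unfold quad
  rw [Finset.filter_eq_empty_iff.2, Finset.sum_empty]
  intro a ha hb
  simp only [Finset.mem_Icc] at ha hb hm
  omega

/-- The pairing of the square of a truncation with a test function. -/
theorem integral_trunc_sq (N : ℕ) (g : Distr) (θ : TestFn) :
    ∫ x in (-Real.pi)..Real.pi, (starRingEnd ℂ (trunc N g x)) ^ 2 * θ.1 x =
      ∑ m ∈ Finset.Icc (-(2 * N : ℤ)) (2 * N), testCoeff m θ * quad N (coeff g) (coeff g) m := by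
  set I := Finset.Icc (-(N : ℤ)) N with hI
  have hconj : ∀ n x, starRingEnd ℂ (expFn n x) = expFn (-n) x := fun n x => by
    unfold expFn
    rw [← Complex.exp_conj]
    congr 1
    simp
  have h1 : ∀ x, (starRingEnd ℂ (trunc N g x)) ^ 2 * θ.1 x =
      ∑ a ∈ I, ∑ b ∈ I, starRingEnd ℂ (coeff g a) * starRingEnd ℂ (coeff g b) *
        (θ.1 x * expFn (-a - b) x) := fun x => by
    unfold trunc
    rw [map_sum, sq, Finset.sum_mul_sum, Finset.sum_mul]
    refine Finset.sum_congr rfl fun a _ => ?_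
    rw [Finset.sum_mul]
    refine Finset.sum_congr rfl fun b _ => ?_
    rw [map_mul, map_mul, hconj, hconj, sub_eq_add_neg, ← expFn_mul]
    ring
  have hi : ∀ a b, IntervalIntegrable (fun x => starRingEnd ℂ (coeff g a) *
      starRingEnd ℂ (coeff g b) * (θ.1 x * expFn (-a - b) x)) volume (-Real.pi) Real.pi :=
    fun a b => (intervalIntegrable_testCoeff _ θ).const_mul _
  have hi' : ∀ a, IntervalIntegrable (fun x => ∑ b ∈ I, starRingEnd ℂ (coeff g a) *
      starRingEnd ℂ (coeff g b) * (θ.1 x * expFn (-a - b) x)) volume (-Real.pi) Real.pi :=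
    fun a => by
      have h := IntervalIntegrable.sum I fun b _ => hi a b
      rwa [Finset.sum_fn] at h
  simp_rw [h1]
  rw [intervalIntegral.integral_finsetSum fun a _ => hi' a]
  simp_rw [quad, Finset.mul_sum, Finset.sum_filter]
  rw [Finset.sum_comm]
  refine Finset.sum_congr rfl fun a ha => ?_
  rw [intervalIntegral.integral_finsetSum fun b _ => hi a b, ← Finset.sum_filter]
  symm
  -- For fixed a the conjugated frequencies give m = -a - b; both ranges together force |m| ≤ 2N.
  refine Finset.sum_bij' (fun m _ => -m - a) (fun b _ => -a - b) ?_ ?_ ?_ ?_ ?_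
  · intro m hm
    exact (Finset.mem_filter.1 hm).2
  · intro b hb
    simp only [Finset.mem_filter, Finset.mem_Icc, hI] at ha hb ⊢
    omega
  · intro m _; ring
  · intro b _; ring
  · intro m _
    rw [intervalIntegral.integral_const_mul, mul_comm]
    congr 1
    unfold testCoeff
    congr 1
    funext x
    congr 2
    ring

/-- The modulated cutoff `t ↦ η(t) e^{-im²t}`. -/
def etaMod (η : ℝ → ℂ) (m : ℤ) (t : ℝ) : ℂ := η t * Complex.exp (-Complex.I * (m : ℂ) ^ 2 * t)

theorem hasDerivAt_exp_free (m : ℤ) (t : ℝ) :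
    HasDerivAt (fun t : ℝ => Complex.exp (-Complex.I * (m : ℂ) ^ 2 * t))
      (-Complex.I * (m : ℂ) ^ 2 * Complex.exp (-Complex.I * (m : ℂ) ^ 2 * t)) t := by
  have h : HasDerivAt (fun y : ℝ => -Complex.I * (m : ℂ) ^ 2 * (y : ℂ))
      (-Complex.I * (m : ℂ) ^ 2 * 1) t :=
    (Complex.ofRealCLM.hasDerivAt (x := t)).const_mul _
  have := h.cexp
  rwa [mul_one, mul_comm (Complex.exp _)] at this

theorem hasDerivAt_etaMod {η : ℝ → ℂ} (hη : ContDiff ℝ ∞ η) (m : ℤ) (t : ℝ) :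
    HasDerivAt (etaMod η m) ((deriv η t - Complex.I * (m : ℂ) ^ 2 * η t) *
      Complex.exp (-Complex.I * (m : ℂ) ^ 2 * t)) t := by
  have h := ((hη.differentiable (by simp)) t).hasDerivAt.mul (hasDerivAt_exp_free m t)
  refine h.congr_deriv ?_
  ring

theorem norm_exp_free (m : ℤ) (t : ℝ) : ‖Complex.exp (-Complex.I * (m : ℂ) ^ 2 * t)‖ = 1 := by
  have : -Complex.I * (m : ℂ) ^ 2 * t = ((-((m : ℝ) ^ 2 * t) : ℝ) : ℂ) * Complex.I := by
    push_cast; ring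
  rw [this, Complex.norm_exp_ofReal_mul_I]

theorem exp_free_mul (m : ℤ) (t : ℝ) : Complex.exp (-Complex.I * (m : ℂ) ^ 2 * t) *
    Complex.exp (Complex.I * ((m : ℝ) ^ 2 : ℝ) * t) = 1 := by
  rw [← Complex.exp_add, ← Complex.exp_zero]
  congr 1
  push_cast; ring

theorem contDiff_exp_free (m : ℤ) :
    ContDiff ℝ ∞ fun t : ℝ => Complex.exp (-Complex.I * (m : ℂ) ^ 2 * t) := by
  have h : ContDiff ℝ ∞ (fun x : ℝ => (x : ℂ)) := Complex.ofRealCLM.contDiff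
  exact (contDiff_const.mul h).cexp

theorem contDiff_etaMod {η : ℝ → ℂ} (hη : ContDiff ℝ ∞ η) (m : ℤ) : ContDiff ℝ ∞ (etaMod η m) :=
  hη.mul (contDiff_exp_free m)

theorem continuous_deriv_etaMod {η : ℝ → ℂ} (hη : ContDiff ℝ ∞ η) (m : ℤ) :
    Continuous (deriv (etaMod η m)) :=
  (contDiff_infty_iff_deriv.1 (contDiff_etaMod hη m)).2.continuous

/-- Differentiating the free phase costs 1 + m². This loss is later paid by the decay of the
coefficients of the spatial test function. -/
theorem exists_norm_deriv_etaMod_le {η : ℝ → ℂ} (hη : ContDiff ℝ ∞ η) (hs : HasCompactSupport η) :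
    ∃ B : ℝ, 0 ≤ B ∧ ∀ (m : ℤ) (t : ℝ), ‖deriv (etaMod η m) t‖ ≤ B * (1 + (m : ℝ) ^ 2) := by
  obtain ⟨B₀, hB₀⟩ := hs.exists_bound_of_continuous hη.continuous
  obtain ⟨B₁, hB₁⟩ := hs.deriv.exists_bound_of_continuous
    (contDiff_infty_iff_deriv.1 hη).2.continuous
  have p₀ : 0 ≤ B₀ := (norm_nonneg _).trans (hB₀ 0)
  have p₁ : 0 ≤ B₁ := (norm_nonneg _).trans (hB₁ 0)
  refine ⟨B₀ + B₁, by positivity, fun m t => ?_⟩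
  rw [(hasDerivAt_etaMod hη m t).deriv, norm_mul, norm_exp_free, mul_one]
  refine (norm_sub_le _ _).trans ?_
  rw [norm_mul, norm_mul, Complex.norm_I, one_mul, norm_pow, Complex.norm_intCast, sq_abs]
  have := hB₀ t
  have := hB₁ t
  have : (m : ℝ) ^ 2 * ‖η t‖ ≤ (m : ℝ) ^ 2 * B₀ := by gcongr
  nlinarith [sq_nonneg (m : ℝ)]

theorem eq_zero_of_tsupport_subset {T : ℝ} {η : ℝ → ℂ} (h : tsupport η ⊆ Ioo (-T) T) :
    η T = 0 ∧ η (-T) = 0 :=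
  ⟨image_eq_zero_of_notMem_tsupport fun h' => lt_irrefl _ (h h').2,
    image_eq_zero_of_notMem_tsupport fun h' => lt_irrefl _ (h h').1⟩

/-- The properties of `U` needed to make sense of the nonlinearity. -/
structure Admissible (U : ℤ × ℝ → ℂ) (K : ℝ) : Prop where
  measurable : Measurable U
  slice : ∀ m : ℤ, Integrable fun τ => U (m, τ)
  conv_le : ∀ n : ℤ, ∫⁻ τ : ℝ, wt (-1) (τ + (n : ℝ) ^ 2) *
    conv (fun y => ‖U y‖ₑ) (fun y => ‖U y‖ₑ) (n, τ) ≤ ENNReal.ofReal K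

theorem continuous_quad_ift {U W : ℤ × ℝ → ℂ} (hU : ∀ m : ℤ, Integrable fun τ => U (m, τ))
    (hW : ∀ m : ℤ, Integrable fun τ => W (m, τ)) (N : ℕ) (m : ℤ) :
    Continuous fun t => quad N (ift U t) (ift W t) m := by
  unfold quad
  refine continuous_finsetSum _ fun a _ => ?_
  exact (Complex.continuous_conj.comp (continuous_ift (hU a))).mul
    (Complex.continuous_conj.comp (continuous_ift (hW _)))

theorem continuous_exp_osc (m : ℤ) :
    Continuous fun s : ℝ => Complex.exp (Complex.I * ((m : ℝ) ^ 2 : ℝ) * s) := by fun_prop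

/-- The primitive of the truncated nonlinearity. -/
def quadPrim (U : ℤ × ℝ → ℂ) (N : ℕ) (m : ℤ) (t : ℝ) : ℂ :=
  ∫ s in (0 : ℝ)..t, Complex.exp (Complex.I * ((m : ℝ) ^ 2 : ℝ) * s) *
      quad N (ift U s) (ift U s) m

/-- Integration by parts against the modulated cutoff moves the limit onto the primitives, for which
convergence and uniform bounds are known. -/
theorem integral_eta_mul_quad {U : ℤ × ℝ → ℂ} (hU : ∀ m : ℤ, Integrable fun τ => U (m, τ))
    {T : ℝ} {η : ℝ → ℂ} (hη : ContDiff ℝ ∞ η) (hs : tsupport η ⊆ Ioo (-T) T) (N : ℕ) (m : ℤ) :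
    ∫ t in (-T)..T, η t * quad N (ift U t) (ift U t) m =
      -∫ t in (-T)..T, deriv (etaMod η m) t * quadPrim U N m t := by
  have hc : Continuous fun s : ℝ => Complex.exp (Complex.I * ((m : ℝ) ^ 2 : ℝ) * s) *
      quad N (ift U s) (ift U s) m := (continuous_exp_osc m).mul (continuous_quad_ift hU hU N m)
  have hd : ∀ t : ℝ, HasDerivAt (quadPrim U N m) (Complex.exp (Complex.I * ((m : ℝ) ^ 2 : ℝ) * t) *
      quad N (ift U t) (ift U t) m) t := fun t =>
    intervalIntegral.integral_hasDerivAt_right (hc.intervalIntegrable _ _)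
      (hc.stronglyMeasurableAtFilter _ _) hc.continuousAt
  have h := intervalIntegral.integral_mul_deriv_eq_deriv_mul (a := -T) (b := T)
    (u := etaMod η m) (v := quadPrim U N m)
    (fun t _ => ((contDiff_etaMod hη m).differentiable (by simp) t).hasDerivAt)
    (fun t _ => hd t) ((continuous_deriv_etaMod hη m).intervalIntegrable _ _)
    (hc.intervalIntegrable _ _)
  obtain ⟨z1, z2⟩ := eq_zero_of_tsupport_subset hs
  have e1 : etaMod η m T = 0 := by simp [etaMod, z1]
  have e2 : etaMod η m (-T) = 0 := by simp [etaMod, z2]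
  rw [e1, e2, zero_mul, zero_mul, sub_zero, zero_sub] at h
  rw [← h]
  refine intervalIntegral.integral_congr fun t _ => ?_
  simp only [etaMod]
  have := exp_free_mul m t
  linear_combination (-(η t * quad N (ift U t) (ift U t) m)) * this

theorem Admissible.tendsto_quadPrim {U : ℤ × ℝ → ℂ} {K : ℝ} (hU : Admissible U K) (m : ℤ) (t : ℝ) :
    Tendsto (fun N => quadPrim U N m t) atTop (𝓝 (duhTerm (nl U U) 0 t m)) :=
  (tendsto_integral_quad hU.measurable hU.measurable hU.slice hU.slice m 0 t
    ((hU.conv_le m).trans_lt ENNReal.ofReal_lt_top)).1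

theorem Admissible.norm_quadPrim_le {U : ℤ × ℝ → ℂ} {K : ℝ} (hK : 0 ≤ K) (hU : Admissible U K)
    (N : ℕ) (m : ℤ) (t : ℝ) : ‖quadPrim U N m t‖ ≤ (|t| + 2) * K := by
  have h := (tendsto_integral_quad hU.measurable hU.measurable hU.slice hU.slice m 0 t
    ((hU.conv_le m).trans_lt ENNReal.ofReal_lt_top)).2 N
  have h2 : ‖quadPrim U N m t‖ₑ ≤ ENNReal.ofReal (|t - 0| + 2) * ENNReal.ofReal K :=
    h.trans (mul_le_mul_right (hU.conv_le m) _)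
  rw [← ENNReal.ofReal_mul (by positivity), sub_zero, ← ofReal_norm] at h2
  exact (ENNReal.ofReal_le_ofReal_iff (by positivity)).1 h2

/-- The limit of the truncated nonlinearities, in the sense of distributions. -/
theorem Admissible.tendsto_nonlinearity {U : ℤ × ℝ → ℂ} {K : ℝ} (hK : 0 ≤ K)
    (hU : Admissible U K) {T : ℝ} (hT : 0 < T) {u : ℝ → Distr}
    (hu : ∀ t ∈ Icc (-T) T, ∀ n, coeff (u t) n = ift U t n) {η : ℝ → ℂ} (hη : ContDiff ℝ ∞ η)
    (hc : HasCompactSupport η) (hs : tsupport η ⊆ Ioo (-T) T) (θ : TestFn) :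
    Tendsto (fun N : ℕ => ∫ t in (-T)..T, η t *
          ∫ x in (-Real.pi)..Real.pi, (starRingEnd ℂ (trunc N (u t) x)) ^ 2 * θ.1 x) atTop
      (𝓝 (∑' m : ℤ, testCoeff m θ *
        -∫ t in (-T)..T, deriv (etaMod η m) t * duhTerm (nl U U) 0 t m)) := by
  have hcq : ∀ N m, Continuous fun t => testCoeff m θ * (η t * quad N (ift U t) (ift U t) m) :=
    fun N m => continuous_const.mul <| hη.continuous.mul (continuous_quad_ift hU.slice hU.slice N m)
  have e1 : ∀ N : ℕ, ∫ t in (-T)..T, η t *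
      ∫ x in (-Real.pi)..Real.pi, (starRingEnd ℂ (trunc N (u t) x)) ^ 2 * θ.1 x =
      ∑' m : ℤ, testCoeff m θ * -∫ t in (-T)..T, deriv (etaMod η m) t * quadPrim U N m t := by
    intro N
    have h1 : ∫ t in (-T)..T, η t *
        ∫ x in (-Real.pi)..Real.pi, (starRingEnd ℂ (trunc N (u t) x)) ^ 2 * θ.1 x =
        ∫ t in (-T)..T, ∑ m ∈ Finset.Icc (-(2 * N : ℤ)) (2 * N), testCoeff m θ *
          (η t * quad N (ift U t) (ift U t) m) := by
      refine intervalIntegral.integral_congr fun t ht => ?_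
      rw [uIcc_of_le (by linarith)] at ht
      have hf : coeff (u t) = ift U t := funext (hu t ht)
      rw [integral_trunc_sq, Finset.mul_sum, hf]
      exact Finset.sum_congr rfl fun m _ => by ring
    rw [h1, intervalIntegral.integral_finsetSum
      fun m _ => (hcq N m).intervalIntegrable _ _]
    simp_rw [← integral_eta_mul_quad hU.slice hη hs, intervalIntegral.integral_const_mul]
    refine (tsum_eq_sum fun m hm => ?_).symm
    simp [quad_eq_zero _ _ hm]
  simp_rw [e1]
  obtain ⟨C, hC0, hC⟩ := exists_norm_testCoeff_mul_le θ
  obtain ⟨B, hB0, hB⟩ := exists_norm_deriv_etaMod_le hη hc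
  have hpt : ∀ N m, ∀ t ∈ Set.uIoc (-T) T, ‖deriv (etaMod η m) t * quadPrim U N m t‖ ≤
      B * (1 + (m : ℝ) ^ 2) * ((T + 2) * K) := by
    intro N m t ht
    rw [uIoc_of_le (by linarith)] at ht
    have : |t| ≤ T := abs_le.2 ⟨ht.1.le, ht.2⟩
    rw [norm_mul]
    refine mul_le_mul (hB m t) ((hU.norm_quadPrim_le hK N m t).trans (by gcongr))
      (norm_nonneg _) (by positivity)
  have hprim : ∀ N m, Continuous (quadPrim U N m) := fun N m =>
    intervalIntegral.continuous_primitive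
      (fun a b => (((continuous_exp_osc m).mul
        (continuous_quad_ift hU.slice hU.slice N m)).intervalIntegrable a b)) 0
  -- Dominated convergence in m, and inside each term in t. The coefficient decay (1+m²)^{-2}
  -- against the loss 1 + m² leaves a summable bound.
  refine tendsto_tsum_of_dominated_convergence
    (bound := fun m : ℤ => C * B * ((T + 2) * K) * (2 * T) * (1 + (m : ℝ) ^ 2)⁻¹)
    (summable_inv_one_add_sq.mul_left _) (fun m => ?_) (Eventually.of_forall fun N m => ?_)
  · refine (Tendsto.neg ?_).const_mul _
    refine intervalIntegral.tendsto_integral_filter_of_dominated_convergence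
      (fun _ => B * (1 + (m : ℝ) ^ 2) * ((T + 2) * K)) (Eventually.of_forall fun N => ?_)
      (Eventually.of_forall fun N => Eventually.of_forall fun t ht => hpt N m t ht)
      intervalIntegrable_const (Eventually.of_forall fun t _ => ?_)
    · exact ((continuous_deriv_etaMod hη m).mul (hprim N m)).aestronglyMeasurable
    · exact (hU.tendsto_quadPrim m t).const_mul _
  · have h1 := intervalIntegral.norm_integral_le_of_norm_le_const (hpt N m)
    rw [norm_mul, norm_neg, ← div_eq_mul_inv, le_div_iff₀ (by positivity)]
    have e : |T - -T| = 2 * T := by rw [abs_of_pos (by linarith)]; ring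
    rw [e] at h1
    calc _ ≤ ‖testCoeff m θ‖ * (B * (1 + (m : ℝ) ^ 2) * ((T + 2) * K) * (2 * T)) *
          (1 + (m : ℝ) ^ 2) := by gcongr
      _ = (‖testCoeff m θ‖ * (1 + (m : ℝ) ^ 2) ^ 2) * (B * ((T + 2) * K) * (2 * T)) := by ring
      _ ≤ C * (B * ((T + 2) * K) * (2 * T)) := by gcongr; exact hC m
      _ = _ := by ring

theorem Admissible.lintegral_nl_lt_top {U : ℤ × ℝ → ℂ} {K : ℝ} (hU : Admissible U K) (n : ℤ) :
    ∫⁻ τ : ℝ, wt (-1) (τ + (n : ℝ) ^ 2) * ‖nl U U (n, τ)‖ₑ < ⊤ := by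
  refine lt_of_le_of_lt (lintegral_mono fun τ => ?_)
    ((hU.conv_le n).trans_lt ENNReal.ofReal_lt_top)
  exact mul_le_mul_right (enorm_nl_le _ _ _) _

theorem Admissible.continuous_duhTerm {U : ℤ × ℝ → ℂ} {K : ℝ} (hU : Admissible U K) (m : ℤ) :
    Continuous fun t => duhTerm (nl U U) 0 t m :=
  NLSTorus.continuous_duhTerm (measurable_nl hU.measurable hU.measurable)
    (hU.lintegral_nl_lt_top m) 0

/-- A solution in the sense of distributions satisfies Duhamel's formula. -/
theorem Admissible.duhamel_of_isSolution {U : ℤ × ℝ → ℂ} {K : ℝ} (hK : 0 ≤ K)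
    (hU : Admissible U K) {κ T : ℝ} (hT : 0 < T) {f : Distr} {u : ℝ → Distr}
    (hu : ∀ t ∈ Icc (-T) T, ∀ n, coeff (u t) n = ift U t n) (hsol : IsSolution κ T f u)
    {t : ℝ} (ht : t ∈ Icc (-T) T) (n : ℤ) :
    Complex.exp (Complex.I * ((n : ℝ) ^ 2 : ℝ) * t) * ift U t n =
      coeff f n - Complex.I * κ * duhTerm (nl U U) 0 t n := by
  set v : ℝ → ℂ := fun t => Complex.exp (Complex.I * ((n : ℝ) ^ 2 : ℝ) * t) * ift U t n with hv
  have cv : Continuous v := (continuous_exp_osc n).mul (continuous_ift (hU.slice n))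
  have cd := hU.continuous_duhTerm n
  have hpi : (2 * Real.pi : ℂ) ≠ 0 := by
    refine mul_ne_zero two_ne_zero ?_
    exact_mod_cast Real.pi_ne_zero
  have h0 : (0 : ℝ) ∈ Icc (-T) T := ⟨by linarith, hT.le⟩
  have hD := eq_of_integral_deriv_mul_eq_zero hT
    (D := fun t => v t + Complex.I * κ * duhTerm (nl U U) 0 t n)
    (cv.add (continuous_const.mul cd)) ?_ ht
  · have e0 : v 0 = coeff f n := by
      simp only [hv]
      rw [← hu 0 h0, hsol.1]
      simp
    have e1 : duhTerm (nl U U) 0 0 n = 0 := by simp [duhTerm, eint]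
    rw [e0, e1, mul_zero, add_zero] at hD
    rw [← hD]
    ring
  intro χ hχ hχc hχs
  -- This choice makes the modulated cutoff for the mode n equal to χ, while the spatial test
  -- function e^{-inx} isolates that mode.
  set η : ℝ → ℂ := fun t => χ t * Complex.exp (Complex.I * ((n : ℝ) ^ 2 : ℝ) * t) with hη
  have cη : ContDiff ℝ ∞ η := by
    have h : ContDiff ℝ ∞ (fun x : ℝ => (x : ℂ)) := Complex.ofRealCLM.contDiff
    exact hχ.mul (contDiff_const.mul h).cexp
  have sub : Function.support η ⊆ Function.support χ := fun x hx hx' => hx (by simp [hη, hx'])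
  have sη : tsupport η ⊆ Ioo (-T) T := (closure_mono sub).trans hχs
  have kη : HasCompactSupport η := hχc.mono sub
  have hmod : etaMod η n = χ := by
    funext t
    simp only [etaMod, hη]
    have := exp_free_mul n t
    linear_combination χ t * this
  have h1 := (hU.tendsto_nonlinearity hK hT hu cη kη sη (expT (-n))).const_mul (κ : ℂ)
  have h2 := hsol.2 η (expT (-n)) cη kη sη
  have h3 := tendsto_nhds_unique h2 h1
  rw [tsum_eq_single n fun m hm => by rw [testCoeff_expT, if_neg hm, zero_mul],
    testCoeff_expT, if_pos rfl, hmod] at h3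
  have hcont : ∀ {g : ℝ → ℂ}, Continuous g →
      IntervalIntegrable (fun t => deriv χ t * g t) volume (-T) T := fun {g} hg =>
    (((contDiff_infty_iff_deriv.1 hχ).2.continuous).mul hg).intervalIntegrable _ _
  have h4 : ∫ t in (-T)..T, (-Complex.I * deriv η t * pair (u t) (expT (-n)) +
      η t * pair (u t) (laplacian (expT (-n)))) =
      (2 * Real.pi : ℂ) * (-Complex.I * ∫ t in (-T)..T, deriv χ t * v t) := by
    rw [← intervalIntegral.integral_const_mul, ← intervalIntegral.integral_const_mul]
    refine intervalIntegral.integral_congr fun t ht => ?_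
    rw [uIcc_of_le (by linarith)] at ht
    have p1 : pair (u t) (expT (-n)) = 2 * Real.pi * ift U t n := by
      rw [← hu t ht, coeff_eq, pair]
      field_simp
    have p2 : pair (u t) (laplacian (expT (-n))) = -(n : ℂ) ^ 2 * (2 * Real.pi * ift U t n) := by
      rw [← p1, laplacian_expT, pair, map_smul, smul_eq_mul, pair]
      push_cast
      ring
    have p3 : deriv χ t = (deriv η t - Complex.I * (n : ℂ) ^ 2 * η t) *
      Complex.exp (-Complex.I * (n : ℂ) ^ 2 * t) := by
      rw [← hmod, (hasDerivAt_etaMod cη n t).deriv]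
    rw [p1, p2, p3]
    have := exp_free_mul n t
    simp only [hv]
    linear_combination ((2 * Real.pi : ℂ) * Complex.I *
      (deriv η t - Complex.I * (n : ℂ) ^ 2 * η t) * ift U t n) * this +
      (-(n : ℂ) ^ 2 * η t * (2 * Real.pi * ift U t n)) * Complex.I_sq
  rw [h4] at h3
  simp_rw [mul_add]
  rw [intervalIntegral.integral_add (hcont cv)
    (hcont (g := fun t => Complex.I * κ * duhTerm (nl U U) 0 t n) (continuous_const.mul cd))]
  have h5 : ∫ t in (-T)..T, deriv χ t * (Complex.I * κ * duhTerm (nl U U) 0 t n) =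
      Complex.I * κ * ∫ t in (-T)..T, deriv χ t * duhTerm (nl U U) 0 t n := by
    rw [← intervalIntegral.integral_const_mul]
    refine intervalIntegral.integral_congr fun t _ => ?_
    ring
  rw [h5]
  have h6 : -Complex.I * (∫ t in (-T)..T, deriv χ t * v t) =
      κ * -∫ t in (-T)..T, deriv χ t * duhTerm (nl U U) 0 t n := by
    refine mul_left_cancel₀ hpi ?_
    rw [h3]; ring
  linear_combination Complex.I * h6 + (∫ t in (-T)..T, deriv χ t * v t) * Complex.I_sq


/-! ### From Duhamel's formula back to the distributional equation -/

/-- The additional factor 1 - Δ gives a third power. One power pays for the derivative of the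
modulated cutoff, one for the growth of the solution's coefficients, and one for summability. -/
theorem exists_norm_testCoeff_mul_pow_three_le (φ : TestFn) :
    ∃ C : ℝ, 0 ≤ C ∧ ∀ n, ‖testCoeff n φ‖ * (1 + (n : ℝ) ^ 2) ^ 3 ≤ C := by
  obtain ⟨C, hC0, hC⟩ := exists_norm_testCoeff_mul_le (φ + (-1 : ℂ) • laplacian φ)
  refine ⟨C, hC0, fun n => le_of_eq_of_le ?_ (hC n)⟩
  have h1 : testCoeff n (φ + (-1 : ℂ) • laplacian φ) =
      ((1 + (n : ℝ) ^ 2 : ℝ) : ℂ) * testCoeff n φ := by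
    rw [testCoeff_add, testCoeff_smul, testCoeff_laplacian]
    push_cast
    ring
  rw [h1, norm_mul, Complex.norm_real, Real.norm_of_nonneg (by positivity)]
  ring

/-- A distribution with Fourier coefficients of polynomial growth is the sum of its Fourier
series. -/
theorem hasSum_pair {Λ : Distr} {c : ℤ → ℂ} {K : ℝ} (hΛ : ∀ n, coeff Λ n = c n)
    (hc : ∀ n, ‖c n‖ ≤ K * (1 + (n : ℝ) ^ 2)) (θ : TestFn) :
    HasSum (fun n => c n * testCoeff n θ) (pair Λ θ) := by
  have h : Λ = ofCoeff c ⟨K, hc⟩ := Distr.ext_coeff fun n => by rw [hΛ, coeff_ofCoeff]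
  rw [h, pair_ofCoeff]
  exact (summable_mul_testCoeff hc θ).hasSum

theorem integral_deriv_etaMod {T : ℝ} {η : ℝ → ℂ} (hη : ContDiff ℝ ∞ η)
    (hs : tsupport η ⊆ Ioo (-T) T) (m : ℤ) : ∫ t in (-T)..T, deriv (etaMod η m) t = 0 := by
  obtain ⟨z1, z2⟩ := eq_zero_of_tsupport_subset hs
  rw [intervalIntegral.integral_deriv_eq_sub
    (fun t _ => (contDiff_etaMod hη m).differentiable (by simp) t)
    ((continuous_deriv_etaMod hη m).intervalIntegrable _ _)]
  simp [etaMod, z1, z2]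

/-- Duhamel's formula implies the equation in the sense of distributions. -/
theorem Admissible.isSolution_of_duhamel {U : ℤ × ℝ → ℂ} {K : ℝ} (hK : 0 ≤ K)
    (hU : Admissible U K) {κ T K' : ℝ} (hT : 0 < T) {f : Distr} {u : ℝ → Distr} (hf : u 0 = f)
    (hu : ∀ t ∈ Icc (-T) T, ∀ n, coeff (u t) n = ift U t n)
    (hb : ∀ t ∈ Icc (-T) T, ∀ n : ℤ, ‖ift U t n‖ ≤ K' * (1 + (n : ℝ) ^ 2))
    (hduh : ∀ t ∈ Icc (-T) T, ∀ n : ℤ, Complex.exp (Complex.I * ((n : ℝ) ^ 2 : ℝ) * t) *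
      ift U t n = coeff f n - Complex.I * κ * duhTerm (nl U U) 0 t n) :
    IsSolution κ T f u := by
  refine ⟨hf, fun η θ hη hc hs => ?_⟩
  have h1 := (hU.tendsto_nonlinearity hK hT hu hη hc hs θ).const_mul (κ : ℂ)
  have h0 : (0 : ℝ) ∈ Icc (-T) T := ⟨by linarith, hT.le⟩
  have hK' : 0 ≤ K' := by simpa using (norm_nonneg _).trans (hb 0 h0 0)
  obtain ⟨C, hC0, hC⟩ := exists_norm_testCoeff_mul_pow_three_le θ
  obtain ⟨B, hB0, hB⟩ := exists_norm_deriv_etaMod_le hη hc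
  set v : ℤ → ℝ → ℂ := fun m t => Complex.exp (Complex.I * ((m : ℝ) ^ 2 : ℝ) * t) * ift U t m
    with hv
  have cv : ∀ m, Continuous (v m) := fun m =>
    (continuous_exp_osc m).mul (continuous_ift (hU.slice m))
  set F : ℤ → ℝ → ℂ := fun m t =>
    testCoeff m θ * (-Complex.I * (deriv (etaMod η m) t * v m t)) with hF
  have cF : ∀ m, Continuous (F m) := fun m =>
    continuous_const.mul (continuous_const.mul ((continuous_deriv_etaMod hη m).mul (cv m)))
  have hIoc : ∀ t ∈ Set.uIoc (-T) T, t ∈ Icc (-T) T := fun t ht => by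
    rw [uIoc_of_le (by linarith)] at ht
    exact Ioc_subset_Icc_self ht
  have h2 : HasSum (fun m => ∫ t in (-T)..T, F m t) (∫ t in (-T)..T,
      (-Complex.I * deriv η t * pair (u t) θ + η t * pair (u t) (laplacian θ))) := by
    refine intervalIntegral.hasSum_integral_of_dominated_convergence
      (fun m _ => C * B * K' * (1 + (m : ℝ) ^ 2)⁻¹) (fun m => (cF m).aestronglyMeasurable)
      (fun m => Eventually.of_forall fun t ht => ?_)
      (Eventually.of_forall fun t ht => summable_inv_one_add_sq.mul_left _)
      intervalIntegrable_const (Eventually.of_forall fun t ht => ?_)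
    · have hvb : ‖v m t‖ ≤ K' * (1 + (m : ℝ) ^ 2) := by
        simp only [hv]
        rw [norm_mul, norm_exp_I_mul_mul, one_mul]
        exact hb t (hIoc t ht) m
      rw [← div_eq_mul_inv, le_div_iff₀ (by positivity)]
      simp only [hF]
      rw [norm_mul, norm_mul, norm_mul, norm_neg, Complex.norm_I, one_mul]
      calc _ ≤ ‖testCoeff m θ‖ * ((B * (1 + (m : ℝ) ^ 2)) * (K' * (1 + (m : ℝ) ^ 2))) *
            (1 + (m : ℝ) ^ 2) := by gcongr; exact hB m t
        _ = (‖testCoeff m θ‖ * (1 + (m : ℝ) ^ 2) ^ 3) * (B * K') := by ring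
        _ ≤ C * (B * K') := by gcongr; exact hC m
        _ = _ := by ring
    -- In each mode the time derivative of η and the Laplacian of θ combine into the derivative of
    -- the modulated cutoff.
    · have p1 := (hasSum_pair (hu t (hIoc t ht)) (hb t (hIoc t ht)) θ).mul_left
        (-Complex.I * deriv η t)
      have p2 := (hasSum_pair (hu t (hIoc t ht)) (hb t (hIoc t ht)) (laplacian θ)).mul_left (η t)
      refine (p1.add p2).congr_fun fun m => ?_
      simp only [hF, hv]
      rw [testCoeff_laplacian, (hasDerivAt_etaMod hη m t).deriv]
      have := exp_free_mul m t
      linear_combination (-testCoeff m θ * Complex.I * (deriv η t -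
        Complex.I * (m : ℂ) ^ 2 * η t) * ift U t m) * this +
        ((m : ℂ) ^ 2 * η t * testCoeff m θ * ift U t m) * Complex.I_sq
  rw [← h2.tsum_eq]
  convert h1 using 2
  rw [← tsum_mul_left]
  refine tsum_congr fun m => ?_
  have ii : ∀ {g : ℝ → ℂ}, Continuous g → IntervalIntegrable g volume (-T) T :=
    fun hg => hg.intervalIntegrable _ _
  have e1 : ∫ t in (-T)..T, F m t = testCoeff m θ * (-Complex.I *
      ∫ t in (-T)..T, (deriv (etaMod η m) t * coeff f m -
        Complex.I * κ * (deriv (etaMod η m) t * duhTerm (nl U U) 0 t m))) := by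
    simp only [hF]
    rw [intervalIntegral.integral_const_mul, intervalIntegral.integral_const_mul]
    congr 2
    refine intervalIntegral.integral_congr fun t ht => ?_
    rw [uIcc_of_le (by linarith)] at ht
    simp only [hv]
    rw [hduh t ht m]
    ring
  have cd := continuous_deriv_etaMod hη m
  -- The datum is constant in time and multiplies a derivative with zero integral, so only the
  -- Duhamel integral remains.
  rw [e1, intervalIntegral.integral_sub
    (ii (g := fun t => deriv (etaMod η m) t * coeff f m) (cd.mul continuous_const))
    (ii (g := fun t => Complex.I * κ * (deriv (etaMod η m) t * duhTerm (nl U U) 0 t m))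
      (continuous_const.mul (cd.mul (hU.continuous_duhTerm m)))),
    intervalIntegral.integral_mul_const, integral_deriv_etaMod hη hs,
    intervalIntegral.integral_const_mul]
  linear_combination (testCoeff m θ * κ *
    ∫ t in (-T)..T, deriv (etaMod η m) t * duhTerm (nl U U) 0 t m) * Complex.I_sq


/-! ### Choice of exponents and estimates for the Duhamel map -/

/-- The constraints on the exponents under which the bilinear estimate holds. -/
structure Exponents (s b β : ℝ) : Prop where
  nonpos : s ≤ 0
  quarter_lt : 1 / 4 < β
  neg_le : -s ≤ β
  lt_half : β < 1 / 2
  half_lt : 1 / 2 < b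
  lt_one : b < 1
  add_lt : b + β < 1

theorem exists_exponents {s : ℝ} (h : -(1 / 2) < s) (h' : s ≤ 0) : ∃ b β, Exponents s b β := by
  -- With b = 1/2 + ε and β = 1/2 - 2ε one has b + β = 1 - ε. The bound ε ≤ 1/16 keeps β above 1/4,
  -- and 2ε ≤ s + 1/2 gives -s ≤ β.
  set ε := min (1 / 16) ((s + 1 / 2) / 2) with hε
  have h1 : ε ≤ 1 / 16 := min_le_left _ _
  have h2 : ε ≤ (s + 1 / 2) / 2 := min_le_right _ _
  have h3 : 0 < ε := lt_min (by norm_num) (by linarith)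
  exact ⟨1 / 2 + ε, 1 / 2 - 2 * ε, h', by linarith, by linarith, by linarith, by linarith,
    by linarith, by linarith⟩

/-- The square of the norm of `X^{s,b}` on the Fourier side. -/
def xNormSq (s b : ℝ) (G : ℤ × ℝ → ℂ) : ℝ≥0∞ := sqNorm s b fun x => ‖G x‖ₑ

theorem xNormSq_add_le {s b : ℝ} {G H : ℤ × ℝ → ℂ} (hG : Measurable G) (hH : Measurable H) :
    xNormSq s b (fun x => G x + H x) ≤ 2 * (xNormSq s b G + xNormSq s b H) :=
  (sqNorm_mono (ae_of_all _ fun x => enorm_add_le (G x) (H x))).trans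
    (sqNorm_add_le hG.enorm hH.enorm)

theorem xNormSq_sub_le {s b : ℝ} {G H : ℤ × ℝ → ℂ} (hG : Measurable G) (hH : Measurable H) :
    xNormSq s b (fun x => G x - H x) ≤ 2 * (xNormSq s b G + xNormSq s b H) :=
  (sqNorm_mono (ae_of_all _ fun _ => enorm_sub_le)).trans
    (sqNorm_add_le hG.enorm hH.enorm)

theorem Exponents.xNormSq_le {s b β : ℝ} (E : Exponents s b β) (G : ℤ × ℝ → ℂ) :
    xNormSq s b G ≤ xNormSq 0 b G := sqNorm_mono_left E.nonpos _

/-- Two products are allowed because a difference of squares has two terms. The domination is only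
almost everywhere since that difference can be expanded only where the convolutions converge. -/
theorem Exponents.bilinear {s b β : ℝ} (E : Exponents s b β) :
    ∃ C : ℝ≥0, ∀ (k : ℤ × ℝ → ℂ) (G₁ G₂ G₃ G₄ : ℤ × ℝ → ℂ), Measurable G₁ → Measurable G₂ →
      Measurable G₃ → Measurable G₄ →
      (∀ᵐ x ∂freqMeasure, ‖k x‖ₑ ≤ conv (fun y => ‖G₁ y‖ₑ) (fun y => ‖G₂ y‖ₑ) x +
        conv (fun y => ‖G₃ y‖ₑ) (fun y => ‖G₄ y‖ₑ) x) →
      xNormSq 0 (-β) k ≤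
        C * (xNormSq s b G₁ * xNormSq s b G₂ + xNormSq s b G₃ * xNormSq s b G₄) := by
  obtain ⟨C, hC⟩ := sqNorm_conv_le E.nonpos E.quarter_lt E.neg_le E.lt_half.le E.half_lt
  refine ⟨2 * C, fun k G₁ G₂ G₃ G₄ h₁ h₂ h₃ h₄ hk => ?_⟩
  calc xNormSq 0 (-β) k ≤ 2 * (sqNorm 0 (-β) (conv (fun y => ‖G₁ y‖ₑ) (fun y => ‖G₂ y‖ₑ)) +
        sqNorm 0 (-β) (conv (fun y => ‖G₃ y‖ₑ) (fun y => ‖G₄ y‖ₑ))) :=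
        (sqNorm_mono hk).trans (sqNorm_add_le (measurable_conv h₁.enorm h₂.enorm)
          (measurable_conv h₃.enorm h₄.enorm))
    _ ≤ 2 * (C * (xNormSq s b G₁ * xNormSq s b G₂) + C * (xNormSq s b G₃ * xNormSq s b G₄)) := by
        gcongr
        · exact hC _ _ h₁.enorm h₂.enorm
        · exact hC _ _ h₃.enorm h₄.enorm
    _ = _ := by push_cast; ring

theorem Exponents.conv_lt_top {s b β : ℝ} (E : Exponents s b β) {G₁ G₂ : ℤ × ℝ → ℂ}
    (h₁ : Measurable G₁) (h₂ : Measurable G₂) (f₁ : xNormSq s b G₁ < ⊤) (f₂ : xNormSq s b G₂ < ⊤) :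
    sqNorm 0 (-β) (conv (fun y => ‖G₁ y‖ₑ) (fun y => ‖G₂ y‖ₑ)) < ⊤ := by
  obtain ⟨C, hC⟩ := sqNorm_conv_le E.nonpos E.quarter_lt E.neg_le E.lt_half.le E.half_lt
  exact (hC _ _ h₁.enorm h₂.enorm).trans_lt
    (ENNReal.mul_lt_top ENNReal.coe_lt_top (ENNReal.mul_lt_top f₁ f₂))

theorem Exponents.nl_lt_top {s b β : ℝ} (E : Exponents s b β) {G₁ G₂ : ℤ × ℝ → ℂ}
    (h₁ : Measurable G₁) (h₂ : Measurable G₂) (f₁ : xNormSq s b G₁ < ⊤) (f₂ : xNormSq s b G₂ < ⊤) :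
    xNormSq 0 (-β) (nl G₁ G₂) < ⊤ :=
  (sqNorm_mono (ae_of_all _ fun x => enorm_nl_le G₁ G₂ x)).trans_lt (E.conv_lt_top h₁ h₂ f₁ f₂)

theorem Exponents.lintegral_conv_lt_top {s b β : ℝ} (E : Exponents s b β) {G₁ G₂ : ℤ × ℝ → ℂ}
    (h₁ : Measurable G₁) (h₂ : Measurable G₂) (f₁ : xNormSq s b G₁ < ⊤) (f₂ : xNormSq s b G₂ < ⊤)
    (n : ℤ) : ∫⁻ τ : ℝ, wt (-1) (τ + (n : ℝ) ^ 2) *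
      conv (fun y => ‖G₁ y‖ₑ) (fun y => ‖G₂ y‖ₑ) (n, τ) < ⊤ :=
  lintegral_wt_neg_one_lt_top E.lt_half (measurable_conv h₁.enorm h₂.enorm)
    (E.conv_lt_top h₁ h₂ f₁ f₂) n

theorem Exponents.integrable {s b β : ℝ} (E : Exponents s b β) {U : ℤ × ℝ → ℂ}
    (hU : Measurable U) (fU : xNormSq s b U < ⊤) (n : ℤ) : Integrable fun τ => U (n, τ) :=
  integrable_slice E.half_lt hU fU n

theorem Exponents.admissible {s b β : ℝ} (E : Exponents s b β) {U : ℤ × ℝ → ℂ}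
    (hU : Measurable U) (fU : xNormSq s b U < ⊤) : ∃ K, 0 ≤ K ∧ Admissible U K := by
  obtain ⟨C, hC⟩ := sq_lintegral_wt_neg_one_le E.lt_half
  have hfin := E.conv_lt_top hU hU fU fU
  -- The estimate bounds the square of the slice integral a; since a ≤ 1 or a ≤ a², adding 1 avoids
  -- a square root.
  set X := 1 + C * sqNorm 0 (-β) (conv (fun y => ‖U y‖ₑ) (fun y => ‖U y‖ₑ)) with hX
  have hX' : X ≠ ⊤ := (ENNReal.add_lt_top.2 ⟨ENNReal.one_lt_top,
    ENNReal.mul_lt_top ENNReal.coe_lt_top hfin⟩).ne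
  refine ⟨X.toReal, ENNReal.toReal_nonneg, hU, fun m => E.integrable hU fU m, fun n => ?_⟩
  rw [ENNReal.ofReal_toReal hX']
  have h := hC _ (measurable_conv hU.enorm hU.enorm) n
  refine le_trans ?_ (add_le_add_right h 1)
  generalize (∫⁻ τ : ℝ, wt (-1) (τ + (n : ℝ) ^ 2) *
    conv (fun y => ‖U y‖ₑ) (fun y => ‖U y‖ₑ) (n, τ)) = a
  rcases le_total a 1 with h1 | h1
  · exact h1.trans le_self_add
  · refine le_trans ?_ le_add_self
    rw [sq]
    exact le_mul_of_one_le_left' h1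

/-- The gain of a power of the length of the interval. -/
def gain (b β δ : ℝ) : ℝ≥0∞ := ENNReal.ofReal (δ ^ (2 * (1 - b - β)))

/-- The exponent 2(1 - b - β) is positive, so short times make any finite constant small. -/
theorem Exponents.exists_gain_le {s b β : ℝ} (E : Exponents s b β) {X : ℝ≥0∞} (hX : X ≠ ⊤)
    {ε : ℝ≥0∞} (hε : 0 < ε) : ∃ δ : ℝ, 0 < δ ∧ δ ≤ 1 ∧
      ∀ δ', 0 < δ' → δ' ≤ δ → gain b β δ' * X ≤ ε := by
  have hp : 0 < 2 * (1 - b - β) := by linarith [E.add_lt]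
  have h1 : Tendsto (fun δ : ℝ => gain b β δ * X) (𝓝 0) (𝓝 0) := by
    have h2 : Tendsto (fun δ : ℝ => δ ^ (2 * (1 - b - β))) (𝓝 0) (𝓝 0) := by
      have := (Real.continuousAt_rpow_const 0 _ (Or.inr hp.le)).tendsto
      rwa [Real.zero_rpow hp.ne'] at this
    have h3 := ENNReal.Tendsto.mul_const (ENNReal.tendsto_ofReal h2) (b := X) (Or.inr hX)
    rwa [ENNReal.ofReal_zero, zero_mul] at h3
  obtain ⟨r, hr, hr'⟩ := Metric.eventually_nhds_iff.1 (h1.eventually (ge_mem_nhds hε))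
  refine ⟨min (r / 2) 1, by positivity, min_le_right _ _, fun δ' h h' => hr' ?_⟩
  rw [Real.dist_eq, sub_zero, abs_of_pos h]
  linarith [h'.trans (min_le_left _ _)]

/-- The nonlinear part of Duhamel's formula. -/
def duhNl (κ δ t₀ : ℝ) (U : ℤ × ℝ → ℂ) : ℤ × ℝ → ℂ :=
  duhOp δ t₀ fun x => -Complex.I * κ * nl U U x

theorem measurable_duhNl (κ δ t₀ : ℝ) {U : ℤ × ℝ → ℂ} (hU : Measurable U) :
    Measurable (duhNl κ δ t₀ U) :=
  measurable_duhOp δ t₀ ((measurable_nl hU hU).const_mul _)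

theorem enorm_neg_I_mul {κ : ℝ} (hκ : κ = 1 ∨ κ = -1) (z : ℂ) :
    ‖-Complex.I * κ * z‖ₑ = ‖z‖ₑ := by
  rw [← ofReal_norm, ← ofReal_norm, norm_mul, norm_mul, norm_neg, Complex.norm_I, Complex.norm_real]
  rcases hκ with rfl | rfl <;> simp

theorem Exponents.mul_nl_lt_top {s b β : ℝ} (E : Exponents s b β) {κ : ℝ} (hκ : κ = 1 ∨ κ = -1)
    {G₁ G₂ : ℤ × ℝ → ℂ} (h₁ : Measurable G₁) (h₂ : Measurable G₂) (f₁ : xNormSq s b G₁ < ⊤)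
    (f₂ : xNormSq s b G₂ < ⊤) : xNormSq 0 (-β) (fun x => -Complex.I * κ * nl G₁ G₂ x) < ⊤ := by
  have := E.nl_lt_top h₁ h₂ f₁ f₂
  unfold xNormSq at this ⊢
  simpa only [enorm_neg_I_mul hκ] using this

/-- The linear Duhamel operator applied to a bilinear expression. -/
theorem Exponents.xNormSq_duhOp_le {s b β : ℝ} (E : Exponents s b β) :
    ∃ C : ℝ≥0, ∀ (δ t₀ : ℝ), 0 < δ → δ ≤ 1 → ∀ (k : ℤ × ℝ → ℂ) (G₁ G₂ G₃ G₄ : ℤ × ℝ → ℂ),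
      Measurable k → Measurable G₁ → Measurable G₂ → Measurable G₃ → Measurable G₄ →
      (∀ᵐ x ∂freqMeasure, ‖k x‖ₑ ≤ conv (fun y => ‖G₁ y‖ₑ) (fun y => ‖G₂ y‖ₑ) x +
        conv (fun y => ‖G₃ y‖ₑ) (fun y => ‖G₄ y‖ₑ) x) →
      xNormSq 0 b (duhOp δ t₀ k) ≤ gain b β δ * (C * (xNormSq s b G₁ * xNormSq s b G₂ +
        xNormSq s b G₃ * xNormSq s b G₄)) := by
  obtain ⟨C₁, h₁⟩ := E.bilinear
  obtain ⟨C₂, h₂⟩ := sqNorm_duhOp_le (by linarith [E.half_lt] : 0 ≤ b) E.lt_one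
    (by linarith [E.quarter_lt] : 0 ≤ β) E.lt_half E.add_lt.le
  refine ⟨C₂ * C₁, fun δ t₀ hδ hδ' k G₁ G₂ G₃ G₄ mk m₁ m₂ m₃ m₄ hk => ?_⟩
  refine (h₂ δ t₀ hδ hδ' k mk).trans ?_
  refine (mul_le_mul_right (h₁ k G₁ G₂ G₃ G₄ m₁ m₂ m₃ m₄ hk) _).trans (le_of_eq ?_)
  unfold gain
  push_cast
  ring

/-- Linearity of the Duhamel operator reduces the difference to one bilinear forcing. The bilinear
estimate supplies the almost everywhere finiteness needed to split it. -/
theorem Exponents.xNormSq_duhNl_sub_le {s b β : ℝ} (E : Exponents s b β) {κ : ℝ}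
    (hκ : κ = 1 ∨ κ = -1) :
    ∃ C : ℝ≥0, ∀ (δ t₀ : ℝ), 0 < δ → δ ≤ 1 → ∀ U W : ℤ × ℝ → ℂ, Measurable U → Measurable W →
      xNormSq s b U < ⊤ → xNormSq s b W < ⊤ →
      xNormSq 0 b (fun x => duhNl κ δ t₀ U x - duhNl κ δ t₀ W x) ≤ gain b β δ *
        (C * ((xNormSq s b U + xNormSq s b W) * xNormSq s b fun x => U x - W x)) := by
  obtain ⟨C, hC⟩ := E.xNormSq_duhOp_le
  refine ⟨C, fun δ t₀ hδ hδ' U W hU hW fU fW => ?_⟩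
  have mU := (measurable_nl hU hU).const_mul (-Complex.I * κ)
  have mW := (measurable_nl hW hW).const_mul (-Complex.I * κ)
  have e : (fun x => duhNl κ δ t₀ U x - duhNl κ δ t₀ W x) =
      duhOp δ t₀ (fun y => -Complex.I * κ * nl U U y - -Complex.I * κ * nl W W y) :=
    funext fun x => duhOp_sub E.lt_half hδ hδ' t₀ mU (E.mul_nl_lt_top hκ hU hU fU fU)
      mW (E.mul_nl_lt_top hκ hW hW fW fW) x
  rw [e]
  refine (hC δ t₀ hδ hδ' _ (fun x => U x - W x) U W (fun x => U x - W x) (mU.sub mW)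
    (hU.sub hW) hU hW (hU.sub hW) ?_).trans (le_of_eq ?_)
  · filter_upwards [ae_lt_top_of_sqNorm (measurable_conv hU.enorm hU.enorm)
      (E.conv_lt_top hU hU fU fU), ae_lt_top_of_sqNorm (measurable_conv hW.enorm hW.enorm)
      (E.conv_lt_top hW hW fW fW)] with x hx hx'
    rw [Pi.sub_apply, ← mul_sub, enorm_neg_I_mul hκ]
    exact enorm_nl_sub_le hU hW hx hx'
  · ring

theorem duhNl_zero (κ δ t₀ : ℝ) : duhNl κ δ t₀ (fun _ => 0) = fun _ => 0 := by
  funext x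
  simp [duhNl, duhOp, nl]

theorem xNormSq_zero (s b : ℝ) : xNormSq s b (fun _ => 0) = 0 := by
  simp [xNormSq, sqNorm]

theorem ift_sub {G H : ℤ × ℝ → ℂ} {n : ℤ} (hG : Integrable fun τ => G (n, τ))
    (hH : Integrable fun τ => H (n, τ)) (t : ℝ) :
    ift (fun x => G x - H x) t n = ift G t n - ift H t n := by
  have hi : ∀ {g : ℝ → ℂ}, Integrable g → Integrable fun τ : ℝ =>
      Complex.exp (Complex.I * τ * t) * g τ := fun {g} hg =>
    hg.bdd_mul (c := 1) (by fun_prop) (ae_of_all _ fun τ => (norm_exp_I_mul_mul τ t).le)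
  unfold ift
  rw [← mul_sub, ← integral_sub (hi hG) (hi hH)]
  simp_rw [mul_sub]

theorem ift_add {G H : ℤ × ℝ → ℂ} {n : ℤ} (hG : Integrable fun τ => G (n, τ))
    (hH : Integrable fun τ => H (n, τ)) (t : ℝ) :
    ift (fun x => G x + H x) t n = ift G t n + ift H t n := by
  have h := ift_sub (G := fun x => G x + H x) (H := H) (n := n) (hG.add hH) hH t
  simp only [add_sub_cancel_right] at h
  rw [h]; ring

theorem ift_eq_zero {b : ℝ} (hb : 1 / 2 < b) {G : ℤ × ℝ → ℂ} (hG : Measurable G) {s : ℝ}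
    (h : xNormSq s b G = 0) (t : ℝ) (n : ℤ) : ift G t n = 0 := by
  obtain ⟨C, hC⟩ := tsum_enorm_ift_sq_le hb
  have h1 := hC s G t hG
  change _ ≤ C * xNormSq s b G at h1
  rw [h, mul_zero, nonpos_iff_eq_zero, ENNReal.tsum_eq_zero] at h1
  simpa [wt_ne_zero] using h1 n

/-- Since s > -1/2, a bound in H^s implies one in H^{-1}, hence polynomial growth of the
coefficients uniformly in time. Distributions can then be rebuilt from them. -/
theorem Exponents.exists_norm_ift_le {s b β : ℝ} (E : Exponents s b β) {U : ℤ × ℝ → ℂ}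
    (hU : Measurable U) (fU : xNormSq s b U < ⊤) :
    ∃ K : ℝ, ∀ (t : ℝ) (n : ℤ), ‖ift U t n‖ ≤ K * (1 + (n : ℝ) ^ 2) := by
  obtain ⟨C, hC⟩ := tsum_enorm_ift_sq_le E.half_lt
  have hfin : C * xNormSq s b U ≠ ⊤ := (ENNReal.mul_lt_top ENNReal.coe_lt_top fU).ne
  refine ⟨1 + (C * xNormSq s b U).toReal, fun t n => ?_⟩
  have h1 : wt (2 * s) n * ‖ift U t n‖ₑ ^ 2 ≤ C * xNormSq s b U :=
    (ENNReal.le_tsum n).trans (hC s U t hU)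
  have h2 : wt (-2) n * ‖ift U t n‖ₑ ^ 2 ≤ C * xNormSq s b U := by
    refine le_trans (mul_le_mul_left (wt_mono ?_ _) _) h1
    linarith [E.neg_le, E.lt_half]
  rw [wt_neg_two, ← ofReal_norm, ← ENNReal.ofReal_pow (norm_nonneg _),
    ← ENNReal.ofReal_mul (by positivity), ENNReal.ofReal_le_iff_le_toReal hfin, one_div,
    inv_mul_le_iff₀ (by positivity)] at h2
  set Y := (C * xNormSq s b U).toReal
  have hY : 0 ≤ Y := ENNReal.toReal_nonneg
  refine abs_le_of_sq_le_sq' ?_ (by positivity) |>.2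
  nlinarith [sq_nonneg (n : ℝ), mul_nonneg hY (sq_nonneg (n : ℝ)), mul_nonneg hY hY,
    mul_nonneg (mul_nonneg hY hY) (sq_nonneg (n : ℝ)), pow_two_nonneg ((n : ℝ) ^ 2),
    mul_nonneg (mul_nonneg hY hY) (sq_nonneg ((n : ℝ) ^ 2)),
    mul_nonneg hY (sq_nonneg ((n : ℝ) ^ 2))]

/-- A space-time function which agrees with the free evolution on `[-1,1]`, on the Fourier side. -/
def freeExt (c : ℤ → ℂ) (x : ℤ × ℝ) : ℂ := 2 * Real.pi * c x.1 * cutP (modn x)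

theorem measurable_freeExt (c : ℤ → ℂ) : Measurable (freeExt c) := by
  unfold freeExt
  have h1 : Measurable fun x : ℤ × ℝ => c x.1 := (measurable_from_top).comp measurable_fst
  exact (h1.const_mul _).mul (continuous_cutP.measurable.comp measurable_modn)

theorem freeExt_sub (c d : ℤ → ℂ) (x : ℤ × ℝ) :
    freeExt c x - freeExt d x = freeExt (fun n => c n - d n) x := by
  unfold freeExt; ring

theorem ift_freeExt (c : ℤ → ℂ) {t : ℝ} (ht : |t| ≤ 1) (n : ℤ) :
    ift (freeExt c) t n = Complex.exp (-Complex.I * (n : ℂ) ^ 2 * t) * c n := by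
  have hpi : (Real.pi : ℂ) ≠ 0 := by exact_mod_cast Real.pi_ne_zero
  have h1 : ∫ τ : ℝ, Complex.exp (Complex.I * τ * t) * freeExt c (n, τ) =
      (2 * Real.pi * c n * Complex.exp (-Complex.I * (n : ℂ) ^ 2 * t)) *
        ∫ τ : ℝ, Complex.exp (Complex.I * ((τ + (n : ℝ) ^ 2 : ℝ) : ℂ) * t) *
          cutP (τ + (n : ℝ) ^ 2) := by
    rw [← integral_const_mul]
    refine integral_congr_ae (ae_of_all _ fun τ => ?_)
    have e : Complex.exp (Complex.I * τ * t) = Complex.exp (-Complex.I * (n : ℂ) ^ 2 * t) *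
        Complex.exp (Complex.I * ((τ + (n : ℝ) ^ 2 : ℝ) : ℂ) * t) := by
      rw [← Complex.exp_add]
      congr 1
      push_cast
      ring
    simp only [freeExt, modn]
    rw [e]
    ring
  rw [ift, h1, integral_add_right_eq_self
    (fun σ : ℝ => Complex.exp (Complex.I * (σ : ℂ) * t) * cutP σ), integral_exp_mul_cutP ht]
  field_simp

theorem hsNorm_sq (s : ℝ) (g : Distr) :
    hsNorm s g ^ 2 = ∑' n : ℤ, wt (2 * s) n * ‖coeff g n‖ₑ ^ 2 := by
  rw [hsNorm, ← ENNReal.rpow_natCast, ← ENNReal.rpow_mul]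
  norm_num [wt]

/-- The datum and the modulation separate: the transform of the cutoff decays like ⟨σ⟩^{-2}, so
⟨σ⟩^{2b-4} is integrable for b < 1 and the sum over n is the H^s norm. -/
theorem exists_xNormSq_freeExt_le {b : ℝ} (hb : b < 1) : ∃ C : ℝ≥0, ∀ (s : ℝ) (g : Distr),
    xNormSq s b (freeExt (coeff g)) ≤ C * hsNorm s g ^ 2 := by
  obtain ⟨C₀, hC₀⟩ := enorm_cutP_le
  have hint := lintegral_wt_lt_top (p := 4 - 2 * b) (by linarith)
  set D := ∫⁻ x : ℝ, wt (-(4 - 2 * b)) x with hD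
  set P : ℝ≥0∞ := ‖(2 * Real.pi : ℂ)‖ₑ with hP
  have hfin : P ^ 2 * ((C₀ : ℝ≥0∞) ^ 2 * D) ≠ ⊤ :=
    ENNReal.mul_ne_top (ENNReal.pow_ne_top enorm_ne_top)
      (ENNReal.mul_ne_top (ENNReal.pow_ne_top ENNReal.coe_ne_top) hint.ne)
  refine ⟨(P ^ 2 * ((C₀ : ℝ≥0∞) ^ 2 * D)).toNNReal, fun s g => ?_⟩
  rw [ENNReal.coe_toNNReal hfin, xNormSq, sqNorm_eq_tsum (measurable_freeExt _).enorm,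
    hsNorm_sq, ← ENNReal.tsum_mul_left]
  refine ENNReal.tsum_le_tsum fun n => ?_
  have h1 : ∫⁻ τ : ℝ, wt (2 * b) (τ + (n : ℝ) ^ 2) * ‖freeExt (coeff g) (n, τ)‖ₑ ^ 2 ≤
      ∫⁻ τ : ℝ, (P ^ 2 * ‖coeff g n‖ₑ ^ 2 * (C₀ : ℝ≥0∞) ^ 2) *
        wt (-(4 - 2 * b)) (τ + (n : ℝ) ^ 2) := by
    refine lintegral_mono fun τ => ?_
    simp only [freeExt, modn]
    rw [enorm_mul, enorm_mul]
    calc _ ≤ wt (2 * b) (τ + (n : ℝ) ^ 2) *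
          (P * ‖coeff g n‖ₑ * (C₀ * wt (-2) (τ + (n : ℝ) ^ 2))) ^ 2 := by
          gcongr; exact hC₀ _
      _ = (P ^ 2 * ‖coeff g n‖ₑ ^ 2 * (C₀ : ℝ≥0∞) ^ 2) *
          (wt (2 * b) (τ + (n : ℝ) ^ 2) * wt (-2) (τ + (n : ℝ) ^ 2) ^ 2) := by ring
      _ = _ := by
          rw [wt_sq, wt_mul]
          congr 2
          ring
  calc _ ≤ wt (2 * s) n * ((P ^ 2 * ‖coeff g n‖ₑ ^ 2 * (C₀ : ℝ≥0∞) ^ 2) * D) := by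
        gcongr
        refine h1.trans (le_of_eq ?_)
        rw [lintegral_const_mul _ (measurable_wt_comp _ (by fun_prop)),
          lintegral_add_right_eq_self (fun x : ℝ => wt (-(4 - 2 * b)) x)]
    _ = _ := by ring


/-! ### The fixed point theorem and mild solutions -/

theorem sq_eLpNorm_two {α : Type*} [MeasurableSpace α] (μ : Measure α) (f : α → ℂ) :
    eLpNorm f 2 μ ^ 2 = ∫⁻ x, ‖f x‖ₑ ^ 2 ∂μ := by
  have h := eLpNorm_nnreal_pow_eq_lintegral (μ := μ) (f := f) (p := 2) two_ne_zero
  simpa using h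

/-- Banach's fixed point theorem in the unit ball of `L²`, for maps on representatives. -/
theorem exists_fixedPoint_lintegral {α : Type*} [MeasurableSpace α] (μ : Measure α)
    {Ψ : (α → ℂ) → α → ℂ} (hm : ∀ G, Measurable G → Measurable (Ψ G))
    (hball : ∀ G, Measurable G → ∫⁻ x, ‖G x‖ₑ ^ 2 ∂μ ≤ 1 → ∫⁻ x, ‖Ψ G x‖ₑ ^ 2 ∂μ ≤ 1)
    (hc : ∀ G H, Measurable G → Measurable H → ∫⁻ x, ‖G x‖ₑ ^ 2 ∂μ ≤ 1 →
      ∫⁻ x, ‖H x‖ₑ ^ 2 ∂μ ≤ 1 →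
      ∫⁻ x, ‖Ψ G x - Ψ H x‖ₑ ^ 2 ∂μ ≤ (1 / 2) ^ 2 * ∫⁻ x, ‖G x - H x‖ₑ ^ 2 ∂μ) :
    ∃ G, Measurable G ∧ ∫⁻ x, ‖G x‖ₑ ^ 2 ∂μ ≤ 1 ∧ ∫⁻ x, ‖G x - Ψ G x‖ₑ ^ 2 ∂μ = 0 := by
  classical
  have rep : ∀ g : Lp ℂ 2 μ, Measurable g := fun g => (Lp.stronglyMeasurable g).measurable
  have e1 : ∀ f : α → ℂ, ∫⁻ x, ‖f x‖ₑ ^ 2 ∂μ ≤ 1 ↔ eLpNorm f 2 μ ≤ 1 := fun f => by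
    have h := ENNReal.pow_le_pow_left_iff (a := eLpNorm f 2 μ) (b := 1) two_ne_zero
    rwa [one_pow, sq_eLpNorm_two] at h
  have mem : ∀ {f : α → ℂ}, Measurable f → ∫⁻ x, ‖f x‖ₑ ^ 2 ∂μ ≤ 1 → MemLp f 2 μ :=
    fun hf h => ⟨hf.aestronglyMeasurable, ((e1 _).1 h).trans_lt ENNReal.one_lt_top⟩
  -- The map acts on the representative attached to each class. The default value 0 is never taken
  -- on the unit ball, by `memF`.
  let F : Lp ℂ 2 μ → Lp ℂ 2 μ := fun g =>
    if h : MemLp (Ψ g) 2 μ then h.toLp (Ψ g) else 0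
  set S : Set (Lp ℂ 2 μ) := Metric.closedEBall 0 1 with hS
  have memS : ∀ g : Lp ℂ 2 μ, g ∈ S ↔ ∫⁻ x, ‖g x‖ₑ ^ 2 ∂μ ≤ 1 := fun g => by
    rw [e1, hS, Metric.mem_closedEBall, edist_zero_right, Lp.enorm_def]
  have memF : ∀ g ∈ S, MemLp (Ψ g) 2 μ := fun g hg =>
    mem (hm _ (rep g)) (hball _ (rep g) ((memS g).1 hg))
  have Feq : ∀ g (hg : g ∈ S), F g = (memF g hg).toLp (Ψ g) := fun g hg => dif_pos (memF g hg)
  have maps : MapsTo F S S := fun g hg => by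
    rw [hS, Metric.mem_closedEBall, edist_zero_right, Feq g hg, Lp.enorm_toLp, ← e1]
    exact hball _ (rep g) ((memS g).1 hg)
  have contr : ContractingWith (1 / 2) (maps.restrict F S S) := by
    refine ⟨by norm_num, fun x y => ?_⟩
    obtain ⟨x, hx⟩ := x
    obtain ⟨y, hy⟩ := y
    change edist (F x) (F y) ≤ _ * edist x y
    rw [Feq x hx, Feq y hy, Lp.edist_toLp_toLp, Lp.edist_def]
    have h := hc x y (rep x) (rep y) ((memS x).1 hx) ((memS y).1 hy)
    rw [← ENNReal.pow_le_pow_left_iff two_ne_zero, mul_pow, sq_eLpNorm_two, sq_eLpNorm_two]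
    refine le_trans h (le_of_eq ?_)
    congr 2
    simp
  obtain ⟨g, hgS, hfix, -⟩ := ContractingWith.exists_fixedPoint' (s := S)
    Metric.isClosed_closedEBall.isComplete maps contr (x := 0)
    (by rw [hS, Metric.mem_closedEBall, edist_self]; exact zero_le_one)
    (edist_ne_top _ _)
  refine ⟨g, rep g, (memS g).1 hgS, ?_⟩
  have h1 : (g : α → ℂ) =ᵐ[μ] Ψ g := by
    have h2 : (memF g hgS).toLp (Ψ g) = g := (Feq g hgS).symm.trans hfix
    conv_lhs => rw [← h2]
    exact (memF g hgS).coeFn_toLp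
  rw [lintegral_congr_ae (g := fun _ => 0) (h1.mono fun x hx => by simp only; rw [hx]; simp)]
  simp

/-- On the Fourier side X^{0,b} is an L² space with a density, so its completeness is that of L². -/
theorem xNormSq_eq_lintegral (b : ℝ) (G : ℤ × ℝ → ℂ) : xNormSq 0 b G =
    ∫⁻ x, ‖G x‖ₑ ^ 2 ∂(freqMeasure.withDensity fun x => wt (2 * b) (modn x)) := by
  have hw : Measurable fun x => wt (2 * b) (modn x) := measurable_wt_comp _ measurable_modn
  rw [lintegral_withDensity_eq_lintegral_mul_non_measurable _ hw
    (ae_of_all _ fun x => (wt_ne_top _ _).lt_top)]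
  simp [xNormSq, sqNorm, wt_zero]

/-- Banach's fixed point theorem in the unit ball of `X^{0,b}`. -/
theorem exists_fixedPoint_xNormSq (b : ℝ) {Ψ : (ℤ × ℝ → ℂ) → ℤ × ℝ → ℂ}
    (hm : ∀ G, Measurable G → Measurable (Ψ G))
    (hball : ∀ G, Measurable G → xNormSq 0 b G ≤ 1 → xNormSq 0 b (Ψ G) ≤ 1)
    (hc : ∀ G H, Measurable G → Measurable H → xNormSq 0 b G ≤ 1 → xNormSq 0 b H ≤ 1 →
      xNormSq 0 b (fun x => Ψ G x - Ψ H x) ≤ (1 / 2) ^ 2 * xNormSq 0 b (fun x => G x - H x)) :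
    ∃ G, Measurable G ∧ xNormSq 0 b G ≤ 1 ∧ xNormSq 0 b (fun x => G x - Ψ G x) = 0 := by
  simp only [xNormSq_eq_lintegral] at hball hc ⊢
  exact exists_fixedPoint_lintegral _ hm hball hc

/-- Duhamel's formula for the spatial Fourier coefficients on `[-T,T]`. -/
def IsMild (κ T : ℝ) (c : ℤ → ℂ) (U : ℤ × ℝ → ℂ) : Prop :=
  ∀ t ∈ Icc (-T) T, ∀ n : ℤ, Complex.exp (Complex.I * ((n : ℝ) ^ 2 : ℝ) * t) * ift U t n =
    c n - Complex.I * κ * duhTerm (nl U U) 0 t n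

theorem continuous_exp_mul_quad {U W : ℤ × ℝ → ℂ} (hU : ∀ m : ℤ, Integrable fun τ => U (m, τ))
    (hW : ∀ m : ℤ, Integrable fun τ => W (m, τ)) (N : ℕ) (n : ℤ) :
    Continuous fun s : ℝ => Complex.exp (Complex.I * ((n : ℝ) ^ 2 : ℝ) * s) *
      quad N (ift U s) (ift W s) n :=
  (continuous_exp_osc n).mul (continuous_quad_ift hU hW N n)

theorem quad_sub_quad (N : ℕ) (u w z : ℤ → ℂ) (h : ∀ m, z m = u m - w m) (n : ℤ) :
    quad N z u n + quad N w z n = quad N u u n - quad N w w n := by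
  unfold quad
  rw [← Finset.sum_add_distrib, ← Finset.sum_sub_distrib]
  refine Finset.sum_congr rfl fun m _ => ?_
  rw [h, h, map_sub, map_sub]
  ring

/-- The difference of the integral terms depends only on the values of the difference on the
interval of integration. -/
theorem Exponents.duhTerm_nl_sub {s b β : ℝ} (E : Exponents s b β) {U W Z : ℤ × ℝ → ℂ}
    (hU : Measurable U) (hW : Measurable W) (hZ : Measurable Z) (fU : xNormSq s b U < ⊤)
    (fW : xNormSq s b W < ⊤) (fZ : xNormSq s b Z < ⊤) {t₀ t : ℝ}
    (h : ∀ r ∈ Set.uIcc t₀ t, ∀ n, ift Z r n = ift U r n - ift W r n) (n : ℤ) :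
    duhTerm (nl Z U) t₀ t n + duhTerm (nl W Z) t₀ t n =
      duhTerm (nl U U) t₀ t n - duhTerm (nl W W) t₀ t n := by
  have iU := E.integrable hU fU
  have iW := E.integrable hW fW
  have iZ := E.integrable hZ fZ
  have lim : ∀ {G H : ℤ × ℝ → ℂ}, Measurable G → Measurable H → xNormSq s b G < ⊤ →
      xNormSq s b H < ⊤ → _ := fun {G H} hG hH fG fH =>
    (tendsto_integral_quad hG hH (E.integrable hG fG) (E.integrable hH fH) n t₀ t
      (E.lintegral_conv_lt_top hG hH fG fH n)).1
  -- The nonlinearity in Fourier variables sees the whole extensions. Its truncated primitives use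
  -- only values on the interval of integration, where the difference of squares splits, and the
  -- limit transfers this locality.
  refine tendsto_nhds_unique ((lim hZ hU fZ fU).add (lim hW hZ fW fZ)) ?_
  refine ((lim hU hU fU fU).sub (lim hW hW fW fW)).congr fun N => ?_
  have ii : ∀ {G H : ℤ × ℝ → ℂ}, (∀ m : ℤ, Integrable fun τ => G (m, τ)) →
      (∀ m : ℤ, Integrable fun τ => H (m, τ)) → IntervalIntegrable (fun r : ℝ =>
        Complex.exp (Complex.I * ((n : ℝ) ^ 2 : ℝ) * r) * quad N (ift G r) (ift H r) n)
        volume t₀ t := fun hG hH => (continuous_exp_mul_quad hG hH N n).intervalIntegrable _ _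
  rw [← intervalIntegral.integral_sub (ii iU iU) (ii iW iW),
    ← intervalIntegral.integral_add (ii iZ iU) (ii iW iZ)]
  refine intervalIntegral.integral_congr fun r hr => ?_
  have := quad_sub_quad N (ift U r) (ift W r) (ift Z r) (h r hr) n
  linear_combination (-Complex.exp (Complex.I * ((n : ℝ) ^ 2 : ℝ) * r)) * this

theorem duhTerm_const_mul (a : ℂ) (k : ℤ × ℝ → ℂ) (t₀ t : ℝ) (n : ℤ) :
    duhTerm (fun x => a * k x) t₀ t n = a * duhTerm k t₀ t n := by
  unfold duhTerm
  simp_rw [mul_assoc]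
  rw [integral_const_mul]
  ring

theorem Exponents.lintegral_nl_lt_top {s b β : ℝ} (E : Exponents s b β) {G₁ G₂ : ℤ × ℝ → ℂ}
    (h₁ : Measurable G₁) (h₂ : Measurable G₂) (f₁ : xNormSq s b G₁ < ⊤) (f₂ : xNormSq s b G₂ < ⊤)
    (n : ℤ) : ∫⁻ τ : ℝ, wt (-1) (τ + (n : ℝ) ^ 2) * ‖nl G₁ G₂ (n, τ)‖ₑ < ⊤ :=
  lintegral_wt_neg_one_lt_top E.lt_half (measurable_nl h₁ h₂).enorm (E.nl_lt_top h₁ h₂ f₁ f₂) n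

/-- Additivity of the Duhamel integral over adjacent intervals allows a restart at t₀. -/
theorem Exponents.isMild_sub {s b β : ℝ} (E : Exponents s b β) {κ T : ℝ} {c : ℤ → ℂ}
    {U : ℤ × ℝ → ℂ} (hU : Measurable U) (fU : xNormSq s b U < ⊤) (h : IsMild κ T c U) {t₀ t : ℝ}
    (h₀ : t₀ ∈ Icc (-T) T) (ht : t ∈ Icc (-T) T) (n : ℤ) :
    Complex.exp (Complex.I * ((n : ℝ) ^ 2 : ℝ) * t) * ift U t n =
      Complex.exp (Complex.I * ((n : ℝ) ^ 2 : ℝ) * t₀) * ift U t₀ n -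
        Complex.I * κ * duhTerm (nl U U) t₀ t n := by
  rw [h t ht n, h t₀ h₀ n, ← duhTerm_add (measurable_nl hU hU)
    (E.lintegral_nl_lt_top hU hU fU fU n) 0 t₀ t]
  ring


/-! ### Uniqueness of mild solutions -/

/-- On a short interval on which two mild solutions start equal, the difference has a
representative of smaller norm. -/
theorem Exponents.exists_smaller_representative {s b β : ℝ} (E : Exponents s b β) {κ T : ℝ}
    (hκ : κ = 1 ∨ κ = -1) {c : ℤ → ℂ} {U W : ℤ × ℝ → ℂ} (hU : Measurable U) (hW : Measurable W)
    (fU : xNormSq s b U < ⊤) (fW : xNormSq s b W < ⊤) (mU : IsMild κ T c U)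
    (mW : IsMild κ T c W) :
    ∃ δ : ℝ, 0 < δ ∧ ∀ t₀ ∈ Icc (-T) T, (∀ n, ift U t₀ n = ift W t₀ n) →
      ∀ Z : ℤ × ℝ → ℂ, Measurable Z → xNormSq 0 b Z < ⊤ →
      (∀ t ∈ Icc (-T) T ∩ Icc (t₀ - δ) (t₀ + δ), ∀ n, ift Z t n = ift U t n - ift W t n) →
      ∃ Z' : ℤ × ℝ → ℂ, Measurable Z' ∧ xNormSq 0 b Z' ≤ 2⁻¹ * xNormSq 0 b Z ∧
        ∀ t ∈ Icc (-T) T ∩ Icc (t₀ - δ) (t₀ + δ), ∀ n, ift Z' t n = ift U t n - ift W t n := by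
  obtain ⟨C, hC⟩ := E.xNormSq_duhOp_le
  have hX : C * (xNormSq s b U + xNormSq s b W) ≠ ⊤ :=
    ENNReal.mul_ne_top ENNReal.coe_ne_top (ENNReal.add_ne_top.2 ⟨fU.ne, fW.ne⟩)
  -- The length depends only on the norms of U and W, not on t₀ or Z, so the same step can be
  -- repeated along the whole interval.
  obtain ⟨δ, hδ, hδ', hgain⟩ := E.exists_gain_le hX (ε := 2⁻¹) (by norm_num)
  refine ⟨δ, hδ, fun t₀ h₀ heq Z hZ fZ hrep => ?_⟩
  have fZ' : xNormSq s b Z < ⊤ := (E.xNormSq_le Z).trans_lt fZ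
  -- The forcing is built from the representative Z rather than from U - W, so that its size is
  -- governed by the norm of Z.
  set k : ℤ × ℝ → ℂ := fun x => -Complex.I * κ * (nl Z U x + nl W Z x) with hk
  have m1 := measurable_nl hZ hU
  have m2 := measurable_nl hW hZ
  have mk : Measurable k := (m1.add m2).const_mul _
  have hkb : ∀ x, ‖k x‖ₑ ≤ conv (fun y => ‖Z y‖ₑ) (fun y => ‖U y‖ₑ) x +
      conv (fun y => ‖W y‖ₑ) (fun y => ‖Z y‖ₑ) x := fun x => by
    simp only [hk]
    rw [enorm_neg_I_mul hκ]
    exact (enorm_add_le _ _).trans (add_le_add (enorm_nl_le _ _ _) (enorm_nl_le _ _ _))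
  have fk : xNormSq 0 (-β) k < ⊤ := by
    obtain ⟨C', hC'⟩ := E.bilinear
    refine (hC' k Z U W Z hZ hU hW hZ (ae_of_all _ hkb)).trans_lt ?_
    exact ENNReal.mul_lt_top ENNReal.coe_lt_top (ENNReal.add_lt_top.2
      ⟨ENNReal.mul_lt_top fZ' fU, ENNReal.mul_lt_top fW fZ'⟩)
  refine ⟨duhOp δ t₀ k, measurable_duhOp δ t₀ mk, ?_, fun t ht n => ?_⟩
  · calc xNormSq 0 b (duhOp δ t₀ k) ≤ gain b β δ * (C * (xNormSq s b Z * xNormSq s b U +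
          xNormSq s b W * xNormSq s b Z)) :=
        hC δ t₀ hδ hδ' k Z U W Z mk hZ hU hW hZ (ae_of_all _ hkb)
      _ = (gain b β δ * (C * (xNormSq s b U + xNormSq s b W))) * xNormSq s b Z := by ring
      _ ≤ 2⁻¹ * xNormSq 0 b Z := by
        gcongr
        · exact hgain δ hδ le_rfl
        · exact E.xNormSq_le Z
  · have habs : |t - t₀| ≤ δ := abs_le.2 ⟨by linarith [ht.2.1], by linarith [ht.2.2]⟩
    -- The segment from t₀ to t stays in the interval where Z represents the difference, which is
    -- all that the Duhamel integral uses.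
    have hseg : ∀ r ∈ Set.uIcc t₀ t, ∀ m, ift Z r m = ift U r m - ift W r m := fun r hr m => by
      refine hrep r ?_ m
      have hcv : (Icc (-T) T ∩ Icc (t₀ - δ) (t₀ + δ)).OrdConnected :=
        ordConnected_Icc.inter ordConnected_Icc
      exact hcv.uIcc_subset ⟨h₀, by linarith, by linarith⟩ ht hr
    have hd := E.duhTerm_nl_sub hU hW hZ fU fW fZ' hseg n
    have e1 : duhTerm k t₀ t n = -Complex.I * κ *
        (duhTerm (nl Z U) t₀ t n + duhTerm (nl W Z) t₀ t n) := by
      rw [hk, duhTerm_const_mul]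
      congr 1
      exact duhTerm_fun_add m1 m2 (E.lintegral_nl_lt_top hZ hU fZ' fU n)
        (E.lintegral_nl_lt_top hW hZ fW fZ' n) t₀ t
    rw [ift_duhOp E.lt_half hδ hδ' habs mk fk, e1, hd]
    have hu := E.isMild_sub hU fU mU h₀ ht.1 n
    have hw := E.isMild_sub hW fW mW h₀ ht.1 n
    rw [heq n] at hu
    have hex := exp_free_mul n t
    have key : Complex.exp (Complex.I * ((n : ℝ) ^ 2 : ℝ) * t) * (ift U t n - ift W t n) =
      -Complex.I * κ * (duhTerm (nl U U) t₀ t n - duhTerm (nl W W) t₀ t n) := by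
      linear_combination hu - hw
    rw [← key]
    linear_combination (ift U t n - ift W t n) * hex

/-- Iteration gives representatives of the same difference with squared norms at most 2^{-k} times
the first. Each bounds the modes uniformly in time, so the difference is zero. -/
theorem Exponents.ift_eq_near {s b β : ℝ} (E : Exponents s b β) {κ T : ℝ}
    (hκ : κ = 1 ∨ κ = -1) {c : ℤ → ℂ} {U W : ℤ × ℝ → ℂ} (hU : Measurable U) (hW : Measurable W)
    (fU : xNormSq s b U < ⊤) (fW : xNormSq s b W < ⊤)
    (fUW : xNormSq 0 b (fun x => U x - W x) < ⊤) (mU : IsMild κ T c U) (mW : IsMild κ T c W) :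
    ∃ δ : ℝ, 0 < δ ∧ ∀ t₀ ∈ Icc (-T) T, (∀ n, ift U t₀ n = ift W t₀ n) →
      ∀ t ∈ Icc (-T) T ∩ Icc (t₀ - δ) (t₀ + δ), ∀ n, ift U t n = ift W t n := by
  obtain ⟨δ, hδ, h⟩ := E.exists_smaller_representative hκ hU hW fU fW mU mW
  refine ⟨δ, hδ, fun t₀ h₀ heq t ht n => ?_⟩
  set X := xNormSq 0 b (fun x => U x - W x) with hX
  have hk : ∀ k : ℕ, ∃ Z : ℤ × ℝ → ℂ, Measurable Z ∧ xNormSq 0 b Z ≤ 2⁻¹ ^ k * X ∧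
      ∀ t ∈ Icc (-T) T ∩ Icc (t₀ - δ) (t₀ + δ), ∀ n, ift Z t n = ift U t n - ift W t n := by
    intro k
    induction k with
    | zero => exact ⟨fun x => U x - W x, hU.sub hW, by simp [hX], fun t _ n =>
        ift_sub (E.integrable hU fU n) (E.integrable hW fW n) t⟩
    | succ k ih =>
      obtain ⟨Z, hZ, hZX, hZr⟩ := ih
      have fZ : xNormSq 0 b Z < ⊤ := hZX.trans_lt
        (ENNReal.mul_lt_top (ENNReal.pow_lt_top (by simp)) fUW)
      obtain ⟨Z', hZ', hZ'X, hZ'r⟩ := h t₀ h₀ heq Z hZ fZ hZr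
      refine ⟨Z', hZ', hZ'X.trans ?_, hZ'r⟩
      rw [pow_succ', mul_assoc]
      gcongr
  obtain ⟨C, hC⟩ := tsum_enorm_ift_sq_le E.half_lt
  have hle : ∀ k : ℕ, ‖ift U t n - ift W t n‖ₑ ^ 2 ≤ C * (2⁻¹ ^ k * X) := fun k => by
    obtain ⟨Z, hZ, hZX, hZr⟩ := hk k
    rw [← hZr t ht n]
    have h1 := (ENNReal.le_tsum n).trans (hC 0 Z t hZ)
    rw [mul_zero, wt_zero, one_mul] at h1
    exact h1.trans (mul_le_mul_right hZX _)
  have hlim : Tendsto (fun k : ℕ => (C : ℝ≥0∞) * (2⁻¹ ^ k * X)) atTop (𝓝 (C * (0 * X))) := by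
    refine ENNReal.Tendsto.const_mul (ENNReal.Tendsto.mul_const ?_ (Or.inr fUW.ne))
      (Or.inr ENNReal.coe_ne_top)
    exact ENNReal.tendsto_pow_atTop_nhds_zero_of_lt_one (by simp)
  rw [zero_mul, mul_zero] at hlim
  have h0 := ge_of_tendsto' hlim hle
  rw [nonpos_iff_eq_zero] at h0
  simpa [sub_eq_zero] using h0

/-- Uniqueness of mild solutions. -/
theorem Exponents.ift_eq_of_isMild {s b β : ℝ} (E : Exponents s b β) {κ T : ℝ}
    (hκ : κ = 1 ∨ κ = -1) {c : ℤ → ℂ} {U W : ℤ × ℝ → ℂ} (hU : Measurable U) (hW : Measurable W)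
    (fU : xNormSq s b U < ⊤) (fW : xNormSq s b W < ⊤)
    (fUW : xNormSq 0 b (fun x => U x - W x) < ⊤) (mU : IsMild κ T c U) (mW : IsMild κ T c W) :
    ∀ t ∈ Icc (-T) T, ∀ n, ift U t n = ift W t n := by
  obtain ⟨δ, hδ, h⟩ := E.ift_eq_near hκ hU hW fU fW fUW mU mW
  have hstep : ∀ k : ℕ, ∀ t ∈ Icc (-T) T, |t| ≤ k * δ → ∀ n, ift U t n = ift W t n := by
    intro k
    induction k with
    | zero =>
      intro t ht hk n
      have h0 : t = 0 := by simpa using hk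
      have hu := mU t ht n
      have hw := mW t ht n
      subst h0
      have e : ∀ k : ℤ × ℝ → ℂ, duhTerm k 0 0 n = 0 := fun k => by simp [duhTerm, eint]
      rw [e] at hu hw
      simpa using hu.trans hw.symm
    | succ k ih =>
      intro t ht hk n
      have hk1 : (0 : ℝ) < k + 1 := by positivity
      push_cast at hk
      -- The restart point tk/(k+1) is covered by the induction hypothesis and lies within δ of t.
      set q : ℝ := k / (k + 1) with hq
      have hq0 : 0 ≤ q := by positivity
      have hq1 : q ≤ 1 := by rw [hq, div_le_one hk1]; linarith
      have habs : |t| ≤ T := abs_le.2 ht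
      have h1 : |t * q| ≤ k * δ := by
        rw [abs_mul, abs_of_nonneg hq0]
        calc |t| * q ≤ ((k + 1) * δ) * q := by gcongr
          _ = k * δ := by rw [hq]; field_simp
      have h2 : t * q ∈ Icc (-T) T := by
        refine abs_le.1 ?_
        rw [abs_mul, abs_of_nonneg hq0]
        exact (mul_le_of_le_one_right (abs_nonneg t) hq1).trans habs
      have h3 : |t - t * q| ≤ δ := by
        have e : t - t * q = t * (k + 1 : ℝ)⁻¹ := by rw [hq]; field_simp; ring
        rw [e, abs_mul, abs_of_pos (inv_pos.2 hk1), ← div_eq_mul_inv, div_le_iff₀ hk1]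
        linarith
      rw [abs_le] at h3
      exact h (t * q) h2 (ih _ h2 h1) t ⟨ht, by linarith, by linarith⟩ n
  intro t ht n
  obtain ⟨k, hk⟩ := exists_nat_ge (|t| / δ)
  exact hstep k t ht ((div_le_iff₀ hδ).1 hk) n


/-! ### Contraction, the solution map and the conclusion -/

theorem ae_eq_of_xNormSq_sub {s b : ℝ} {G H : ℤ × ℝ → ℂ} (hG : Measurable G) (hH : Measurable H)
    (h : xNormSq s b (fun x => G x - H x) = 0) : ∀ᵐ x ∂freqMeasure, G x = H x := by
  have hm : Measurable fun x : ℤ × ℝ =>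
      wt (2 * b) (modn x) * wt (2 * s) x.1 * ‖G x - H x‖ₑ ^ 2 :=
    ((measurable_wt_comp _ measurable_modn).mul (measurable_wt_comp _ measurable_intCast_fst)).mul
      ((hG.sub hH).enorm.pow_const 2)
  have h1 := (lintegral_eq_zero_iff hm).1 h
  filter_upwards [h1] with x hx
  simpa [wt_ne_zero, sub_eq_zero] using hx

theorem freeExt_add_sub_freeExt_add (g₁ g₂ : Distr) (G H : ℤ × ℝ → ℂ) :
    (fun x => (freeExt (coeff g₁) x + G x) - (freeExt (coeff g₂) x + H x)) =
      fun x => freeExt (coeff (g₁ - g₂)) x + (G x - H x) := by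
  funext x
  have h : freeExt (coeff (g₁ - g₂)) x = freeExt (coeff g₁) x - freeExt (coeff g₂) x := by
    rw [freeExt_sub]
    simp only [← coeff_sub]
  rw [h]
  ring

/-- The contraction argument. -/
theorem Exponents.exists_fixedPoint {s b β : ℝ} (E : Exponents s b β) {κ : ℝ}
    (hκ : κ = 1 ∨ κ = -1) (M : ℝ≥0) :
    ∃ (C : ℝ≥0) (T₀ : ℝ), 0 < T₀ ∧ T₀ ≤ 1 ∧ ∀ T, 0 < T → T ≤ T₀ →
      ∃ S : Distr → ℤ × ℝ → ℂ,
        (∀ g, hsNorm s g ^ 2 ≤ M → Measurable (S g) ∧ xNormSq 0 b (S g) < ⊤ ∧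
          xNormSq 0 b (fun x => S g x -
            duhNl κ T 0 (fun y => freeExt (coeff g) y + S g y) x) = 0) ∧
        ∀ g₁ g₂, hsNorm s g₁ ^ 2 ≤ M → hsNorm s g₂ ^ 2 ≤ M →
          xNormSq 0 b (fun x => S g₁ x - S g₂ x) ≤ C * hsNorm s (g₁ - g₂) ^ 2 := by
  obtain ⟨C, hC⟩ := exists_xNormSq_freeExt_le E.lt_one
  obtain ⟨C₁, hC₁⟩ := E.xNormSq_duhNl_sub_le hκ
  -- C M bounds the free evolution, and 1 is the squared radius of the ball for the remainder.
  set Q : ℝ≥0∞ := C * M + 1 with hQ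
  have hQ1 : 1 ≤ Q := le_add_self
  have hQt : Q ≠ ⊤ := by simp [hQ, ENNReal.mul_eq_top]
  -- One constant serves twice: (2Q)² for mapping the ball to itself and, since Q ≥ 1, 4Q ≤ 4Q² for
  -- the contraction.
  have hX : C₁ * (4 * Q * Q) ≠ ⊤ := ENNReal.mul_ne_top ENNReal.coe_ne_top
    (ENNReal.mul_ne_top (ENNReal.mul_ne_top (by simp) hQt) hQt)
  obtain ⟨T₀, hT₀, hT₁, hgain⟩ := E.exists_gain_le hX (ε := (1 / 2) ^ 2)
    (ENNReal.pow_pos (by simp) 2)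
  refine ⟨C, T₀, hT₀, hT₁, fun T hT hTT => ?_⟩
  have hT1 : T ≤ 1 := hTT.trans hT₁
  have hA := fun g => measurable_freeExt (coeff g)
  have mF : ∀ {g : Distr} {G : ℤ × ℝ → ℂ}, Measurable G →
      Measurable fun y => freeExt (coeff g) y + G y := fun {g G} hG => (hA g).add hG
  have bF : ∀ {g : Distr} {G : ℤ × ℝ → ℂ}, hsNorm s g ^ 2 ≤ M → Measurable G →
      xNormSq 0 b G ≤ 1 → xNormSq s b (fun y => freeExt (coeff g) y + G y) ≤ 2 * Q := by
    intro g G hg hG hG1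
    refine (xNormSq_add_le (hA g) hG).trans (mul_le_mul_right (add_le_add ?_ ?_) _)
    · exact (hC s g).trans (by gcongr)
    · exact (E.xNormSq_le G).trans hG1
  have ltF : ∀ {x : ℝ≥0∞}, x ≤ 2 * Q → x < ⊤ := fun h =>
    h.trans_lt (ENNReal.mul_lt_top (by simp) hQt.lt_top)
  have diff : ∀ {U W : ℤ × ℝ → ℂ}, Measurable U → Measurable W → xNormSq s b U ≤ 2 * Q →
      xNormSq s b W ≤ 2 * Q → xNormSq 0 b (fun x => duhNl κ T 0 U x - duhNl κ T 0 W x) ≤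
        (1 / 2) ^ 2 * xNormSq s b fun x => U x - W x := by
    intro U W hU hW bU bW
    refine (hC₁ T 0 hT hT1 U W hU hW (ltF bU) (ltF bW)).trans ?_
    calc _ ≤ gain b β T * (C₁ * ((2 * Q + 2 * Q) * 1 * xNormSq s b fun x => U x - W x)) := by
          rw [mul_one]; gcongr
      _ ≤ gain b β T * (C₁ * ((2 * Q + 2 * Q) * Q * xNormSq s b fun x => U x - W x)) := by gcongr
      _ = gain b β T * (C₁ * (4 * Q * Q)) * xNormSq s b fun x => U x - W x := by ring
      _ ≤ _ := by gcongr; exact hgain T hT hTT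
  have fix : ∀ g : Distr, hsNorm s g ^ 2 ≤ M → ∃ G : ℤ × ℝ → ℂ, Measurable G ∧ xNormSq 0 b G ≤ 1 ∧
      xNormSq 0 b (fun x => G x - duhNl κ T 0 (fun y => freeExt (coeff g) y + G y) x) = 0 := by
    intro g hg
    refine exists_fixedPoint_xNormSq b
      (Ψ := fun G => duhNl κ T 0 fun y => freeExt (coeff g) y + G y)
      (fun G hG => measurable_duhNl κ T 0 (mF hG)) (fun G hG hG1 => ?_)
      (fun G H hG hH hG1 hH1 => ?_)
    -- The difference estimate against 0 gives the quadratic bound.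
    · have h1 := hC₁ T 0 hT hT1 _ _ (mF (g := g) hG) measurable_const (ltF (bF hg hG hG1))
        (by rw [xNormSq_zero]; simp)
      rw [duhNl_zero, xNormSq_zero] at h1
      simp only [sub_zero, add_zero] at h1
      refine h1.trans ?_
      calc _ ≤ gain b β T * (C₁ * ((2 * Q) * (2 * Q))) := by gcongr <;> exact bF hg hG hG1
        _ = gain b β T * (C₁ * (4 * Q * Q)) := by ring
        _ ≤ (1 / 2) ^ 2 := hgain T hT hTT
        _ ≤ 1 := pow_le_one₀ (by simp) (by simp)
    · refine (diff (mF hG) (mF hH) (bF hg hG hG1) (bF hg hH hH1)).trans ?_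
      simp only [add_sub_add_left_eq_sub]
      gcongr
      exact E.xNormSq_le _
  choose! S hS using fix
  refine ⟨S, fun g hg => ⟨(hS g hg).1, (hS g hg).2.1.trans_lt ENNReal.one_lt_top,
    (hS g hg).2.2⟩, fun g₁ g₂ h₁ h₂ => ?_⟩
  obtain ⟨m₁, b₁, z₁⟩ := hS g₁ h₁
  obtain ⟨m₂, b₂, z₂⟩ := hS g₂ h₂
  set D := xNormSq 0 b (fun x => S g₁ x - S g₂ x) with hD
  have hDt : D ≠ ⊤ := ((xNormSq_sub_le m₁ m₂).trans_lt (ENNReal.mul_lt_top (by simp)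
    (ENNReal.add_lt_top.2 ⟨b₁.trans_lt ENNReal.one_lt_top, b₂.trans_lt ENNReal.one_lt_top⟩))).ne
  have e1 := ae_eq_of_xNormSq_sub m₁ (measurable_duhNl κ T 0 (mF m₁)) z₁
  have e2 := ae_eq_of_xNormSq_sub m₂ (measurable_duhNl κ T 0 (mF m₂)) z₂
  have d1 : D ≤ (1 / 2) ^ 2 * xNormSq s b (fun x => (freeExt (coeff g₁) x + S g₁ x) -
      (freeExt (coeff g₂) x + S g₂ x)) := by
    refine le_trans (sqNorm_mono ?_)
      (diff (mF m₁) (mF m₂) (bF h₁ m₁ b₁) (bF h₂ m₂ b₂))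
    filter_upwards [e1, e2] with x hx hx'
    rw [hx, hx']
  have d2 : xNormSq s b (fun x => (freeExt (coeff g₁) x + S g₁ x) -
      (freeExt (coeff g₂) x + S g₂ x)) ≤ 2 * (C * hsNorm s (g₁ - g₂) ^ 2 + D) := by
    rw [freeExt_add_sub_freeExt_add]
    refine (xNormSq_add_le (hA _) (m₁.sub m₂)).trans ?_
    gcongr
    · exact hC s _
    · exact E.xNormSq_le _
  set a := C * hsNorm s (g₁ - g₂) ^ 2
  -- This reads D ≤ (a + D)/2. As D is finite it can be absorbed, leaving D ≤ a, so the Lipschitz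
  -- constant is that of the free evolution.
  have d3 : D ≤ (1 / 2) ^ 2 * (2 * (a + D)) := d1.trans (by gcongr)
  rcases eq_or_ne a ⊤ with ha | ha
  · rw [ha]; exact le_top
  · have d4 := ENNReal.toReal_mono (by simp [ENNReal.mul_eq_top, ha, hDt]) d3
    rw [ENNReal.toReal_mul, ENNReal.toReal_mul, ENNReal.toReal_add ha hDt] at d4
    rw [← ENNReal.toReal_le_toReal hDt ha]
    norm_num at d4
    linarith

/-- The distribution with Fourier coefficients `ift U t`. -/
def fromFreq (U : ℤ × ℝ → ℂ) (t : ℝ) : Distr :=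
  open Classical in
  if h : ∃ K : ℝ, ∀ n, ‖ift U t n‖ ≤ K * (1 + (n : ℝ) ^ 2) then ofCoeff (ift U t) h else 0

theorem Exponents.coeff_fromFreq {s b β : ℝ} (E : Exponents s b β) {U : ℤ × ℝ → ℂ}
    (hU : Measurable U) (fU : xNormSq s b U < ⊤) (t : ℝ) (n : ℤ) :
    coeff (fromFreq U t) n = ift U t n := by
  obtain ⟨K, hK⟩ := E.exists_norm_ift_le hU fU
  rw [fromFreq, dif_pos ⟨K, hK t⟩, coeff_ofCoeff]

theorem weightedNorm_sq {b : ℝ} (G : ℤ → ℝ → ℂ) : weightedNorm 0 b G ^ 2 =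
    ∑' n : ℤ, ∫⁻ τ : ℝ, wt (2 * b) (τ + (n : ℝ) ^ 2) * ‖G n τ‖ₑ ^ 2 := by
  rw [weightedNorm, ← ENNReal.rpow_natCast, ← ENNReal.rpow_mul]
  norm_num [wt]

theorem xNormSq_zero_eq_tsum {b : ℝ} {G : ℤ × ℝ → ℂ} (hG : Measurable G) : xNormSq 0 b G =
    ∑' n : ℤ, ∫⁻ τ : ℝ, wt (2 * b) (τ + (n : ℝ) ^ 2) * ‖G (n, τ)‖ₑ ^ 2 := by
  rw [xNormSq, sqNorm_eq_tsum hG.enorm]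
  simp [wt_zero]

/-- An extension is only almost everywhere measurable on each slice. Choosing measurable versions
slice by slice yields joint measurability because ℤ is countable, and changes neither the norm nor
the inverse transforms. -/
theorem exists_measurable_of_isExtension {b T : ℝ} {V : ℝ → ℤ → ℂ} {G : ℤ → ℝ → ℂ}
    (h : IsExtension T V G) (hG : weightedNorm 0 b G < ⊤) :
    ∃ H : ℤ × ℝ → ℂ, Measurable H ∧ xNormSq 0 b H < ⊤ ∧
      ∀ t ∈ Icc (-T) T, ∀ n, V t n = ift H t n := by
  have hs := fun n => (h.1 n).aestronglyMeasurable
  have hm : Measurable fun x : ℤ × ℝ => (hs x.1).mk (G x.1) x.2 :=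
    measurable_from_prod_countable_right fun n => (hs n).stronglyMeasurable_mk.measurable
  have hae : ∀ n, (fun τ => (hs n).mk (G n) τ) =ᵐ[volume] G n := fun n => (hs n).ae_eq_mk.symm
  refine ⟨fun x => (hs x.1).mk (G x.1) x.2, hm, ?_, fun t ht n => ?_⟩
  · have e : xNormSq 0 b (fun x : ℤ × ℝ => (hs x.1).mk (G x.1) x.2) = weightedNorm 0 b G ^ 2 := by
      rw [xNormSq_zero_eq_tsum hm, weightedNorm_sq]
      refine tsum_congr fun n => lintegral_congr_ae ?_
      filter_upwards [hae n] with τ hτ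
      rw [hτ]
    rw [e]
    exact ENNReal.pow_lt_top hG
  · rw [h.2 t ht n, ift]
    congr 1
    refine integral_congr_ae ?_
    filter_upwards [hae n] with τ hτ
    rw [hτ]

theorem sq_xNorm_le {b T : ℝ} (hb : 1 / 2 < b) {V : ℝ → ℤ → ℂ} {H : ℤ × ℝ → ℂ}
    (hH : Measurable H) (fH : xNormSq 0 b H < ⊤)
    (h : ∀ t ∈ Icc (-T) T, ∀ n, V t n = ift H t n) : xNorm 0 b T V ^ 2 ≤ xNormSq 0 b H := by
  have hext : IsExtension T V fun n τ => H (n, τ) := ⟨integrable_slice hb hH fH, h⟩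
  rw [xNormSq_zero_eq_tsum hH, ← weightedNorm_sq]
  gcongr
  exact iInf₂_le _ hext

theorem exists_of_inY {b T : ℝ} {f : Distr} {u : ℝ → Distr} (h : InY b T f u) :
    ∃ H : ℤ × ℝ → ℂ, Measurable H ∧ xNormSq 0 b H < ⊤ ∧
      ∀ t ∈ Icc (-T) T, ∀ n, remainder f u t n = ift H t n := by
  unfold InY xNorm at h
  simp only [iInf_lt_iff] at h
  obtain ⟨G, hG, hlt⟩ := h
  exact exists_measurable_of_isExtension hG hlt

theorem Exponents.ift_free_add {s b β : ℝ} (E : Exponents s b β) {g : Distr}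
    (hg : hsNorm s g < ⊤) {H : ℤ × ℝ → ℂ} (hH : Measurable H) (fH : xNormSq 0 b H < ⊤) {t : ℝ}
    (ht : |t| ≤ 1) (n : ℤ) :
    ift (fun x => freeExt (coeff g) x + H x) t n = freeCoeff g t n + ift H t n := by
  obtain ⟨C, hC⟩ := exists_xNormSq_freeExt_le E.lt_one
  have fA : xNormSq s b (freeExt (coeff g)) < ⊤ := (hC s g).trans_lt
    (ENNReal.mul_lt_top ENNReal.coe_lt_top (ENNReal.pow_lt_top hg))
  rw [ift_add (E.integrable (measurable_freeExt _) fA n)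
    (integrable_slice E.half_lt hH fH n), ift_freeExt _ ht]
  rfl

theorem Exponents.xNormSq_free_add_lt_top {s b β : ℝ} (E : Exponents s b β) {g : Distr}
    (hg : hsNorm s g < ⊤) {H : ℤ × ℝ → ℂ} (hH : Measurable H) (fH : xNormSq 0 b H < ⊤) :
    xNormSq s b (fun x => freeExt (coeff g) x + H x) < ⊤ := by
  obtain ⟨C, hC⟩ := exists_xNormSq_freeExt_le E.lt_one
  have fA : xNormSq s b (freeExt (coeff g)) < ⊤ := (hC s g).trans_lt
    (ENNReal.mul_lt_top ENNReal.coe_lt_top (ENNReal.pow_lt_top hg))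
  exact (xNormSq_add_le (measurable_freeExt _) hH).trans_lt (ENNReal.mul_lt_top (by simp)
    (ENNReal.add_lt_top.2 ⟨fA, (E.xNormSq_le H).trans_lt fH⟩))

/-- A fixed point of the Duhamel operator is a mild solution. -/
theorem Exponents.isMild_of_fixedPoint {s b β : ℝ} (E : Exponents s b β) {κ : ℝ}
    (hκ : κ = 1 ∨ κ = -1) {T : ℝ} (hT : 0 < T) (hT1 : T ≤ 1) {g : Distr} (hg : hsNorm s g < ⊤)
    {H : ℤ × ℝ → ℂ} (hH : Measurable H) (fH : xNormSq 0 b H < ⊤)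
    (h : xNormSq 0 b (fun x => H x - duhNl κ T 0 (fun y => freeExt (coeff g) y + H y) x) = 0) :
    IsMild κ T (coeff g) fun x => freeExt (coeff g) x + H x := by
  intro t ht n
  have hta : |t| ≤ T := abs_le.2 ht
  set U : ℤ × ℝ → ℂ := fun x => freeExt (coeff g) x + H x with hU
  have mU : Measurable U := (measurable_freeExt _).add hH
  have fU : xNormSq s b U < ⊤ := E.xNormSq_free_add_lt_top hg hH fH
  have mD : Measurable (duhNl κ T 0 U) := measurable_duhNl κ T 0 mU
  -- The fixed point relation holds almost everywhere, so finiteness is inherited from H without a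
  -- further estimate.
  have fD : xNormSq 0 b (duhNl κ T 0 U) < ⊤ := by
    refine lt_of_le_of_lt (sqNorm_mono ?_) fH
    filter_upwards [ae_eq_of_xNormSq_sub hH mD h] with x hx
    rw [hx]
  have e1 : ift H t n = ift (duhNl κ T 0 U) t n := by
    have := ift_eq_zero E.half_lt (hH.sub mD) h t n
    rw [← sub_eq_zero, ← ift_sub (integrable_slice E.half_lt hH fH n)
      (integrable_slice E.half_lt mD fD n)]
    exact this
  rw [hU, E.ift_free_add hg hH fH (hta.trans hT1), e1, duhNl,
    ift_duhOp E.lt_half hT hT1 (by rwa [sub_zero]) ((measurable_nl mU mU).const_mul _)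
      (E.mul_nl_lt_top hκ mU mU fU fU), duhTerm_const_mul, freeCoeff]
  have := exp_free_mul n t
  linear_combination (coeff g n - Complex.I * κ * duhTerm (nl U U) 0 t n) * this

theorem IsMild.ift_zero {κ T : ℝ} (hT : 0 < T) {c : ℤ → ℂ} {U : ℤ × ℝ → ℂ} (h : IsMild κ T c U)
    (n : ℤ) : ift U 0 n = c n := by
  have h0 := h 0 ⟨by linarith, hT.le⟩ n
  have e : duhTerm (nl U U) 0 0 n = 0 := by simp [duhTerm, eint]
  rw [e] at h0
  simpa using h0

/-- A fixed point of the Duhamel operator gives the unique solution. -/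
theorem Exponents.isUniqueSolution {s b β : ℝ} (E : Exponents s b β) {κ : ℝ}
    (hκ : κ = 1 ∨ κ = -1) {T : ℝ} (hT : 0 < T) (hT1 : T ≤ 1) {g : Distr} (hg : hsNorm s g < ⊤)
    {H : ℤ × ℝ → ℂ} (hH : Measurable H) (fH : xNormSq 0 b H < ⊤)
    (h : xNormSq 0 b (fun x => H x - duhNl κ T 0 (fun y => freeExt (coeff g) y + H y) x) = 0) :
    IsUniqueSolution κ b T g (fromFreq fun x => freeExt (coeff g) x + H x) := by
  have mild := E.isMild_of_fixedPoint hκ hT hT1 hg hH fH h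
  have eU := fun t (ht : t ∈ Icc (-T) T) (n : ℤ) =>
    E.ift_free_add hg hH fH ((abs_le.2 ht).trans hT1) n
  have fU := E.xNormSq_free_add_lt_top hg hH fH
  have mU : Measurable fun x => freeExt (coeff g) x + H x := (measurable_freeExt _).add hH
  set U : ℤ × ℝ → ℂ := fun x => freeExt (coeff g) x + H x with hU
  obtain ⟨K, hK, adm⟩ := E.admissible mU fU
  obtain ⟨K', hK'⟩ := E.exists_norm_ift_le mU fU
  have cf := E.coeff_fromFreq mU fU
  refine ⟨⟨?_, ?_⟩, fun w hw hsol t ht => ?_⟩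
  · have h1 := sq_xNorm_le (V := remainder g (fromFreq U)) (T := T) E.half_lt hH fH
      fun t ht n => by
        rw [remainder, cf, eU t ht]
        ring
    have h2 := h1.trans_lt fH
    by_contra hc
    rw [InY, not_lt, top_le_iff] at hc
    rw [hc] at h2
    simp at h2
  · refine adm.isSolution_of_duhamel hK hT (Distr.ext_coeff fun n => ?_) (fun t _ n => cf t n)
      (fun t _ n => hK' t n) mild
    rw [cf, mild.ift_zero hT]
  · obtain ⟨G, mG, fG, hG⟩ := exists_of_inY hw
    have eW := fun t (ht : t ∈ Icc (-T) T) (n : ℤ) =>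
      E.ift_free_add hg mG fG ((abs_le.2 ht).trans hT1) n
    have fW := E.xNormSq_free_add_lt_top hg mG fG
    have mW : Measurable fun x => freeExt (coeff g) x + G x := (measurable_freeExt _).add mG
    have cw : ∀ t ∈ Icc (-T) T, ∀ n,
        coeff (w t) n = ift (fun x => freeExt (coeff g) x + G x) t n := fun t ht n => by
      rw [eW t ht, ← hG t ht, remainder]
      ring
    obtain ⟨KW, hKW, admW⟩ := E.admissible mW fW
    have mildW : IsMild κ T (coeff g) fun x => freeExt (coeff g) x + G x := fun t ht n =>
      admW.duhamel_of_isSolution hKW hT cw hsol ht n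
    -- The free parts coincide and cancel: the solutions lie only in X^{s,b}, but their difference
    -- lies in X^{0,b}, as uniqueness requires.
    have fD : xNormSq 0 b (fun x => (freeExt (coeff g) x + G x) - U x) < ⊤ := by
      simp only [hU, add_sub_add_left_eq_sub]
      exact (xNormSq_sub_le mG hH).trans_lt
        (ENNReal.mul_lt_top (by simp) (ENNReal.add_lt_top.2 ⟨fG, fH⟩))
    refine Distr.ext_coeff fun n => ?_
    rw [cw t ht, cf]
    exact E.ift_eq_of_isMild hκ mW mU fW fU fD mildW mild t ht n

theorem le_mul_of_sq_le {x y : ℝ≥0∞} {L : ℝ≥0} (h : x ^ 2 ≤ L * y ^ 2) : x ≤ (L + 1 : ℝ≥0) * y := by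
  rw [← ENNReal.pow_le_pow_left_iff two_ne_zero, mul_pow]
  refine h.trans ?_
  gcongr
  rw [← ENNReal.coe_pow, ENNReal.coe_le_coe]
  nlinarith [zero_le (a := L), zero_le (a := L ^ 2)]

/-- Local well-posedness on bounded sets of data. -/
theorem Exponents.exists_flow {s b β : ℝ} (E : Exponents s b β) {κ : ℝ}
    (hκ : κ = 1 ∨ κ = -1) (M : ℝ≥0) :
    ∃ T₀ : ℝ, 0 < T₀ ∧ ∀ T, 0 < T → T ≤ T₀ → ∃ (Φ : Distr → ℝ → Distr) (L : ℝ≥0),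
      (∀ g, hsNorm s g ^ 2 ≤ M → IsUniqueSolution κ b T g (Φ g)) ∧
      ∀ g₁ g₂, hsNorm s g₁ ^ 2 ≤ M → hsNorm s g₂ ^ 2 ≤ M →
        xNorm 0 b T (fun t n => remainder g₁ (Φ g₁) t n - remainder g₂ (Φ g₂) t n)
            ≤ L * hsNorm s (g₁ - g₂) ∧
          ∀ t ∈ Icc (-T) T, hsNorm s (Φ g₁ t - Φ g₂ t) ≤ L * hsNorm s (g₁ - g₂) := by
  obtain ⟨C, T₀, hT₀, hT₁, h⟩ := E.exists_fixedPoint hκ M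
  obtain ⟨C₁, hC₁⟩ := tsum_enorm_ift_sq_le E.half_lt
  obtain ⟨C₂, hC₂⟩ := exists_xNormSq_freeExt_le E.lt_one
  refine ⟨T₀, hT₀, fun T hT hTT => ?_⟩
  have hT1 : T ≤ 1 := hTT.trans hT₁
  obtain ⟨S, hS, hL⟩ := h T hT hTT
  have fin : ∀ {g : Distr}, hsNorm s g ^ 2 ≤ M → hsNorm s g < ⊤ := fun {g} hg => by
    by_contra hc
    rw [not_lt, top_le_iff] at hc
    rw [hc] at hg
    simp at hg
  -- C₁ is the constant of the embedding into H^s, 2 comes from the squared triangle inequality, C₂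
  -- from the free evolution and C from the remainder.
  set L₂ : ℝ≥0 := C₁ * (2 * (C₂ + C)) with hL₂
  refine ⟨fun g => fromFreq fun x => freeExt (coeff g) x + S g x, (C + 1) + (L₂ + 1),
    fun g hg => ?_, fun g₁ g₂ h₁ h₂ => ⟨?_, fun t ht => ?_⟩⟩
  · obtain ⟨m, f, z⟩ := hS g hg
    exact E.isUniqueSolution hκ hT hT1 (fin hg) m f z
  all_goals
    obtain ⟨m₁, f₁, -⟩ := hS g₁ h₁
    obtain ⟨m₂, f₂, -⟩ := hS g₂ h₂
    have mU₁ : Measurable fun x => freeExt (coeff g₁) x + S g₁ x := (measurable_freeExt _).add m₁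
    have mU₂ : Measurable fun x => freeExt (coeff g₂) x + S g₂ x := (measurable_freeExt _).add m₂
    have fU₁ := E.xNormSq_free_add_lt_top (fin h₁) m₁ f₁
    have fU₂ := E.xNormSq_free_add_lt_top (fin h₂) m₂ f₂
    have hD := hL g₁ g₂ h₁ h₂
    have fD : xNormSq 0 b (fun x => S g₁ x - S g₂ x) < ⊤ := (xNormSq_sub_le m₁ m₂).trans_lt
      (ENNReal.mul_lt_top (by simp) (ENNReal.add_lt_top.2 ⟨f₁, f₂⟩))
  · have h1 := (sq_xNorm_le (T := T) (V := fun t n => remainder g₁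
      (fromFreq fun x => freeExt (coeff g₁) x + S g₁ x) t n - remainder g₂
      (fromFreq fun x => freeExt (coeff g₂) x + S g₂ x) t n) E.half_lt (m₁.sub m₂) fD
      fun t ht n => by
        have hta := (abs_le.2 ht).trans hT1
        rw [remainder, remainder, E.coeff_fromFreq mU₁ fU₁, E.coeff_fromFreq mU₂ fU₂,
          E.ift_free_add (fin h₁) m₁ f₁ hta, E.ift_free_add (fin h₂) m₂ f₂ hta]
        have := ift_sub (integrable_slice E.half_lt m₁ f₁ n) (integrable_slice E.half_lt m₂ f₂ n) t
        refine Eq.trans ?_ this.symm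
        ring).trans hD
    refine (le_mul_of_sq_le h1).trans ?_
    exact mul_le_mul_left (ENNReal.coe_le_coe.2 le_self_add) _
  · have e1 : hsNorm s (fromFreq (fun x => freeExt (coeff g₁) x + S g₁ x) t -
        fromFreq (fun x => freeExt (coeff g₂) x + S g₂ x) t) ^ 2 =
        ∑' n : ℤ, wt (2 * s) n * ‖ift (fun x => (freeExt (coeff g₁) x + S g₁ x) -
          (freeExt (coeff g₂) x + S g₂ x)) t n‖ₑ ^ 2 := by
      rw [hsNorm_sq]
      refine tsum_congr fun n => ?_
      rw [coeff_sub, E.coeff_fromFreq mU₁ fU₁, E.coeff_fromFreq mU₂ fU₂,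
        ift_sub (E.integrable mU₁ fU₁ n) (E.integrable mU₂ fU₂ n)]
    have e3 : hsNorm s (fromFreq (fun x => freeExt (coeff g₁) x + S g₁ x) t -
        fromFreq (fun x => freeExt (coeff g₂) x + S g₂ x) t) ^ 2 ≤
        L₂ * hsNorm s (g₁ - g₂) ^ 2 := by
      rw [e1]
      refine (hC₁ s _ t (mU₁.sub mU₂)).trans ?_
      change C₁ * xNormSq s b (fun x => (freeExt (coeff g₁) x + S g₁ x) -
        (freeExt (coeff g₂) x + S g₂ x)) ≤ _
      rw [freeExt_add_sub_freeExt_add]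
      calc _ ≤ C₁ * (2 * (C₂ * hsNorm s (g₁ - g₂) ^ 2 + C * hsNorm s (g₁ - g₂) ^ 2)) := by
            gcongr
            refine (xNormSq_add_le (measurable_freeExt _) (m₁.sub m₂)).trans ?_
            gcongr
            · exact hC₂ s _
            · exact (E.xNormSq_le _).trans hD
        _ = _ := by rw [hL₂]; push_cast; ring
    refine (le_mul_of_sq_le e3).trans ?_
    exact mul_le_mul_left (ENNReal.coe_le_coe.2 le_add_self) _

theorem hsNorm_sq_le (s : ℝ) (g f : Distr) :
    hsNorm s g ^ 2 ≤ 2 * (hsNorm s (g - f) ^ 2 + hsNorm s f ^ 2) := by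
  rw [hsNorm_sq, hsNorm_sq, hsNorm_sq, ← ENNReal.tsum_add, ← ENNReal.tsum_mul_left]
  refine ENNReal.tsum_le_tsum fun n => ?_
  have h : ‖coeff g n‖ₑ ≤ ‖coeff (g - f) n‖ₑ + ‖coeff f n‖ₑ := by
    have e : coeff g n = coeff (g - f) n + coeff f n := by rw [coeff_sub]; ring
    rw [e]
    exact enorm_add_le _ _
  calc _ ≤ wt (2 * s) n * (2 * (‖coeff (g - f) n‖ₑ ^ 2 + ‖coeff f n‖ₑ ^ 2)) := by
        gcongr
        exact (pow_le_pow_left₀ zero_le h 2).trans (add_sq_le_two _ _)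
    _ = _ := by ring

end NLSTorus

end

open NLSTorus
theorem theorem1 (κ : ℝ) (hκ : κ = 1 ∨ κ = -1) (s₀ : ℝ) (hs₀ : -(1 / 2) < s₀) (hs₀' : s₀ ≤ 0)
    (f : Distr) (hf : MemHs s₀ f) :
    ∃ b T : ℝ, 1 / 2 < b ∧ 0 < T ∧
      (∃ u : ℝ → Distr, IsUniqueSolution κ b T f u) ∧
      ∀ T' : ℝ, 0 < T' → T' < T →
        ∃ R : ℝ, 0 < R ∧ ∃ (Φ : Distr → ℝ → Distr) (L : ℝ≥0),
          (∀ g : Distr, MemHs s₀ g → hsNorm s₀ (g - f) < ENNReal.ofReal R →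
            IsUniqueSolution κ b T' g (Φ g)) ∧
          ∀ g₁ g₂ : Distr,
            MemHs s₀ g₁ → hsNorm s₀ (g₁ - f) < ENNReal.ofReal R →
            MemHs s₀ g₂ → hsNorm s₀ (g₂ - f) < ENNReal.ofReal R →
            xNorm 0 b T' (fun t n => remainder g₁ (Φ g₁) t n - remainder g₂ (Φ g₂) t n)
                ≤ L * hsNorm s₀ (g₁ - g₂) ∧
              ∀ t ∈ Icc (-T') T', hsNorm s₀ (Φ g₁ t - Φ g₂ t) ≤ L * hsNorm s₀ (g₁ - g₂) := by
  obtain ⟨b, β, E⟩ := exists_exponents hs₀ hs₀'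
  -- M bounds the squared norm of every datum within distance 1 of f. The existence time depends
  -- only on M, so one T serves all these data.
  set M : ℝ≥0∞ := 2 * (1 + hsNorm s₀ f ^ 2) with hM
  have hMt : M ≠ ⊤ := (ENNReal.mul_lt_top (by simp)
    (ENNReal.add_lt_top.2 ⟨ENNReal.one_lt_top, ENNReal.pow_lt_top hf⟩)).ne
  obtain ⟨T, hT, hflow⟩ := E.exists_flow hκ M.toNNReal
  rw [ENNReal.coe_toNNReal hMt] at hflow
  have hfM : hsNorm s₀ f ^ 2 ≤ M := by
    rw [hM, two_mul]
    exact le_add_self.trans le_self_add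
  have hgM : ∀ g : Distr, hsNorm s₀ (g - f) < ENNReal.ofReal 1 → hsNorm s₀ g ^ 2 ≤ M :=
    fun g hg => by
      refine (hsNorm_sq_le s₀ g f).trans ?_
      rw [hM]
      gcongr
      rw [ENNReal.ofReal_one] at hg
      exact pow_le_one₀ zero_le hg.le
  -- The radius 1 works for every T', since the flow exists on each interval no longer than T for
  -- all data bounded by M.
  refine ⟨b, T, E.half_lt, hT, ?_, fun T' hT' hTT' => ⟨1, one_pos, ?_⟩⟩
  · obtain ⟨Φ, L, h, -⟩ := hflow T hT le_rfl
    exact ⟨Φ f, h f hfM⟩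
  · obtain ⟨Φ, L, h, hL⟩ := hflow T' hT' hTT'.le
    exact ⟨Φ, L, fun g _ hg => h g (hgM g hg), fun g₁ g₂ _ h₁ _ h₂ =>
      hL g₁ g₂ (hgM g₁ h₁) (hgM g₂ h₂)⟩
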